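/- Let $X$ be a totally disconnected, compact, metrisable space and let $\varphi,\sigma$ be homeomorphisms of $X$ with $\sigma^2=\mathrm{id}$ and $\sigma\varphi\sigma=\varphi^{-1}$. Assume that the set of points of $X$ that are not periodic for $\varphi$ is dense in $X$, and that $\sigma$ does not preserve any $\varphi$-orbit. Let $Z=(X\times\mathbb R)/D_\infty$ be the quotient (with the quotient topology) by the diagonal action of the infinite dihedral group $D_\infty=\mathbb Z\rtimes\mathbb Z/2$ given by $(n,j)\cdot(x,t)=(\varphi^n\sigma^j(x),(-1)^jt-n)$, with projection $\pi_Z\colon X\times\mathbb R\to Z$. For a clopen $C\subset X$ and an open interval $I\subset\mathbb R$ such that $\pi_Z$ is injective on $C\times I$, call $Z_{C,I}=\pi_Z(C\times I)$ a chart. A map $f$ is dyadic PL on an open set $U\subset\mathbb R$ if there is a finite set $\Sigma\subset U\cap\mathbb Z[\frac12]$ such that on each connected component of $U\setminus\Sigma$ it has the form $x\mapsto 2^nx+b$ with $n\in\mathbb Z$, $b\in\mathbb Z[\frac12]$. A homeomorphism $f\colon I\to J$ between bounded open intervals with endpoints in $\mathbb Z[\frac12]$ is of type $\mathfrak D$ if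 there is a finite set $B\subset I$ such that every point of $I\setminus B$ has an open neighbourhood on which $f$ is dyadic PL, and every $x_0\in B$ satisfies $x_0,f(x_0)\in\mathbb Z[\frac12]$ and $f\circ h_{x_0}=h_{f(x_0)}\circ f$ on a neighbourhood of $x_0$, where $h_{c}(x)=2(x-c)+c$. Let $G=\mathscr T(\varphi,\sigma)$ be the group of homeomorphisms $g$ of $Z$ such that for every $z\in Z$ there are charts $Z_{C,I}\ni z$ and $Z_{C,J}\ni g(z)$ (with the same $C$) and a homeomorphism $f\colon I\to J$ of type $\mathfrak D$ such that $g(Z_{C,I})=Z_{C,J}$ and $g(\pi_Z(x,t))=\pi_Z(x,f(t))$ for all $(x,t)\in C\times I$. For $g\in G$ let $\operatorname{supp}(g)=\{z\in Z: g(z)\neq z\}$, and for an open $U\subset Z$ let $G_U$ be the subgroup of all $g\in G$ with $\operatorname{supp}(g)\subset U$. **Proposition 4.7 (fragmentation).** For every $g\in G$ and every family $\mathcal U$ of open subsets of $Z$ that covers $\overline{\operatorname{supp}(g)}$, we have $$g\in\Big\langle\bigcup_{U\in\mathcal U}G_U\Big\rangle .$$ Moreover, the group $G$ is perfect, that is,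 $G=[G,G]$. -/

import Mathlib

open Set Filter Topology

namespace SolenoidalThompson

/-! ### Dyadic piecewise linear maps and maps of type `𝔇` -/

/-- `x ∈ ℤ[1/2]`. -/
def IsDyadic (x : ℝ) : Prop := ∃ (m : ℤ) (k : ℕ), x = m / 2 ^ k

/-- Open (bounded, non-empty) intervals with dyadic endpoints. -/
def IsDyadicInterval (I : Set ℝ) : Prop :=
  ∃ a b : ℝ, IsDyadic a ∧ IsDyadic b ∧ a < b ∧ I = Ioo a b

/-- `f` is dyadic PL on `U`: there is a finite set `S ⊆ U` of dyadic rationals such that on each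
connected component of `U ∖ S` the map `f` is `x ↦ 2 ^ n * x + b` with `n ∈ ℤ` and `b ∈ ℤ[1/2]`. -/
def IsDyadicPLOn (f : ℝ → ℝ) (U : Set ℝ) : Prop :=
  ∃ S : Finset ℝ, (∀ s ∈ S, s ∈ U ∧ IsDyadic s) ∧
    ∀ x ∈ U \ (S : Set ℝ), ∃ (n : ℤ) (b : ℝ), IsDyadic b ∧
      ∀ y ∈ connectedComponentIn (U \ (S : Set ℝ)) x, f y = 2 ^ n * y + b

/-- The map `h_{x₀}`, the homothety of ratio `2` centred at `x₀`. -/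
def doubling (x₀ x : ℝ) : ℝ := 2 * (x - x₀) + x₀

/-- A homeomorphism `f : I → J` between open dyadic intervals (`I = f.source`, `J = f.target`) is
of type `𝔇` if there is a finite set `BP ⊆ I` such that `f` is dyadic PL near every point of
`I ∖ BP`, while every `x₀ ∈ BP` is a dyadic rational (with dyadic image) near which
`f ∘ h_{x₀} = h_{f(x₀)} ∘ f`. -/
structure IsTypeD (f : OpenPartialHomeomorph ℝ ℝ) : Prop where
  source_dyadic : IsDyadicInterval f.source
  target_dyadic : IsDyadicInterval f.target
  exists_bp : ∃ BP : Finset ℝ, (BP : Set ℝ) ⊆ f.source ∧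
    (∀ x ∈ f.source, x ∉ BP → ∃ U, IsOpen U ∧ x ∈ U ∧ U ⊆ f.source ∧ IsDyadicPLOn f U) ∧
    ∀ x₀ ∈ BP, IsDyadic x₀ ∧ IsDyadic (f x₀) ∧
      ∀ᶠ x in 𝓝 x₀, f (doubling x₀ x) = doubling (f x₀) (f x)

/-! ### Auxiliary facts: stability of type `𝔇` -/

theorem IsDyadic.int (m : ℤ) : IsDyadic m := ⟨m, 0, by simp⟩

theorem IsDyadic.neg {x : ℝ} (h : IsDyadic x) : IsDyadic (-x) := by
  obtain ⟨m, k, rfl⟩ := h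
  exact ⟨-m, k, by push_cast; ring⟩

theorem IsDyadic.add {x y : ℝ} (hx : IsDyadic x) (hy : IsDyadic y) : IsDyadic (x + y) := by
  obtain ⟨m, k, rfl⟩ := hx
  obtain ⟨m', k', rfl⟩ := hy
  refine ⟨m * 2 ^ k' + m' * 2 ^ k, k + k', ?_⟩
  push_cast
  field_simp
  ring

theorem IsDyadic.mul {x y : ℝ} (hx : IsDyadic x) (hy : IsDyadic y) : IsDyadic (x * y) := by
  obtain ⟨m, k, rfl⟩ := hx
  obtain ⟨m', k', rfl⟩ := hy
  refine ⟨m * m', k + k', ?_⟩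
  push_cast
  rw [pow_add]
  field_simp

theorem IsDyadic.two_zpow (n : ℤ) : IsDyadic (2 ^ n) := by
  obtain ⟨k, rfl | rfl⟩ := n.eq_nat_or_neg
  · exact ⟨2 ^ k, 0, by simp⟩
  · exact ⟨1, k, by simp⟩

theorem IsDyadic.affine_iff {x b : ℝ} (n : ℤ) (hb : IsDyadic b) :
    IsDyadic (2 ^ n * x + b) ↔ IsDyadic x := by
  refine ⟨fun h => ?_, fun h => ((IsDyadic.two_zpow n).mul h).add hb⟩
  have h2 : x = 2 ^ (-n) * ((2 ^ n * x + b) + -b) := by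
    rw [zpow_neg]; field_simp; ring
  rw [h2]
  exact (IsDyadic.two_zpow _).mul (h.add hb.neg)

theorem exists_isDyadic_btwn {a b : ℝ} (h : a < b) : ∃ c, IsDyadic c ∧ a < c ∧ c < b := by
  obtain ⟨k, hk⟩ := exists_nat_gt (1 / (b - a))
  have hba : 0 < b - a := sub_pos.2 h
  have h2 : (1 : ℝ) < (b - a) * 2 ^ k := by
    have h3 : (k : ℝ) < 2 ^ k := by exact_mod_cast Nat.lt_two_pow_self
    have h4 : 1 / (b - a) < 2 ^ k := hk.trans h3
    rw [div_lt_iff₀ hba] at h4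
    linarith
  have hp : (0 : ℝ) < 2 ^ k := by positivity
  refine ⟨(⌊a * 2 ^ k⌋ + 1 : ℤ) / 2 ^ k, ⟨_, k, rfl⟩, ?_, ?_⟩
  · rw [lt_div_iff₀ hp]
    push_cast
    exact Int.lt_floor_add_one _
  · rw [div_lt_iff₀ hp]
    push_cast
    have := Int.floor_le (a * 2 ^ k)
    nlinarith

/-- `f` is given by one dyadic affine formula along the filter `l`. -/
def AffAlong (f : ℝ → ℝ) (l : Filter ℝ) : Prop :=
  ∃ (n : ℤ) (b : ℝ), IsDyadic b ∧ ∀ᶠ y in l, f y = 2 ^ n * y + b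

/-- Germ version of being dyadic PL. -/
def PLGerm (f : ℝ → ℝ) (x : ℝ) : Prop :=
  AffAlong f (𝓝[<] x) ∧ AffAlong f (𝓝[>] x) ∧ (IsDyadic x ∨ AffAlong f (𝓝 x))

/-- Germ version of commuting with the doubling map. -/
def HGerm (f : ℝ → ℝ) (x : ℝ) : Prop :=
  IsDyadic x ∧ IsDyadic (f x) ∧ ∀ᶠ y in 𝓝 x, f (doubling x y) = doubling (f x) (f y)

theorem AffAlong.mono {f : ℝ → ℝ} {l l' : Filter ℝ} (h : AffAlong f l) (hl : l' ≤ l) :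
    AffAlong f l' := by
  obtain ⟨n, b, hb, h⟩ := h
  exact ⟨n, b, hb, h.filter_mono hl⟩

theorem AffAlong.comp {f g : ℝ → ℝ} {l l' : Filter ℝ} (hf : AffAlong f l) (hg : AffAlong g l')
    (h : Tendsto f l l') : AffAlong (g ∘ f) l := by
  obtain ⟨n, b, hb, hf⟩ := hf
  obtain ⟨n', b', hb', hg⟩ := hg
  refine ⟨n' + n, 2 ^ n' * b + b', ((IsDyadic.two_zpow n').mul hb).add hb', ?_⟩
  filter_upwards [hf, h.eventually hg] with y h1 h2
  rw [Function.comp_apply, h2, h1, zpow_add₀ (by norm_num)]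
  ring

theorem PLGerm.of_pl {f : ℝ → ℝ} {U : Set ℝ} {x : ℝ} (hU : IsOpen U) (hx : x ∈ U)
    (h : IsDyadicPLOn f U) : PLGerm f x := by
  obtain ⟨S, hS, h⟩ := h
  have hV : IsOpen (U \ (↑(S.erase x) : Set ℝ)) := hU.sdiff (Finset.finite_toSet _).isClosed
  obtain ⟨ε, hε, hball⟩ := Metric.isOpen_iff.1 hV x ⟨hx, by simp⟩
  rw [Real.ball_eq_Ioo] at hball
  have key : ∀ K : Set ℝ, IsPreconnected K → K ⊆ U \ (S : Set ℝ) → ∀ z ∈ K, ∀ l : Filter ℝ,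
      K ∈ l → AffAlong f l := by
    intro K hK hKs z hz l hl
    obtain ⟨n, b, hb, hf⟩ := h z (hKs hz)
    exact ⟨n, b, hb, mem_of_superset hl
      fun y hy => hf y (hK.subset_connectedComponentIn hz hKs hy)⟩
  have sub : ∀ y ∈ Ioo (x - ε) (x + ε), y ≠ x → y ∈ U \ (S : Set ℝ) := by
    intro y hy hne
    have := hball hy
    exact ⟨this.1, fun hs => this.2 (by simpa [hne] using hs)⟩
  refine ⟨key (Ioo (x - ε) x) isPreconnected_Ioo ?_ (x - ε / 2) ⟨by linarith, by linarith⟩ _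
    (Ioo_mem_nhdsLT (by linarith)), key (Ioo x (x + ε)) isPreconnected_Ioo ?_ (x + ε / 2)
    ⟨by linarith, by linarith⟩ _ (Ioo_mem_nhdsGT (by linarith)), ?_⟩
  · exact fun y hy => sub y ⟨hy.1, by linarith [hy.2]⟩ hy.2.ne
  · exact fun y hy => sub y ⟨by linarith [hy.1], hy.2⟩ hy.1.ne'
  · by_cases hxS : x ∈ S
    · exact Or.inl (hS x hxS).2
    · refine Or.inr (key (Ioo (x - ε) (x + ε)) isPreconnected_Ioo ?_ x
        ⟨by linarith, by linarith⟩ _ (Ioo_mem_nhds (by linarith) (by linarith)))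
      intro y hy
      by_cases hyx : y = x
      · subst hyx; exact ⟨hx, hxS⟩
      · exact sub y hy hyx

theorem PLGerm.exists_pl {f : ℝ → ℝ} {V : Set ℝ} {x : ℝ} (hV : V ∈ 𝓝 x) (h : PLGerm f x) :
    ∃ U, IsOpen U ∧ x ∈ U ∧ U ⊆ V ∧ IsDyadicPLOn f U := by
  obtain ⟨⟨n, b, hb, h1⟩, ⟨n', b', hb', h2⟩, h3⟩ := h
  obtain ⟨ε, hε, hεV⟩ := Metric.mem_nhds_iff.1 hV
  rw [Real.ball_eq_Ioo] at hεV
  rcases h3 with h3 | ⟨m, c, hc, h3⟩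
  · obtain ⟨p, hp, hp'⟩ := (mem_nhdsLT_iff_exists_Ioo_subset (a := x)).1 h1
    obtain ⟨q, hq, hq'⟩ := (mem_nhdsGT_iff_exists_Ioo_subset (a := x)).1 h2
    rw [mem_Iio] at hp
    rw [mem_Ioi] at hq
    have hU : Ioo (max p (x - ε)) (min q (x + ε)) ⊆ V := fun y hy => hεV
      ⟨(le_max_right _ _).trans_lt hy.1, hy.2.trans_le (min_le_right _ _)⟩
    have hxU : x ∈ Ioo (max p (x - ε)) (min q (x + ε)) :=
      ⟨max_lt hp (by linarith), lt_min hq (by linarith)⟩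
    refine ⟨_, isOpen_Ioo, hxU, hU, {x}, fun s hs => ?_, ?_⟩
    · rw [Finset.mem_singleton.1 hs]
      exact ⟨hxU, h3⟩
    rintro z ⟨hz, hzx⟩
    have hcomp : ∀ y ∈ connectedComponentIn (Ioo (max p (x - ε)) (min q (x + ε)) \
        (({x} : Finset ℝ) : Set ℝ)) z, y ∈ Ioo (max p (x - ε)) (min q (x + ε)) ∧
        uIcc y z ⊆ {x}ᶜ := by
      intro y hy
      have hs := connectedComponentIn_subset _ _ hy
      refine ⟨hs.1, fun w hw => ?_⟩
      have := isPreconnected_connectedComponentIn.ordConnected.uIcc_subset hy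
        (mem_connectedComponentIn ⟨hz, hzx⟩) hw
      have := (connectedComponentIn_subset _ _ this).2
      simpa using this
    have hzx : z ≠ x := by simpa using hzx
    rcases lt_or_gt_of_ne hzx with hlt | hgt
    · refine ⟨n, b, hb, fun y hy => ?_⟩
      obtain ⟨hy1, hy2⟩ := hcomp y hy
      refine hp' ⟨(le_max_left _ _).trans_lt hy1.1, ?_⟩
      by_contra hxy
      exact hy2 (a := x) (by rw [mem_uIcc]; right; exact ⟨hlt.le, not_lt.1 hxy⟩) rfl
    · refine ⟨n', b', hb', fun y hy => ?_⟩
      obtain ⟨hy1, hy2⟩ := hcomp y hy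
      refine hq' ⟨?_, hy1.2.trans_le (min_le_left _ _)⟩
      by_contra hxy
      exact hy2 (a := x) (by rw [mem_uIcc]; left; exact ⟨not_lt.1 hxy, hgt.le⟩) rfl
  · obtain ⟨W, hW, hWo, hxW⟩ := mem_nhds_iff.1 (inter_mem hV h3)
    refine ⟨W, hWo, hxW, fun y hy => (hW hy).1, ∅, by simp, fun z hz => ⟨m, c, hc, fun y hy => ?_⟩⟩
    exact (hW (connectedComponentIn_subset _ _ hy).1).2

/-- A one-sided affine germ of a continuous map fixes the value and the side. -/
theorem side_data {f : ℝ → ℝ} {x b : ℝ} {n : ℤ} (hf : ContinuousAt f x) {s : Set ℝ}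
    (hne : (𝓝[s] x).NeBot) (hs : ∀ᶠ y in 𝓝[s] x, f y = 2 ^ n * y + b) : f x = 2 ^ n * x + b := by
  refine tendsto_nhds_unique (hf.tendsto.mono_left (nhdsWithin_le_nhds (s := s)))
    (Tendsto.congr' (f₁ := fun y => 2 ^ n * y + b) (hs.mono fun y hy => hy.symm) ?_)
  exact ((Continuous.tendsto (by fun_prop) x)).mono_left nhdsWithin_le_nhds

theorem PLGerm.dyadic_apply_iff {f : ℝ → ℝ} {x : ℝ} (h : PLGerm f x) (hf : ContinuousAt f x) :
    IsDyadic (f x) ↔ IsDyadic x := by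
  obtain ⟨-, ⟨n, b, hb, h2⟩, -⟩ := h
  rw [side_data hf inferInstance h2, IsDyadic.affine_iff n hb]

theorem PLGerm.hGerm {f : ℝ → ℝ} {x : ℝ} (h : PLGerm f x) (hf : ContinuousAt f x)
    (hx : IsDyadic x) : HGerm f x := by
  refine ⟨hx, (h.dyadic_apply_iff hf).2 hx, ?_⟩
  have hd : Continuous (doubling x) := by unfold doubling; fun_prop
  have hdx : doubling x x = x := by simp [doubling]
  have side : ∀ s : Set ℝ, AffAlong f (𝓝[s] x) → (𝓝[s] x).NeBot →
      (∀ y ∈ s, doubling x y ∈ s) → ∀ᶠ y in 𝓝[s] x, f (doubling x y) = doubling (f x) (f y) := by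
    rintro s ⟨n, b, -, hs⟩ hne hsd
    have h3 : f x = 2 ^ n * x + b := side_data hf hne hs
    have ht : Tendsto (doubling x) (𝓝[s] x) (𝓝[s] x) := by
      refine tendsto_nhdsWithin_of_tendsto_nhds_of_eventually_within _ ?_
        (eventually_nhdsWithin_of_forall hsd)
      have := (hd.tendsto x).mono_left (nhdsWithin_le_nhds (s := s))
      rwa [hdx] at this
    filter_upwards [hs, ht.eventually hs] with y h1 h2
    rw [h2, h1, h3]
    simp only [doubling]
    ring
  have hl := side (Iio x) h.1 inferInstance fun y (hy : y < x) => by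
    simp only [doubling, mem_Iio]; linarith
  have hr := side (Ioi x) h.2.1 inferInstance fun y (hy : x < y) => by
    simp only [doubling, mem_Ioi]; linarith
  rw [← nhdsNE_sup_pure, eventually_sup]
  refine ⟨?_, ?_⟩
  · rw [← nhdsLT_sup_nhdsGT, eventually_sup]
    exact ⟨hl, hr⟩
  · simp [doubling]

theorem tendsto_affine_side {x b : ℝ} (n : ℤ) :
    Tendsto (fun y => (2 : ℝ) ^ n * y + b) (𝓝[<] x) (𝓝[<] (2 ^ n * x + b)) ∧
    Tendsto (fun y => (2 : ℝ) ^ n * y + b) (𝓝[>] x) (𝓝[>] (2 ^ n * x + b)) := by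
  have hp : (0 : ℝ) < 2 ^ n := by positivity
  have hc : Tendsto (fun y => (2 : ℝ) ^ n * y + b) (𝓝 x) (𝓝 (2 ^ n * x + b)) :=
    Continuous.tendsto (by fun_prop) x
  constructor
  · refine tendsto_nhdsWithin_of_tendsto_nhds_of_eventually_within _
      (hc.mono_left nhdsWithin_le_nhds) (eventually_nhdsWithin_of_forall fun y hy => ?_)
    have := mul_lt_mul_of_pos_left (mem_Iio.1 hy) hp
    simp only [mem_Iio]; linarith
  · refine tendsto_nhdsWithin_of_tendsto_nhds_of_eventually_within _
      (hc.mono_left nhdsWithin_le_nhds) (eventually_nhdsWithin_of_forall fun y hy => ?_)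
    have := mul_lt_mul_of_pos_left (mem_Ioi.1 hy) hp
    simp only [mem_Ioi]; linarith

theorem PLGerm.tendsto_side {f : ℝ → ℝ} {x : ℝ} (h : PLGerm f x) (hf : ContinuousAt f x) :
    Tendsto f (𝓝[<] x) (𝓝[<] (f x)) ∧ Tendsto f (𝓝[>] x) (𝓝[>] (f x)) := by
  obtain ⟨⟨n, b, -, h1⟩, ⟨n', b', -, h2⟩, -⟩ := h
  constructor
  · rw [side_data hf inferInstance h1]
    exact (tendsto_affine_side n).1.congr' (h1.mono fun y hy => hy.symm)
  · rw [side_data hf inferInstance h2]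
    exact (tendsto_affine_side n').2.congr' (h2.mono fun y hy => hy.symm)

theorem PLGerm.comp {f g : ℝ → ℝ} {x : ℝ} (hf : PLGerm f x) (hg : PLGerm g (f x))
    (hc : ContinuousAt f x) : PLGerm (g ∘ f) x := by
  have ht := hf.tendsto_side hc
  refine ⟨hf.1.comp hg.1 ht.1, hf.2.1.comp hg.2.1 ht.2, ?_⟩
  by_cases hx : IsDyadic x
  · exact Or.inl hx
  · have hfx : ¬ IsDyadic (f x) := fun h => hx ((hf.dyadic_apply_iff hc).1 h)
    exact Or.inr ((hf.2.2.resolve_left hx).comp (hg.2.2.resolve_left hfx) hc)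

theorem HGerm.comp {f g : ℝ → ℝ} {x : ℝ} (hf : HGerm f x) (hg : HGerm g (f x))
    (hc : ContinuousAt f x) : HGerm (g ∘ f) x := by
  refine ⟨hf.1, hg.2.1, ?_⟩
  filter_upwards [hf.2.2, hc.eventually hg.2.2] with y h1 h2
  simp only [Function.comp_apply]
  rw [h1, h2]

theorem AffAlong.symm {f : OpenPartialHomeomorph ℝ ℝ} {l l' : Filter ℝ}
    (hl : ∀ᶠ y in l, y ∈ f.source) (h : AffAlong f l)
    (ht : ∀ (n : ℤ) (b : ℝ), (∀ᶠ y in l, f y = 2 ^ n * y + b) →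
      Tendsto (fun z => (2 : ℝ) ^ (-n) * z + -(2 ^ (-n) * b)) l' l) : AffAlong f.symm l' := by
  obtain ⟨n, b, hb, h⟩ := h
  refine ⟨-n, _, ((IsDyadic.two_zpow (-n)).mul hb).neg, ?_⟩
  filter_upwards [(ht n b h).eventually h, (ht n b h).eventually hl] with z h1 h2
  have h3 : f (2 ^ (-n) * z + -(2 ^ (-n) * b)) = z := by
    rw [h1, zpow_neg]; field_simp; ring
  rw [← f.left_inv h2, h3]

theorem PLGerm.symm {f : OpenPartialHomeomorph ℝ ℝ} {x : ℝ} (hx : x ∈ f.source)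
    (h : PLGerm f x) : PLGerm f.symm (f x) := by
  have hc : ContinuousAt f x := f.continuousAt hx
  have hs : ∀ᶠ y in 𝓝 x, y ∈ f.source := f.open_source.mem_nhds hx
  have e : ∀ (n : ℤ) (b : ℝ), f x = 2 ^ n * x + b → 2 ^ (-n) * f x + -(2 ^ (-n) * b) = x := by
    intro n b h
    rw [h, zpow_neg]; field_simp; ring
  refine ⟨h.1.symm (hs.filter_mono nhdsWithin_le_nhds) fun n b hn => ?_,
    h.2.1.symm (hs.filter_mono nhdsWithin_le_nhds) fun n b hn => ?_, ?_⟩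
  · have := (tendsto_affine_side (x := f x) (b := -(2 ^ (-n) * b)) (-n)).1
    rwa [e n b (side_data hc inferInstance hn)] at this
  · have := (tendsto_affine_side (x := f x) (b := -(2 ^ (-n) * b)) (-n)).2
    rwa [e n b (side_data hc inferInstance hn)] at this
  · rcases h.2.2 with h3 | h3
    · exact Or.inl ((h.dyadic_apply_iff hc).2 h3)
    · refine Or.inr (h3.symm hs fun n b hn => ?_)
      have : Tendsto (fun z => (2 : ℝ) ^ (-n) * z + -(2 ^ (-n) * b)) (𝓝 (f x))
        (𝓝 (2 ^ (-n) * f x + -(2 ^ (-n) * b))) := Continuous.tendsto (by fun_prop) _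
      rwa [e n b hn.self_of_nhds] at this

theorem HGerm.symm {f : OpenPartialHomeomorph ℝ ℝ} {x : ℝ} (hx : x ∈ f.source)
    (h : HGerm f x) : HGerm f.symm (f x) := by
  have hl : f.symm (f x) = x := f.left_inv hx
  refine ⟨h.2.1, by rw [hl]; exact h.1, ?_⟩
  have ht : Tendsto f.symm (𝓝 (f x)) (𝓝 x) := by
    have := f.symm.continuousAt (x := f x) (f.map_source hx)
    rwa [ContinuousAt, hl] at this
  have hd : Tendsto (doubling x) (𝓝 x) (𝓝 x) := by
    have : Continuous (doubling x) := by unfold doubling; fun_prop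
    simpa [doubling] using this.tendsto x
  rw [hl]
  filter_upwards [ht.eventually h.2.2, f.open_target.mem_nhds (f.map_source hx),
    (hd.comp ht).eventually (f.open_source.mem_nhds hx)] with z h1 h2 h3
  replace h3 : doubling x (f.symm z) ∈ f.source := h3
  rw [f.right_inv h2] at h1
  rw [← h1, f.left_inv h3]

/-- Reformulation of type `𝔇` through germs. -/
theorem isTypeD_iff {f : OpenPartialHomeomorph ℝ ℝ} :
    IsTypeD f ↔ IsDyadicInterval f.source ∧ IsDyadicInterval f.target ∧
      ∃ BP : Finset ℝ, (BP : Set ℝ) ⊆ f.source ∧ (∀ x ∈ f.source, x ∉ BP → PLGerm f x) ∧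
        ∀ x ∈ BP, HGerm f x := by
  constructor
  · rintro ⟨h1, h2, BP, h3, h4, h5⟩
    refine ⟨h1, h2, BP, h3, fun x hx hxB => ?_, h5⟩
    obtain ⟨U, hU, hxU, -, h⟩ := h4 x hx hxB
    exact PLGerm.of_pl hU hxU h
  · rintro ⟨h1, h2, BP, h3, h4, h5⟩
    exact ⟨h1, h2, BP, h3, fun x hx hxB =>
      (h4 x hx hxB).exists_pl (f.open_source.mem_nhds hx), h5⟩

theorem IsTypeD.dyadic_apply_iff {f : OpenPartialHomeomorph ℝ ℝ} (hf : IsTypeD f) {x : ℝ}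
    (hx : x ∈ f.source) : IsDyadic (f x) ↔ IsDyadic x := by
  obtain ⟨-, -, BP, -, h4, h5⟩ := isTypeD_iff.1 hf
  by_cases hxB : x ∈ BP
  · exact iff_of_true (h5 x hxB).2.1 (h5 x hxB).1
  · exact (h4 x hx hxB).dyadic_apply_iff (f.continuousAt hx)

theorem IsTypeD.hGerm {f : OpenPartialHomeomorph ℝ ℝ} (hf : IsTypeD f) {x : ℝ}
    (hx : x ∈ f.source) (hd : IsDyadic x) : HGerm f x := by
  obtain ⟨-, -, BP, -, h4, h5⟩ := isTypeD_iff.1 hf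
  by_cases hxB : x ∈ BP
  · exact h5 x hxB
  · exact (h4 x hx hxB).hGerm (f.continuousAt hx) hd

theorem IsTypeD.symm {f : OpenPartialHomeomorph ℝ ℝ} (hf : IsTypeD f) : IsTypeD f.symm := by
  classical
  obtain ⟨h1, h2, BP, h3, h4, h5⟩ := isTypeD_iff.1 hf
  refine isTypeD_iff.2 ⟨h2, h1, BP.image f, ?_, ?_, ?_⟩
  · intro y hy
    obtain ⟨x, hx, rfl⟩ := Finset.mem_image.1 hy
    exact f.map_source (h3 hx)
  · intro y hy hyB
    have hxs : f.symm y ∈ f.source := f.map_target hy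
    have := (h4 (f.symm y) hxs fun hB =>
      hyB (Finset.mem_image.2 ⟨_, hB, f.right_inv hy⟩)).symm hxs
    rwa [f.right_inv hy] at this
  · intro y hy
    obtain ⟨x, hx, rfl⟩ := Finset.mem_image.1 hy
    exact (h5 x hx).symm (h3 hx)

theorem isDyadicInterval_image {F : ℝ → ℝ} {p q : ℝ} (hpq : p < q)
    (hF : ContinuousOn F (Icc p q)) (hi : InjOn F (Icc p q)) (hp : IsDyadic (F p))
    (hq : IsDyadic (F q)) : IsDyadicInterval (F '' Ioo p q) := by
  have hpm : p ∈ Icc p q := left_mem_Icc.2 hpq.le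
  have hqm : q ∈ Icc p q := right_mem_Icc.2 hpq.le
  rcases hF.strictMonoOn_of_injOn_Icc' hpq.le hi with h | h
  · refine ⟨F p, F q, hp, hq, h hpm hqm hpq, Subset.antisymm ?_ (intermediate_value_Ioo hpq.le hF)⟩
    rintro _ ⟨y, hy, rfl⟩
    exact ⟨h hpm (Ioo_subset_Icc_self hy) hy.1, h (Ioo_subset_Icc_self hy) hqm hy.2⟩
  · refine ⟨F q, F p, hq, hp, h hpm hqm hpq, Subset.antisymm ?_ (intermediate_value_Ioo' hpq.le hF)⟩
    rintro _ ⟨y, hy, rfl⟩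
    exact ⟨h (Ioo_subset_Icc_self hy) hqm hy.2, h hpm (Ioo_subset_Icc_self hy) hy.1⟩

theorem exists_dyadic_Icc_subset {V : Set ℝ} {t : ℝ} (hV : V ∈ 𝓝 t) :
    ∃ p q, IsDyadic p ∧ IsDyadic q ∧ p < t ∧ t < q ∧ Icc p q ⊆ V := by
  obtain ⟨ε, hε, hεV⟩ := Metric.mem_nhds_iff.1 hV
  rw [Real.ball_eq_Ioo] at hεV
  obtain ⟨p, hp, hp1, hp2⟩ := exists_isDyadic_btwn (show t - ε < t by linarith)
  obtain ⟨q, hq, hq1, hq2⟩ := exists_isDyadic_btwn (show t < t + ε by linarith)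
  exact ⟨p, q, hp, hq, hp2, hq1, fun y hy => hεV ⟨hp1.trans_le hy.1, hy.2.trans_lt hq2⟩⟩

theorem IsTypeD.exists_comp {f g : OpenPartialHomeomorph ℝ ℝ} (hf : IsTypeD f) (hg : IsTypeD g)
    {t : ℝ} (ht : t ∈ f.source) (ht' : f t ∈ g.source) :
    ∃ k : OpenPartialHomeomorph ℝ ℝ, IsTypeD k ∧ t ∈ k.source ∧
      (∀ s ∈ k.source, s ∈ f.source ∧ f s ∈ g.source) ∧ ∀ s, k s = g (f s) := by
  classical
  obtain ⟨-, -, B, h3, h4, h5⟩ := isTypeD_iff.1 hf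
  obtain ⟨-, -, B', h3', h4', h5'⟩ := isTypeD_iff.1 hg
  have hts : t ∈ (f.trans g).source := by simp [ht, ht']
  obtain ⟨p, q, hp, hq, hpt, htq, hpq⟩ :=
    exists_dyadic_Icc_subset ((f.trans g).open_source.mem_nhds hts)
  have hlt : p < q := hpt.trans htq
  have hsub : ∀ s ∈ Icc p q, s ∈ f.source ∧ f s ∈ g.source := fun s hs => by
    simpa using hpq hs
  have hdy : ∀ s ∈ Icc p q, IsDyadic (g (f s)) ↔ IsDyadic s := fun s hs => by
    rw [hg.dyadic_apply_iff (hsub s hs).2, hf.dyadic_apply_iff (hsub s hs).1]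
  let k := (f.trans g).restr (Ioo p q)
  have hks : k.source = Ioo p q := by
    rw [OpenPartialHomeomorph.restr_source' _ _ isOpen_Ioo]
    exact inter_eq_right.2 (Ioo_subset_Icc_self.trans hpq)
  have hk : ∀ s, k s = g (f s) := fun s => rfl
  have hcomp : ∀ s ∈ Ioo p q, IsDyadic s → HGerm k s := fun s hs hd => by
    obtain ⟨h6, h7⟩ := hsub s (Ioo_subset_Icc_self hs)
    exact (hf.hGerm h6 hd).comp (hg.hGerm h7 ((hf.dyadic_apply_iff h6).2 hd)) (f.continuousAt h6)
  refine ⟨k, isTypeD_iff.2 ⟨hks ▸ ⟨p, q, hp, hq, hlt, rfl⟩, ?_,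
    (B ∪ (B'.filter (· ∈ f.target)).image f.symm).filter (· ∈ Ioo p q), ?_, ?_, ?_⟩, ?_, ?_, hk⟩
  · rw [← k.image_source_eq_target, hks]
    have e : (k : ℝ → ℝ) = (f.trans g) := rfl
    rw [e]
    refine isDyadicInterval_image hlt ((f.trans g).continuousOn.mono hpq)
      ((f.trans g).injOn.mono hpq) ?_ ?_
    · exact (hdy p (left_mem_Icc.2 hlt.le)).2 hp
    · exact (hdy q (right_mem_Icc.2 hlt.le)).2 hq
  · intro s hs
    rw [hks]
    exact (Finset.mem_filter.1 hs).2
  · intro s hs hsB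
    rw [hks] at hs
    obtain ⟨h6, h7⟩ := hsub s (Ioo_subset_Icc_self hs)
    simp only [Finset.mem_filter, Finset.mem_union, Finset.mem_image, not_and_or, hs,
      not_true_eq_false, or_false, not_or, not_exists] at hsB
    refine (h4 s h6 hsB.1).comp (h4' (f s) h7 fun h8 => ?_) (f.continuousAt h6)
    rcases hsB.2 (f s) with (h | h) | h
    · exact h h8
    · exact h (f.map_source h6)
    · exact h (f.left_inv h6)
  · intro s hs
    obtain ⟨h8, hs⟩ := Finset.mem_filter.1 hs
    refine hcomp s hs ?_
    rcases Finset.mem_union.1 h8 with h8 | h8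
    · exact (h5 s h8).1
    · obtain ⟨z, hz, rfl⟩ := Finset.mem_image.1 h8
      obtain ⟨h6, h7⟩ := hsub _ (Ioo_subset_Icc_self hs)
      obtain ⟨hz, hzt⟩ := Finset.mem_filter.1 hz
      rw [← hf.dyadic_apply_iff h6, f.right_inv hzt]
      exact (h5' z hz).1
  · rw [hks]; exact ⟨hpt, htq⟩
  · intro s hs
    rw [hks] at hs
    exact hsub s (Ioo_subset_Icc_self hs)

theorem AffAlong.conj {f : ℝ → ℝ} {γ : ℝ ≃ₜ ℝ} {ε : ℤ} {m : ℤ} (hε : ε * ε = 1)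
    (hγ : ∀ t, γ t = ε * t + m) {l l' : Filter ℝ} (hf : AffAlong f l)
    (ht : Tendsto γ.symm l' l) : AffAlong (fun y => γ (f (γ.symm y))) l' := by
  obtain ⟨n, b, hb, hf⟩ := hf
  refine ⟨n, -(2 ^ n * m) + (ε * b + m), ((IsDyadic.two_zpow n).mul (.int m)).neg.add
    (((IsDyadic.int ε).mul hb).add (.int m)), ?_⟩
  filter_upwards [ht.eventually hf] with y hy
  have h1 : y = ε * γ.symm y + m := by rw [← hγ, γ.apply_symm_apply]
  have hε' : (ε : ℝ) * ε = 1 := by exact_mod_cast hε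
  rw [hy, hγ]
  conv_rhs => rw [h1]
  ring

theorem IsTypeD.conj {f : OpenPartialHomeomorph ℝ ℝ} (hf : IsTypeD f) {γ : ℝ ≃ₜ ℝ} {ε m : ℤ}
    (hε : ε = 1 ∨ ε = -1) (hγ : ∀ t, γ t = ε * t + m) :
    IsTypeD ((γ.symm.transOpenPartialHomeomorph f).transHomeomorph γ) := by
  classical
  have hε2 : ε * ε = 1 := by rcases hε with rfl | rfl <;> norm_num
  have hε' : (ε : ℝ) * ε = 1 := by exact_mod_cast hε2
  have hdy : ∀ t, IsDyadic t → IsDyadic (γ t) := fun t ht => by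
    rw [hγ]; exact ((IsDyadic.int ε).mul ht).add (.int m)
  have himg : ∀ I, IsDyadicInterval I → IsDyadicInterval (γ.symm ⁻¹' I) := by
    rintro _ ⟨a, b, ha, hb, hab, rfl⟩
    rw [← γ.image_eq_preimage_symm]
    exact isDyadicInterval_image hab γ.continuous.continuousOn γ.injective.injOn (hdy a ha)
      (hdy b hb)
  have hside : ∀ x, (Tendsto γ.symm (𝓝[<] (γ x)) (𝓝[<] x) ∧
      Tendsto γ.symm (𝓝[>] (γ x)) (𝓝[>] x)) ∨ (Tendsto γ.symm (𝓝[<] (γ x)) (𝓝[>] x) ∧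
      Tendsto γ.symm (𝓝[>] (γ x)) (𝓝[<] x)) := by
    intro x
    have key : ∀ s t : Set ℝ, (∀ y, γ y ∈ s → y ∈ t) →
        Tendsto γ.symm (𝓝[s] (γ x)) (𝓝[t] x) := by
      intro s t hst
      refine tendsto_nhdsWithin_of_tendsto_nhds_of_eventually_within _ ?_
        (eventually_nhdsWithin_of_forall fun y hy => hst _ (by rwa [γ.apply_symm_apply]))
      have := (γ.symm.continuous.tendsto (γ x)).mono_left (nhdsWithin_le_nhds (s := s))
      rwa [γ.symm_apply_apply] at this
    rcases hε with rfl | rfl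
    · left
      constructor <;> refine key _ _ fun y hy => ?_ <;> simp [hγ] at hy ⊢ <;> exact hy
    · right
      constructor <;> refine key _ _ fun y hy => ?_ <;> simp [hγ] at hy ⊢ <;> linarith
  obtain ⟨h1, h2, B, h3, h4, h5⟩ := isTypeD_iff.1 hf
  refine isTypeD_iff.2 ⟨himg _ h1, himg _ h2, B.image γ, ?_, ?_, ?_⟩
  · intro y hy
    obtain ⟨x, hx, rfl⟩ := Finset.mem_image.1 hy
    change γ.symm (γ x) ∈ f.source
    rw [γ.symm_apply_apply]
    exact h3 hx
  · intro y hy hyB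
    obtain ⟨x, rfl⟩ := γ.surjective y
    have hx : x ∈ f.source := by
      change γ.symm (γ x) ∈ f.source at hy
      rwa [γ.symm_apply_apply] at hy
    have hg := h4 x hx fun h => hyB (Finset.mem_image_of_mem _ h)
    have h3 : IsDyadic (γ x) ∨ AffAlong (fun y => γ (f (γ.symm y))) (𝓝 (γ x)) := by
      rcases hg.2.2 with h | h
      · exact Or.inl (hdy x h)
      · refine Or.inr (h.conj hε2 hγ ?_)
        have := γ.symm.continuous.tendsto (γ x)
        rwa [γ.symm_apply_apply] at this
    rcases hside x with ⟨hl, hr⟩ | ⟨hl, hr⟩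
    · exact ⟨hg.1.conj hε2 hγ hl, hg.2.1.conj hε2 hγ hr, h3⟩
    · exact ⟨hg.2.1.conj hε2 hγ hl, hg.1.conj hε2 hγ hr, h3⟩
  · intro y hy
    obtain ⟨x, hx, rfl⟩ := Finset.mem_image.1 hy
    obtain ⟨h6, h7, h8⟩ := h5 x hx
    have e : ((γ.symm.transOpenPartialHomeomorph f).transHomeomorph γ : ℝ → ℝ) =
      fun y => γ (f (γ.symm y)) := rfl
    rw [e]
    have hds : ∀ a b, doubling (γ a) (γ b) = γ (doubling a b) := fun a b => by
      simp only [doubling, hγ]; ring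
    refine ⟨hdy x h6, ?_, ?_⟩
    · simp only [γ.symm_apply_apply]
      exact hdy _ h7
    · have ht := γ.symm.continuous.tendsto (γ x)
      rw [γ.symm_apply_apply] at ht
      filter_upwards [ht.eventually h8] with z hz
      obtain ⟨w, rfl⟩ := γ.surjective z
      rw [γ.symm_apply_apply] at hz
      rw [hds]
      simp only [γ.symm_apply_apply]
      rw [hds, hz]

theorem IsTypeD.refl_Ioo {p q : ℝ} (hp : IsDyadic p) (hq : IsDyadic q) (hpq : p < q) :
    IsTypeD (OpenPartialHomeomorph.ofSet (Ioo p q) isOpen_Ioo) := by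
  refine isTypeD_iff.2 ⟨⟨p, q, hp, hq, hpq, rfl⟩, ⟨p, q, hp, hq, hpq, rfl⟩, ∅, by simp,
    fun x _ _ => ?_, by simp⟩
  have h : AffAlong (OpenPartialHomeomorph.ofSet (Ioo p q) isOpen_Ioo) (𝓝 x) :=
    ⟨0, 0, by simpa using IsDyadic.int 0, by simp⟩
  exact ⟨h.mono nhdsWithin_le_nhds, h.mono nhdsWithin_le_nhds, Or.inr h⟩

/-! ### The dihedral suspension -/

/-- A homeomorphism `φ` together with an involution `σ` such that `σ φ σ = φ⁻¹`, where `σ` does not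
preserve any `φ`-orbit. (Since `σ` permutes the `φ`-orbits, it preserves the orbit of `x` if and
only if `σ x` lies in it.) -/
structure ReversibleSystem (X : Type*) [TopologicalSpace X] where
  φ : X ≃ₜ X
  σ : X ≃ₜ X
  σ_σ : ∀ x, σ (σ x) = x
  σ_φ_σ : ∀ x, σ (φ (σ x)) = φ.symm x
  σ_ne : ∀ (x : X) (n : ℤ), σ x ≠ (φ ^ n) x

namespace ReversibleSystem

variable {X : Type*} [TopologicalSpace X] (S : ReversibleSystem X)

/-- `q` lies in the orbit of `p` under the diagonal action of the infinite dihedral group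
`ℤ ⋊ ℤ/2` on `X × ℝ`: the element `(n, 0)` acts by `(x, t) ↦ (φ ^ n x, t - n)` and `(n, 1)` acts by
`(x, t) ↦ (φ ^ n (σ x), -t - n)`. -/
def SameOrbit (p q : X × ℝ) : Prop :=
  ∃ n : ℤ, q = ((S.φ ^ n) p.1, p.2 - n) ∨ q = ((S.φ ^ n) (S.σ p.1), -p.2 - n)

theorem σ_zpow (n : ℤ) (x : X) : S.σ ((S.φ ^ n) x) = (S.φ ^ (-n)) (S.σ x) := by
  have h1 : S.σ * S.σ = 1 := Homeomorph.ext S.σ_σ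
  have h2 : S.σ * S.φ * S.σ⁻¹ = S.φ⁻¹ := by
    rw [inv_eq_of_mul_eq_one_left h1]
    exact Homeomorph.ext S.σ_φ_σ
  have h3 : S.σ * S.φ ^ n * S.σ⁻¹ = S.φ ^ (-n) := by
    rw [← conj_zpow, h2, inv_zpow, zpow_neg]
  rw [← Homeomorph.mul_apply, ← Homeomorph.mul_apply, ← h3]
  simp

theorem zpow_zpow (m n : ℤ) (x : X) : (S.φ ^ m) ((S.φ ^ n) x) = (S.φ ^ (m + n)) x := by
  rw [zpow_add, Homeomorph.mul_apply]

theorem sameOrbit_equivalence : Equivalence S.SameOrbit where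
  refl p := ⟨0, Or.inl (by simp)⟩
  symm := by
    rintro ⟨x, t⟩ _ ⟨n, rfl | rfl⟩
    · exact ⟨-n, Or.inl (by simp)⟩
    · exact ⟨n, Or.inr (by simp [σ_zpow, S.σ_σ])⟩
  trans := by
    rintro ⟨x, t⟩ _ _ ⟨n, rfl | rfl⟩ ⟨m, rfl | rfl⟩
    · exact ⟨m + n, Or.inl (by simp [zpow_zpow]; ring)⟩
    · exact ⟨m - n, Or.inr (Prod.ext (by simp only [σ_zpow, zpow_zpow, sub_eq_add_neg])
        (by push_cast; ring))⟩
    · exact ⟨m + n, Or.inr (by simp [zpow_zpow]; ring)⟩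
    · exact ⟨m - n, Or.inl (Prod.ext (by simp only [σ_zpow, zpow_zpow, S.σ_σ, sub_eq_add_neg])
        (by push_cast; ring))⟩

/-- The orbit equivalence relation of the infinite dihedral group on `X × ℝ`. -/
def orbitSetoid : Setoid (X × ℝ) := ⟨S.SameOrbit, S.sameOrbit_equivalence⟩

/-- The dihedral suspension `Z = (X × ℝ) / D_∞`. -/
def DihedralSuspension : Type _ := Quotient S.orbitSetoid

/-- `Z` carries the quotient topology. -/
instance : TopologicalSpace S.DihedralSuspension :=
  inferInstanceAs (TopologicalSpace (Quotient S.orbitSetoid))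

/-- The quotient projection `π_Z : X × ℝ → Z`. -/
def π (p : X × ℝ) : S.DihedralSuspension := Quotient.mk S.orbitSetoid p

/-- `C ⊆ X` and `I ⊆ ℝ` define a chart of `Z`: `C` is clopen, `I` is an open interval, and
`π_Z` is injective on `C × I`. -/
def IsChart (C : Set X) (I : Set ℝ) : Prop :=
  IsClopen C ∧ IsOpen I ∧ I.OrdConnected ∧ InjOn S.π (C ×ˢ I)

/-- The set `Z_{C, I} = π_Z (C × I)`. -/
def chart (C : Set X) (I : Set ℝ) : Set S.DihedralSuspension := S.π '' (C ×ˢ I)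

/-- Near `z`, the homeomorphism `g` of `Z` is, in charts `Z_{C, I} ∋ z` and `Z_{C, J} ∋ g z` with
the same transversal `C`, of the form `π_Z (x, t) ↦ π_Z (x, f t)` for some homeomorphism
`f : I → J` of type `𝔇` (`I = f.source` and `J = f.target`, so that `g` maps `Z_{C, I}`
onto `Z_{C, J}`). -/
def IsLocallyTypeD (g : S.DihedralSuspension ≃ₜ S.DihedralSuspension)
    (z : S.DihedralSuspension) : Prop :=
  ∃ (C : Set X) (f : OpenPartialHomeomorph ℝ ℝ), IsTypeD f ∧
    S.IsChart C f.source ∧ S.IsChart C f.target ∧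
    z ∈ S.chart C f.source ∧ g z ∈ S.chart C f.target ∧
    ∀ x ∈ C, ∀ t ∈ f.source, g (S.π (x, t)) = S.π (x, f t)

variable {S}

theorem π_eq_iff {p q : X × ℝ} : S.π p = S.π q ↔ S.SameOrbit p q := Quotient.eq (r := S.orbitSetoid)

theorem exists_rep (z : S.DihedralSuspension) : ∃ x t, z = S.π (x, t) := by
  obtain ⟨p, rfl⟩ := Quotient.exists_rep z
  exact ⟨p.1, p.2, rfl⟩

/-- The local form of `g` at a given representative. -/
def LocalForm (g : S.DihedralSuspension ≃ₜ S.DihedralSuspension) (p : X × ℝ) : Prop :=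
  ∃ (C : Set X) (f : OpenPartialHomeomorph ℝ ℝ), IsTypeD f ∧ IsClopen C ∧
    InjOn S.π (C ×ˢ f.source) ∧ p.1 ∈ C ∧ p.2 ∈ f.source ∧
    ∀ x ∈ C, ∀ t ∈ f.source, g (S.π (x, t)) = S.π (x, f t)

theorem LocalForm.isLocallyTypeD {g : S.DihedralSuspension ≃ₜ S.DihedralSuspension} {p : X × ℝ}
    (h : LocalForm g p) : S.IsLocallyTypeD g (S.π p) := by
  obtain ⟨C, f, hf, hC, hi, hp1, hp2, hg⟩ := h
  have oc : ∀ I, IsDyadicInterval I → I.OrdConnected := by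
    rintro _ ⟨a, b, -, -, -, rfl⟩
    exact ordConnected_Ioo
  refine ⟨C, f, hf, ⟨hC, f.open_source, oc _ hf.source_dyadic, hi⟩,
    ⟨hC, f.open_target, oc _ hf.target_dyadic, ?_⟩, ⟨p, ⟨hp1, hp2⟩, rfl⟩,
    ⟨(p.1, f p.2), ⟨hp1, f.map_source hp2⟩, (hg _ hp1 _ hp2).symm⟩, hg⟩
  rintro ⟨x, s⟩ ⟨hx, hs⟩ ⟨y, s'⟩ ⟨hy, hs'⟩ heq
  simp only at hx hs hy hs'
  have e1 := hg x hx (f.symm s) (f.map_target hs)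
  have e2 := hg y hy (f.symm s') (f.map_target hs')
  rw [f.right_inv hs] at e1
  rw [f.right_inv hs'] at e2
  have e3 := @hi (x, f.symm s) ⟨hx, f.map_target hs⟩ (y, f.symm s')
    ⟨hy, f.map_target hs'⟩ (g.injective (e1.trans (heq.trans e2.symm)))
  rw [Prod.mk.injEq] at e3 ⊢
  exact ⟨e3.1, f.symm.injOn hs hs' e3.2⟩

theorem LocalForm.transfer {g : S.DihedralSuspension ≃ₜ S.DihedralSuspension} {x : X} {t : ℝ}
    (h : LocalForm g (x, t)) {α : X ≃ₜ X} {γ : ℝ ≃ₜ ℝ} {ε m : ℤ} (hε : ε = 1 ∨ ε = -1)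
    (hγ : ∀ t, γ t = ε * t + m) (hπ : ∀ x t, S.π (α x, γ t) = S.π (x, t)) :
    LocalForm g (α x, γ t) := by
  obtain ⟨C, f, hf, hC, hi, hp1, hp2, hg⟩ := h
  have hπ' : ∀ y s, S.π (y, s) = S.π (α.symm y, γ.symm s) := fun y s => by
    rw [← hπ (α.symm y), α.apply_symm_apply, γ.apply_symm_apply]
  refine ⟨α.symm ⁻¹' C, _, hf.conj hε hγ, hC.preimage α.symm.continuous, ?_, ?_, ?_, ?_⟩
  · rintro ⟨y, s⟩ ⟨hy, hs⟩ ⟨y', s'⟩ ⟨hy', hs'⟩ heq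
    rw [hπ' y s, hπ' y' s'] at heq
    have := @hi (α.symm y, γ.symm s) ⟨hy, hs⟩ (α.symm y', γ.symm s') ⟨hy', hs'⟩ heq
    rw [Prod.mk.injEq] at this ⊢
    exact ⟨α.symm.injective this.1, γ.symm.injective this.2⟩
  · simpa using hp1
  · change γ.symm (γ t) ∈ f.source
    simpa using hp2
  · intro y hy s hs
    change g (S.π (y, s)) = S.π (y, γ (f (γ.symm s)))
    rw [hπ', hg _ hy (γ.symm s) hs, hπ' y, γ.symm_apply_apply]

theorem LocalForm.of_sameOrbit {g : S.DihedralSuspension ≃ₜ S.DihedralSuspension} {p q : X × ℝ}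
    (h : LocalForm g p) (hpq : S.SameOrbit p q) : LocalForm g q := by
  obtain ⟨x, t⟩ := p
  obtain ⟨n, rfl | rfl⟩ := hpq
  · have := h.transfer (α := S.φ ^ n) (γ := Homeomorph.addRight (-(n : ℝ))) (ε := 1) (m := -n)
      (Or.inl rfl) (by simp) fun y s => (π_eq_iff.2 ⟨n, Or.inl (by simp [sub_eq_add_neg])⟩).symm
    simpa [sub_eq_add_neg] using this
  · have := h.transfer (α := S.φ ^ n * S.σ)
      (γ := (Homeomorph.neg ℝ).trans (Homeomorph.addRight (-(n : ℝ)))) (ε := -1) (m := -n)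
      (Or.inr rfl) (by simp) fun y s => (π_eq_iff.2 ⟨n, Or.inr (by simp [sub_eq_add_neg])⟩).symm
    simpa [sub_eq_add_neg] using this

theorem IsLocallyTypeD.localForm {g : S.DihedralSuspension ≃ₜ S.DihedralSuspension} {p : X × ℝ}
    (h : S.IsLocallyTypeD g (S.π p)) : LocalForm g p := by
  obtain ⟨C, f, hf, hC, -, ⟨q, ⟨hq1, hq2⟩, hqp⟩, -, hg⟩ := h
  exact LocalForm.of_sameOrbit ⟨C, f, hf, hC.1, hC.2.2.2, hq1, hq2, hg⟩ (π_eq_iff.1 hqp)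

theorem LocalForm.mul {g h : S.DihedralSuspension ≃ₜ S.DihedralSuspension} {p : X × ℝ}
    (hh : LocalForm h p) (hg : ∀ q, LocalForm g q) : LocalForm (g * h) p := by
  obtain ⟨x, t⟩ := p
  obtain ⟨C, f, hf, hC, hi, hp1, hp2, hh⟩ := hh
  obtain ⟨C', f', hf', hC', -, hp1', hp2', hg⟩ := hg (x, f t)
  obtain ⟨k, hk, htk, hsub, hke⟩ := hf.exists_comp hf' hp2 hp2'
  refine ⟨C ∩ C', k, hk, hC.inter hC', hi.mono ?_, ⟨hp1, hp1'⟩, htk, ?_⟩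
  · exact prod_mono inter_subset_left fun s hs => (hsub s hs).1
  · intro y hy s hs
    rw [Homeomorph.mul_apply, hh y hy.1 s (hsub s hs).1, hg y hy.2 _ (hsub s hs).2, hke]

theorem exists_injOn [CompactSpace X] [T2Space X] [TotallyDisconnectedSpace X] (x : X) (t : ℝ) :
    ∃ C : Set X, IsClopen C ∧ x ∈ C ∧ InjOn S.π (C ×ˢ Ioo (t - 1 / 4) (t + 1 / 4)) := by
  obtain ⟨C, hC, hxC, hCn⟩ : ∃ C : Set X, IsClopen C ∧ x ∈ C ∧
      ∀ n : ℤ, n = -round (2 * t) → ∀ y ∈ C, (S.φ ^ n) (S.σ y) ∉ C := by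
    let n : ℤ := -round (2 * t)
    have hne : x ≠ (S.φ ^ n) (S.σ x) := by
      intro h
      rw [← neg_neg n, ← σ_zpow] at h
      have := congrArg S.σ h
      rw [S.σ_σ] at this
      exact S.σ_ne _ _ this
    obtain ⟨U, hU, hxU, hyU⟩ := exists_isClopen_of_totally_separated hne
    refine ⟨U ∩ (S.φ ^ n * S.σ) ⁻¹' Uᶜ, hU.inter (hU.compl.preimage (Homeomorph.continuous _)),
      ⟨hxU, hyU⟩, ?_⟩
    rintro _ rfl y hy hy'
    exact hy.2 hy'.1
  refine ⟨C, hC, hxC, ?_⟩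
  rintro ⟨y, s⟩ ⟨hy, hs⟩ ⟨y', s'⟩ ⟨hy', hs'⟩ heq
  simp only [mem_Ioo] at hs hs' hy hy'
  obtain ⟨n, h | h⟩ := π_eq_iff.1 heq
  · rw [Prod.mk.injEq] at h
    obtain ⟨h1, h2⟩ := h
    have hn : n = 0 := by
      have h3 : (n : ℝ) < 1 := by simp only at h2; linarith
      have h4 : (-1 : ℝ) < n := by simp only at h2; linarith
      have h5 : n < 1 := by exact_mod_cast h3
      have h6 : -1 < n := by exact_mod_cast h4
      omega
    subst hn
    simp_all
  · rw [Prod.mk.injEq] at h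
    obtain ⟨h1, h2⟩ := h
    refine absurd hy' ?_
    rw [h1]
    refine hCn n ?_ y hy
    have h3 := abs_le.1 (abs_sub_round (2 * t))
    have h4 : ((n + round (2 * t) : ℤ) : ℝ) < 1 := by push_cast; simp only at h2; linarith
    have h5 : (-1 : ℝ) < ((n + round (2 * t) : ℤ) : ℝ) := by push_cast; simp only at h2; linarith
    have h6 : n + round (2 * t) < 1 := by exact_mod_cast h4
    have h7 : -1 < n + round (2 * t) := by exact_mod_cast h5
    omega

theorem LocalForm.one [CompactSpace X] [T2Space X] [TotallyDisconnectedSpace X] (p : X × ℝ) :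
    LocalForm (1 : S.DihedralSuspension ≃ₜ S.DihedralSuspension) p := by
  obtain ⟨x, t⟩ := p
  obtain ⟨C, hC, hxC, hi⟩ := exists_injOn (S := S) x t
  obtain ⟨a, b, ha, hb, hat, htb, hab⟩ := exists_dyadic_Icc_subset
    (Ioo_mem_nhds (show t - 1 / 4 < t by linarith) (show t < t + 1 / 4 by linarith))
  exact ⟨C, _, IsTypeD.refl_Ioo ha hb (hat.trans htb), hC,
    hi.mono (prod_mono_right (Ioo_subset_Icc_self.trans hab)), hxC, ⟨hat, htb⟩, fun y _ s _ => rfl⟩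

variable (S)

/-- The group `𝒯(φ, σ)` of all homeomorphisms of `Z` that are everywhere locally of
type `𝔇`. -/
def groupT [CompactSpace X] [T2Space X] [TotallyDisconnectedSpace X] :
    Subgroup (S.DihedralSuspension ≃ₜ S.DihedralSuspension) where
  carrier := {g | ∀ z, S.IsLocallyTypeD g z}
  mul_mem' := by
    intro g h hg hh z
    obtain ⟨x, t, rfl⟩ := exists_rep z
    exact ((hh _).localForm.mul fun q => (hg _).localForm).isLocallyTypeD
  one_mem' := by
    intro z
    obtain ⟨x, t, rfl⟩ := exists_rep z
    exact (LocalForm.one _).isLocallyTypeD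
  inv_mem' := by
    intro g hg z
    obtain ⟨C, f, hf, hC, hC', hz, hgz, h⟩ := hg (g⁻¹ z)
    have e : g (g⁻¹ z) = z := g.apply_symm_apply z
    rw [e] at hgz
    refine ⟨C, f.symm, hf.symm, hC', hC, hgz, hz, fun x hx s hs => ?_⟩
    have := h x hx (f.symm s) (f.map_target hs)
    rw [f.right_inv hs] at this
    rw [← this]
    exact g.symm_apply_apply _

variable {S}

/-- The support of a homeomorphism of `Z`: the set of points that it moves. -/
def supp (g : S.DihedralSuspension ≃ₜ S.DihedralSuspension) : Set S.DihedralSuspension :=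
  {z | g z ≠ z}

variable (S)

/-- The subgroup `G_U` of elements of `G = 𝒯(φ, σ)` whose support is contained in `U`. -/
def supportedIn [CompactSpace X] [T2Space X] [TotallyDisconnectedSpace X]
    (U : Set S.DihedralSuspension) : Subgroup S.groupT where
  carrier := {g | supp g.1 ⊆ U}
  mul_mem' := by
    intro g h hg hh z hz
    by_contra hzU
    have h1 : h.1 z = z := by by_contra hc; exact hzU (hh hc)
    have h2 : g.1 z = z := by by_contra hc; exact hzU (hg hc)
    refine hz ?_
    change g.1 (h.1 z) = z
    rw [h1, h2]
  one_mem' := fun z hz => absurd rfl hz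
  inv_mem' := by
    intro g hg z hz
    refine hg fun hc => hz ?_
    change g.1.symm z = z
    rw [Homeomorph.symm_apply_eq, hc]

end ReversibleSystem

end SolenoidalThompson

namespace SolenoidalThompson

/-! ### Germs of order isomorphisms of the line -/

/-! Everything is pulled back to `X × ℝ`. Over a non-periodic point of `X` the projection to `Z` is
injective on the line, and such points are dense. Hence the local forms of an element of the group
agree on overlaps and assemble into a lift: a family of increasing homeomorphisms `F x` of the line,
locally of type `𝔇`, locally constant in `x` and equivariant under the dihedral group
(`descend_surjective`). Both claims then follow from one statement about lifts: a lift whose moved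
set has closure covered by a family `𝒱` of open saturated sets is a product of lifts, each supported
in a member of `𝒱` and each lying in the commutator subgroup (`mem_fragGroup`). A general cover
gives fragmentation, and the cover `{univ}` gives perfection.

The factors are bumps: a compactly supported `f` of type `𝔇` on `(a, b)`, copied to all translates
of a box `D × (a, b)` that meets each orbit at most once. For a fixed box, `f ↦` bump is a
homomorphism, so bumps are products of commutators as soon as the compactly supported group of `(a,
b)` is perfect (`Dc_Ioo_le_commutator`). This is the one-dimensional half of the proof.

In the PL case, compactly supported maps are products of kinks, the maps with one breakpoint where
the slope jumps from `1` to `2`. Modulo commutators of compactly supported maps, a product of kinks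
is determined by its affine germ at `+∞`. That germ is trivial for a compactly supported map, which
gives `PLc_univ_le_commutator`. Conjugation squeezes this result into any interval. For type `𝔇`, a
germ at a singular fixed point commutes with doubling, so it splits into two one-sided germs
extending to maps of a half-line that commute with `t ↦ 2 * t`. The group `Tt` of such maps is
perfect, because periodic extension carries the PL result over from a fundamental domain. Each
singular point can thus be removed by a product of commutators, and induction on their number
finishes.

For fragmentation, take a fine grid of dyadic walls `X × {c}` with `2 * c` not an integer. Each wall
is slid onto its image under `F` along the linear interpolation between them, in short steps made by
bumps (`exists_move`). The segments swept out consist of points moved by `F`, so they are covered by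
`𝒱`, and translates of the interpolated wall stay uniformly apart, so the steps do not interfere.
After dividing out the slides, the remaining lift fixes all walls, and it falls apart into bumps on
the cells between consecutive walls (`matches_cell`). -/

theorem IsDyadic.sub {x y : ℝ} (hx : IsDyadic x) (hy : IsDyadic y) : IsDyadic (x - y) := by
  rw [sub_eq_add_neg]; exact hx.add hy.neg

theorem IsDyadic.zero : IsDyadic 0 := by simpa using IsDyadic.int 0

theorem IsDyadic.one : IsDyadic 1 := by simpa using IsDyadic.int 1

theorem PLGerm.congr {f g : ℝ → ℝ} {x : ℝ} (h : PLGerm f x) (hfg : g =ᶠ[𝓝 x] f) : PLGerm g x := by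
  have key : ∀ l ≤ 𝓝 x, AffAlong f l → AffAlong g l := by
    rintro l hl ⟨n, b, hb, h⟩
    refine ⟨n, b, hb, ?_⟩
    filter_upwards [h, hfg.filter_mono hl] with y h1 h2
    rw [h2, h1]
  exact ⟨key _ nhdsWithin_le_nhds h.1, key _ nhdsWithin_le_nhds h.2.1, h.2.2.imp id (key _ le_rfl)⟩

theorem AffAlong.congr {f g : ℝ → ℝ} {l : Filter ℝ} (h : AffAlong f l) (hfg : g =ᶠ[l] f) :
    AffAlong g l := by
  obtain ⟨n, b, hb, h⟩ := h
  exact ⟨n, b, hb, hfg.trans h⟩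

theorem AffAlong.plGerm {f : ℝ → ℝ} {x : ℝ} (h : AffAlong f (𝓝 x)) : PLGerm f x :=
  ⟨h.mono nhdsWithin_le_nhds, h.mono nhdsWithin_le_nhds, Or.inr h⟩

theorem tendsto_doubling (x : ℝ) : Tendsto (doubling x) (𝓝 x) (𝓝 x) := by
  have : Continuous (doubling x) := by unfold doubling; fun_prop
  simpa [doubling] using this.tendsto x

theorem HGerm.congr {f g : ℝ → ℝ} {x : ℝ} (h : HGerm f x) (hfg : g =ᶠ[𝓝 x] f) : HGerm g x := by
  refine ⟨h.1, hfg.self_of_nhds ▸ h.2.1, ?_⟩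
  filter_upwards [h.2.2, hfg, (tendsto_doubling x).eventually hfg] with y h1 h2 h3
  rw [h3, h1, h2, hfg.self_of_nhds]

/-- A one-sided affine germ is a two-sided affine germ at each nearby point of that side. Points
where a map fails to be PL are therefore isolated once they are allowed at all. -/
theorem PLGerm.eventually {f : ℝ → ℝ} {x : ℝ} (h : PLGerm f x) : ∀ᶠ y in 𝓝[≠] x, PLGerm f y := by
  rw [← nhdsLT_sup_nhdsGT, eventually_sup]
  constructor
  · obtain ⟨n, b, hb, h⟩ := h.1
    filter_upwards [eventually_eventually_nhdsWithin.2 h, self_mem_nhdsWithin] with y hy hyx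
    rw [(isOpen_Iio.nhdsWithin_eq hyx)] at hy
    exact AffAlong.plGerm ⟨n, b, hb, hy⟩
  · obtain ⟨n, b, hb, h⟩ := h.2.1
    filter_upwards [eventually_eventually_nhdsWithin.2 h, self_mem_nhdsWithin] with y hy hyx
    rw [(isOpen_Ioi.nhdsWithin_eq hyx)] at hy
    exact AffAlong.plGerm ⟨n, b, hb, hy⟩

/-- Germ version of being of type `𝔇`. -/
def DGerm (f : ℝ → ℝ) (x : ℝ) : Prop :=
  (∀ᶠ y in 𝓝[≠] x, PLGerm f y) ∧ (IsDyadic x → HGerm f x) ∧ (¬ IsDyadic x → AffAlong f (𝓝 x))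

theorem PLGerm.dGerm {f : ℝ → ℝ} {x : ℝ} (h : PLGerm f x) (hf : ContinuousAt f x) : DGerm f x :=
  ⟨h.eventually, fun hx => h.hGerm hf hx, fun hx => h.2.2.resolve_left hx⟩

theorem eventually_eventually_nhdsNE {p : ℝ → Prop} {x : ℝ} (h : ∀ᶠ y in 𝓝 x, p y) :
    ∀ᶠ y in 𝓝[≠] x, ∀ᶠ z in 𝓝 y, p z :=
  (eventually_eventually_nhds.2 h).filter_mono nhdsWithin_le_nhds

theorem DGerm.congr {f g : ℝ → ℝ} {x : ℝ} (h : DGerm f x) (hfg : g =ᶠ[𝓝 x] f) : DGerm g x := by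
  refine ⟨?_, fun hx => (h.2.1 hx).congr hfg, fun hx => (h.2.2 hx).congr hfg⟩
  filter_upwards [h.1, eventually_eventually_nhdsNE hfg] with y h1 h2
  exact h1.congr h2

theorem DGerm.dyadic_apply_iff {f : ℝ → ℝ} {x : ℝ} (h : DGerm f x) :
    IsDyadic (f x) ↔ IsDyadic x := by
  by_cases hx : IsDyadic x
  · exact iff_of_true (h.2.1 hx).2.1 hx
  · obtain ⟨n, b, hb, h⟩ := h.2.2 hx
    rw [h.self_of_nhds, IsDyadic.affine_iff n hb]

theorem tendsto_nhdsNE_of_injective {f : ℝ → ℝ} (hc : Continuous f) (hi : Function.Injective f)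
    (x : ℝ) : Tendsto f (𝓝[≠] x) (𝓝[≠] (f x)) :=
  tendsto_nhdsWithin_of_tendsto_nhds_of_eventually_within _
    (hc.continuousAt.tendsto.mono_left nhdsWithin_le_nhds)
    (eventually_nhdsWithin_of_forall fun _ hy => hi.ne hy)

theorem DGerm.comp {f g : ℝ → ℝ} {x : ℝ} (hf : DGerm f x) (hg : DGerm g (f x))
    (hc : Continuous f) (hi : Function.Injective f) : DGerm (g ∘ f) x := by
  refine ⟨?_, fun hx => (hf.2.1 hx).comp (hg.2.1 (hf.dyadic_apply_iff.2 hx)) hc.continuousAt,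
    fun hx => (hf.2.2 hx).comp (hg.2.2 fun h => hx (hf.dyadic_apply_iff.1 h)) hc.continuousAt⟩
  filter_upwards [hf.1, (tendsto_nhdsNE_of_injective hc hi x).eventually hg.1] with y h1 h2
  exact h1.comp h2 hc.continuousAt

theorem PLGerm.inv {f : ℝ ≃o ℝ} {x : ℝ} (h : PLGerm f x) : PLGerm (f.symm) (f x) :=
  PLGerm.symm (f := f.toHomeomorph.toOpenPartialHomeomorph) (mem_univ x) h

theorem HGerm.inv {f : ℝ ≃o ℝ} {x : ℝ} (h : HGerm f x) : HGerm (f.symm) (f x) :=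
  HGerm.symm (f := f.toHomeomorph.toOpenPartialHomeomorph) (mem_univ x) h

theorem DGerm.inv {f : ℝ ≃o ℝ} {x : ℝ} (h : DGerm f x) : DGerm (f.symm) (f x) := by
  refine ⟨?_, fun hx => (h.2.1 (h.dyadic_apply_iff.1 hx)).inv, fun hx => ?_⟩
  · have ht := tendsto_nhdsNE_of_injective f.symm.continuous f.symm.injective (f x)
    rw [f.symm_apply_apply] at ht
    filter_upwards [ht.eventually h.1] with y hy
    have := hy.inv
    rwa [f.apply_symm_apply] at this
  · have := (AffAlong.plGerm (h.2.2 fun hd => hx (h.dyadic_apply_iff.2 hd))).inv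
    exact this.2.2.resolve_left hx

/-- The group of dyadic PL homeomorphisms of the line (with locally finitely many breakpoints). -/
def PL : Subgroup (ℝ ≃o ℝ) where
  carrier := {f | ∀ x, PLGerm f x}
  mul_mem' {f g} hf hg x := (hg x).comp (hf _) g.continuous.continuousAt
  one_mem' x := AffAlong.plGerm ⟨0, 0, .zero, Eventually.of_forall fun y => by simp⟩
  inv_mem' {f} hf x := by
    have := (hf (f.symm x)).inv
    rwa [f.apply_symm_apply] at this

/-- The group of homeomorphisms of the line that are locally of type `𝔇`. -/
def DD : Subgroup (ℝ ≃o ℝ) where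
  carrier := {f | ∀ x, DGerm f x}
  mul_mem' {f g} hf hg x := (hg x).comp (hf _) g.continuous g.injective
  one_mem' x := (PL.one_mem x).dGerm continuous_id.continuousAt
  inv_mem' {f} hf x := by
    have := (hf (f.symm x)).inv
    rwa [f.apply_symm_apply] at this

theorem PL_le_DD : PL ≤ DD := fun f hf x => (hf x).dGerm f.continuous.continuousAt

theorem DD.dyadic {f : ℝ ≃o ℝ} (hf : f ∈ DD) {x : ℝ} (hx : IsDyadic x) : IsDyadic (f x) :=
  (hf x).dyadic_apply_iff.2 hx

/-! ### Comparison with type `𝔇` -/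

theorem IsTypeD.dGerm {f : OpenPartialHomeomorph ℝ ℝ} (hf : IsTypeD f) {x : ℝ}
    (hx : x ∈ f.source) : DGerm f x := by
  obtain ⟨-, -, B, h1, h2, h3⟩ := isTypeD_iff.1 hf
  refine ⟨?_, fun hd => hf.hGerm hx hd, fun hd => ?_⟩
  · have : ((B.erase x : Finset ℝ) : Set ℝ)ᶜ ∈ 𝓝 x :=
      (Finset.finite_toSet _).isClosed.isOpen_compl.mem_nhds (by simp)
    filter_upwards [nhdsWithin_le_nhds this, nhdsWithin_le_nhds (f.open_source.mem_nhds hx),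
      self_mem_nhdsWithin] with y h4 h5 h6
    exact h2 y h5 fun h7 => h4 (Finset.mem_coe.2 (Finset.mem_erase.2 ⟨h6, h7⟩))
  · exact (h2 x hx fun hB => hd (h3 x hB).1).2.2.resolve_left hd

/-- Each point has a neighbourhood containing no bad point except possibly itself, and compactness
makes finitely many of these suffice. -/
theorem finite_not_PLGerm {f : ℝ → ℝ} {K : Set ℝ} (hK : IsCompact K)
    (h : ∀ x ∈ K, ∀ᶠ y in 𝓝[≠] x, PLGerm f y) : {x ∈ K | ¬ PLGerm f x}.Finite := by
  have : ∀ x ∈ K, ∃ t ∈ 𝓝[K] x, (t ∩ {x | ¬ PLGerm f x}).Finite := by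
    intro x hx
    refine ⟨insert x {y | PLGerm f y}, nhdsWithin_le_nhds ?_, (finite_singleton x).subset ?_⟩
    · exact insert_mem_nhds_iff.2 (h x hx)
    · rintro y ⟨rfl | hy, hy'⟩
      · rfl
      · exact absurd hy hy'
  obtain ⟨t, ht'⟩ := hK.elim_nhdsWithin_subcover' (fun x hx => (this x hx).choose)
    fun x hx => (this x hx).choose_spec.1
  refine ((t.finite_toSet.biUnion (t := fun x => (this x.1 x.2).choose ∩ {x | ¬ PLGerm f x})
    fun x _ => (this x.1 x.2).choose_spec.2)).subset ?_
  rintro x ⟨hx, hx'⟩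
  obtain ⟨y, hy, hxy⟩ := mem_iUnion₂.1 (ht' hx)
  exact mem_biUnion hy ⟨hxy, hx'⟩

/-- The exceptional set consists of the finitely many non-PL points of the interval. They are
dyadic, since at a non-dyadic point a `DGerm` is affine. -/
theorem DD.exists_isTypeD {f : ℝ ≃o ℝ} (hf : f ∈ DD) {p q : ℝ} (hp : IsDyadic p) (hq : IsDyadic q)
    (hpq : p < q) : ∃ k : OpenPartialHomeomorph ℝ ℝ, IsTypeD k ∧ k.source = Ioo p q ∧
      ∀ t, k t = f t := by
  let k := f.toHomeomorph.toOpenPartialHomeomorph.restr (Ioo p q)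
  have hks : k.source = Ioo p q := by
    rw [OpenPartialHomeomorph.restr_source' _ _ isOpen_Ioo]
    simp
  have hk : ∀ t, k t = f t := fun t => rfl
  have hke : (k : ℝ → ℝ) = f := rfl
  have hfin := finite_not_PLGerm (f := f) (isCompact_Icc (a := p) (b := q)) fun x _ => (hf x).1
  have hmem : ∀ x, x ∈ hfin.toFinset.filter (· ∈ Ioo p q) ↔ x ∈ Ioo p q ∧ ¬ PLGerm f x := by
    intro x
    rw [Finset.mem_filter, Finite.mem_toFinset]
    exact ⟨fun h => ⟨h.2, h.1.2⟩, fun h => ⟨⟨Ioo_subset_Icc_self h.1, h.2⟩, h.1⟩⟩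
  refine ⟨k, isTypeD_iff.2 ⟨hks ▸ ⟨p, q, hp, hq, hpq, rfl⟩, ?_,
    hfin.toFinset.filter (· ∈ Ioo p q), ?_, ?_, ?_⟩, hks, hk⟩
  · rw [← k.image_source_eq_target, hks, hke]
    exact isDyadicInterval_image hpq f.continuous.continuousOn f.injective.injOn
      (DD.dyadic hf hp) (DD.dyadic hf hq)
  · intro x hx
    rw [hks]
    exact ((hmem x).1 hx).1
  · intro x hx hxB
    rw [hks] at hx
    by_contra hc
    exact hxB ((hmem x).2 ⟨hx, hc⟩)
  · intro x hx
    obtain ⟨h1, h2⟩ := (hmem x).1 hx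
    refine (hf x).2.1 ?_
    by_contra hd
    exact h2 (AffAlong.plGerm ((hf x).2.2 hd))

/-! ### Gluing order isomorphisms -/

/-- The order isomorphism that equals `f` on `(-∞, c]` and `g` on `[c, ∞)`. -/
noncomputable def glue (f g : ℝ ≃o ℝ) (c : ℝ) (h : f c = g c) : ℝ ≃o ℝ := by
  classical
  refine StrictMono.orderIsoOfRightInverse (fun t => if t ≤ c then f t else g t) ?_
    (fun s => if s ≤ f c then f.symm s else g.symm s) ?_
  · intro s t hst
    by_cases hs : s ≤ c <;> by_cases ht : t ≤ c
    · simpa [hs, ht] using hst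
    · simp only [hs, ht, if_true, if_false]
      calc f s ≤ f c := f.monotone hs
        _ = g c := h
        _ < g t := g.strictMono (not_le.1 ht)
    · exact absurd (hst.le.trans ht) hs
    · simpa [hs, ht] using hst
  · intro s
    by_cases hs : s ≤ f c
    · have : f.symm s ≤ c := by rwa [← f.le_iff_le, f.apply_symm_apply]
      simp [hs, this]
    · have : ¬ g.symm s ≤ c := by rwa [← g.le_iff_le, g.apply_symm_apply, ← h]
      simp [hs, this]

theorem glue_of_le {f g : ℝ ≃o ℝ} {c : ℝ} (h : f c = g c) {t : ℝ} (ht : t ≤ c) :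
    glue f g c h t = f t := if_pos ht

theorem glue_of_ge {f g : ℝ ≃o ℝ} {c : ℝ} (h : f c = g c) {t : ℝ} (ht : c ≤ t) :
    glue f g c h t = g t := by
  rcases ht.eq_or_lt with rfl | ht
  · rw [glue_of_le h le_rfl, h]
  · exact if_neg ht.not_ge

theorem glue_eventuallyEq_left {f g : ℝ ≃o ℝ} {c : ℝ} (h : f c = g c) {t : ℝ} (ht : t < c) :
    glue f g c h =ᶠ[𝓝 t] f :=
  mem_of_superset (Iio_mem_nhds ht) fun _ hs => glue_of_le h (le_of_lt hs)

theorem glue_eventuallyEq_right {f g : ℝ ≃o ℝ} {c : ℝ} (h : f c = g c) {t : ℝ} (ht : c < t) :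
    glue f g c h =ᶠ[𝓝 t] g :=
  mem_of_superset (Ioi_mem_nhds ht) fun _ hs => glue_of_ge h (le_of_lt hs)


theorem glue_PLGerm {f g : ℝ ≃o ℝ} {c : ℝ} (h : f c = g c) (hc : IsDyadic c) {t : ℝ}
    (hf : t ≤ c → PLGerm f t) (hg : c ≤ t → PLGerm g t) : PLGerm (glue f g c h) t := by
  rcases lt_trichotomy t c with ht | rfl | ht
  · exact (hf ht.le).congr (glue_eventuallyEq_left h ht)
  · exact ⟨(hf le_rfl).1.congr (eventually_nhdsWithin_of_forall fun s hs =>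
      glue_of_le h (le_of_lt hs)), (hg le_rfl).2.1.congr
      (eventually_nhdsWithin_of_forall fun s hs => glue_of_ge h (le_of_lt hs)), Or.inl hc⟩
  · exact (hg ht.le).congr (glue_eventuallyEq_right h ht)

theorem glue_mem_PL {f g : ℝ ≃o ℝ} {c : ℝ} (h : f c = g c) (hc : IsDyadic c) (hf : f ∈ PL)
    (hg : g ∈ PL) : glue f g c h ∈ PL :=
  fun t => glue_PLGerm h hc (fun _ => hf t) fun _ => hg t

/-- Doubling about the cut point preserves both sides of it, so commutation with doubling can be
checked on each side separately. -/
theorem glue_mem_DD {f g : ℝ ≃o ℝ} {c : ℝ} (h : f c = g c) (hc : IsDyadic c) (hf : f ∈ DD)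
    (hg : g ∈ DD) : glue f g c h ∈ DD := by
  intro t
  rcases lt_trichotomy t c with ht | rfl | ht
  · exact (hf t).congr (glue_eventuallyEq_left h ht)
  · refine ⟨?_, fun _ => ⟨hc, ?_, ?_⟩, fun hd => absurd hc hd⟩
    · filter_upwards [(hf t).1, (hg t).1, self_mem_nhdsWithin] with y h1 h2 h3
      rcases lt_or_gt_of_ne h3 with h3 | h3
      · exact h1.congr (glue_eventuallyEq_left h h3)
      · exact h2.congr (glue_eventuallyEq_right h h3)
    · rw [glue_of_le h le_rfl]
      exact DD.dyadic hf hc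
    · filter_upwards [((hf t).2.1 hc).2.2, ((hg t).2.1 hc).2.2] with y h1 h2
      rcases le_total y t with hy | hy
      · rw [glue_of_le h hy, glue_of_le h le_rfl, glue_of_le h, h1]
        simp only [doubling]; linarith
      · rw [glue_of_ge h hy, glue_of_ge h le_rfl, glue_of_ge h, h2]
        simp only [doubling]; linarith
  · exact (hg t).congr (glue_eventuallyEq_right h ht)

/-! ### Affine maps and PL interpolation -/

/-- The affine map `t ↦ 2 ^ n * t + b`. -/
noncomputable def aff (n : ℤ) (b : ℝ) : ℝ ≃o ℝ := by
  refine StrictMono.orderIsoOfRightInverse (fun t => 2 ^ n * t + b) ?_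
    (fun s => 2 ^ (-n) * (s - b)) ?_
  · intro s t hst
    have : (0 : ℝ) < 2 ^ n := by positivity
    simpa using mul_lt_mul_of_pos_left hst this
  · intro s
    simp only [zpow_neg]
    field_simp
    ring

@[simp] theorem aff_apply (n : ℤ) (b t : ℝ) : aff n b t = 2 ^ n * t + b := rfl

theorem aff_mem_PL (n : ℤ) {b : ℝ} (hb : IsDyadic b) : aff n b ∈ PL :=
  fun _ => AffAlong.plGerm ⟨n, b, hb, Eventually.of_forall fun _ => rfl⟩

theorem exists_PL_apply_add {x y x' y' : ℝ} (hx : IsDyadic x) (hx' : IsDyadic x')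
    (h : ∃ f ∈ PL, f 0 = 0 ∧ f x = x') (h' : ∃ f ∈ PL, f 0 = 0 ∧ f y = y') (hx0 : 0 ≤ x)
    (hy0 : 0 ≤ y) : ∃ f ∈ PL, f 0 = 0 ∧ f (x + y) = x' + y' := by
  obtain ⟨f, hf, hf0, hfx⟩ := h
  obtain ⟨g, hg, hg0, hgy⟩ := h'
  have hgl : f x = (aff 0 x' * g * aff 0 (-x)) x := by simp [hfx, hg0]
  refine ⟨glue f _ x hgl, glue_mem_PL _ hx hf
    (mul_mem (mul_mem (aff_mem_PL 0 hx') hg) (aff_mem_PL 0 hx.neg)), ?_, ?_⟩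
  · rw [glue_of_le hgl hx0, hf0]
  · rw [glue_of_ge hgl (by linarith)]
    simp [hgy, add_comm]

/-- Inductive step: halve `[0, 1]`, stretch the first half to length `n + 1` and the second half to
length `1`. -/
theorem exists_PL_apply_one_nat (n : ℕ) : ∃ f ∈ PL, f 0 = 0 ∧ f 1 = n + 1 := by
  induction n with
  | zero => exact ⟨1, one_mem _, rfl, by simp⟩
  | succ n ih =>
    obtain ⟨f, hf, hf0, hf1⟩ := ih
    have h2 : IsDyadic (1 / 2) := ⟨1, 1, by norm_num⟩
    have h1 : IsDyadic ((n : ℝ) + 1) := by exact_mod_cast IsDyadic.int (n + 1)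
    have := exists_PL_apply_add (x := 1 / 2) (y := 1 / 2) (x' := n + 1) (y' := 1) h2 h1
      ⟨f * aff 1 0, mul_mem hf (aff_mem_PL 1 .zero), by simp [hf0], by simp [hf1]⟩
      ⟨aff 1 0, aff_mem_PL 1 .zero, by simp, by simp⟩ (by norm_num) (by norm_num)
    norm_num at this
    push_cast
    exact this

theorem exists_PL_apply_one {x : ℝ} (hx : IsDyadic x) (hx0 : 0 < x) :
    ∃ f ∈ PL, f 0 = 0 ∧ f 1 = x := by
  obtain ⟨m, k, rfl⟩ := hx
  have hm : 0 < m := by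
    have h2 : (0 : ℝ) < 2 ^ k := by positivity
    exact_mod_cast (div_pos_iff_of_pos_right h2).1 hx0
  obtain ⟨n, rfl⟩ : ∃ n : ℕ, m = n + 1 := ⟨(m - 1).toNat, by omega⟩
  obtain ⟨f, hf, hf0, hf1⟩ := exists_PL_apply_one_nat n
  refine ⟨aff (-k) 0 * f, mul_mem (aff_mem_PL _ .zero) hf, by simp [hf0], ?_⟩
  simp [hf1]
  ring

/-- Up to translation, both intervals are PL images of `[0, 1]`, so one passes from the first to the
second through the unit interval. -/
theorem exists_PL_interp {a b a' b' : ℝ} (ha : IsDyadic a) (hb : IsDyadic b) (ha' : IsDyadic a')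
    (hb' : IsDyadic b') (hab : a < b) (hab' : a' < b') : ∃ f ∈ PL, f a = a' ∧ f b = b' := by
  obtain ⟨f, hf, hf0, hf1⟩ := exists_PL_apply_one (hb.sub ha) (sub_pos.2 hab)
  obtain ⟨g, hg, hg0, hg1⟩ := exists_PL_apply_one (hb'.sub ha') (sub_pos.2 hab')
  refine ⟨aff 0 a' * g * f⁻¹ * aff 0 (-a), mul_mem (mul_mem (mul_mem (aff_mem_PL 0 ha') hg)
    (inv_mem hf)) (aff_mem_PL 0 ha.neg), ?_, ?_⟩
  · have : f⁻¹ 0 = 0 := (f.symm_apply_eq).2 hf0.symm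
    simp [this, hg0]
  · have : f⁻¹ (b - a) = 1 := (f.symm_apply_eq).2 hf1.symm
    simp [← sub_eq_add_neg, this, hg1]

/-- A modification of `f` outside `[c', d']` that is the identity outside `[c, d]`. -/
theorem exists_patch {f : ℝ ≃o ℝ} (hf : f ∈ DD) {c c' d' d : ℝ} (hc : IsDyadic c)
    (hc' : IsDyadic c') (hd' : IsDyadic d') (hd : IsDyadic d) (h1 : c < c') (h2 : c' < d')
    (h3 : d' < d) (h4 : c < f c') (h5 : f d' < d) :
    ∃ k ∈ DD, (∀ t ∈ Icc c' d', k t = f t) ∧ (∀ t ∉ Ioo c d, k t = t) ∧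
      ∀ t, (t ∈ Icc c' d' → PLGerm f t) → PLGerm k t := by
  obtain ⟨m, hm, hm1, hm2⟩ := exists_PL_interp hc hc' hc (DD.dyadic hf hc') h1 h4
  obtain ⟨m', hm', hm1', hm2'⟩ := exists_PL_interp hd' hd (DD.dyadic hf hd') hd h3 h5
  have e1 : (1 : ℝ ≃o ℝ) c = m c := hm1.symm
  have e2 : glue 1 m c e1 c' = f c' := by rw [glue_of_ge e1 h1.le, hm2]
  have e3 : glue _ f c' e2 d' = m' d' := by rw [glue_of_ge e2 h2.le, hm1']
  have e4 : glue _ m' d' e3 d = (1 : ℝ ≃o ℝ) d := by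
    rw [glue_of_ge e3 h3.le, hm2']; rfl
  have q1 := glue_mem_PL e1 hc (one_mem _) hm
  have hD := glue_mem_DD e4 hd (glue_mem_DD e3 hd' (glue_mem_DD e2 hc' (PL_le_DD q1) hf)
    (PL_le_DD hm')) (one_mem _)
  refine ⟨_, hD, ?_, ?_, ?_⟩
  · rintro t ⟨h6, h7⟩
    rw [glue_of_le e4 (h7.trans h3.le), glue_of_le e3 h7, glue_of_ge e2 h6]
  · intro t ht
    by_cases h6 : t ≤ c
    · rw [glue_of_le e4 (by linarith), glue_of_le e3 (by linarith), glue_of_le e2 (by linarith),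
        glue_of_le e1 h6]
      rfl
    · have : d ≤ t := by
        by_contra h
        exact ht ⟨not_le.1 h6, not_le.1 h⟩
      rw [glue_of_ge e4 this]
      rfl
  · intro t ht
    refine glue_PLGerm e4 hd (fun _ => glue_PLGerm e3 hd' (fun h8 => glue_PLGerm e2 hc'
      (fun _ => q1 t) fun h9 => ht ⟨h9, h8⟩) fun _ => hm' t) fun _ => one_mem PL t

theorem exists_PL_move {p q x y : ℝ} (hp : IsDyadic p) (hq : IsDyadic q) (hx : IsDyadic x)
    (hy : IsDyadic y) (hpx : p < x) (hpy : p < y) (hxq : x < q) (hyq : y < q) :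
    ∃ f ∈ PL, f x = y ∧ ∀ t ∉ Ioo p q, f t = t := by
  obtain ⟨m, hm, hm1, hm2⟩ := exists_PL_interp hp hx hp hy hpx hpy
  obtain ⟨m', hm', hm1', hm2'⟩ := exists_PL_interp hx hq hy hq hxq hyq
  have e1 : (1 : ℝ ≃o ℝ) p = m p := hm1.symm
  have e2 : glue 1 m p e1 x = m' x := by rw [glue_of_ge e1 hpx.le, hm2, hm1']
  have e3 : glue _ m' x e2 q = (1 : ℝ ≃o ℝ) q := by rw [glue_of_ge e2 hxq.le, hm2']; rfl
  refine ⟨_, glue_mem_PL e3 hq (glue_mem_PL e2 hx (glue_mem_PL e1 hp (one_mem _) hm) hm')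
    (one_mem _), ?_, ?_⟩
  · rw [glue_of_le e3 hxq.le, glue_of_ge e2 le_rfl, hm1']
  · intro t ht
    by_cases h6 : t ≤ p
    · rw [glue_of_le e3 (by linarith), glue_of_le e2 (by linarith), glue_of_le e1 h6]
      rfl
    · have : q ≤ t := by
        by_contra h
        exact ht ⟨not_le.1 h6, not_le.1 h⟩
      rw [glue_of_ge e3 this]
      rfl

/-! ### Induction along chains of dyadic points -/

theorem IsDyadic.mul_div_two_pow {x : ℝ} (hx : IsDyadic x) (i k : ℕ) :
    IsDyadic (i * (x / 2 ^ k)) := by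
  have : (i : ℝ) * (x / 2 ^ k) = ((i : ℤ) : ℝ) * x * 2 ^ (-(k : ℤ)) := by
    rw [zpow_neg]; simp; ring
  rw [this]
  exact ((IsDyadic.int _).mul hx).mul (.two_zpow _)

/-- A Lebesgue number of the cover bounds the mesh. Cutting `[a, b]` into `2 ^ k` equal pieces keeps
all division points dyadic. -/
theorem dyadic_chain {P : ℝ → ℝ → Prop} {a b : ℝ} (ha : IsDyadic a) (hb : IsDyadic b)
    (hab : a < b)
    (htrans : ∀ x y z, IsDyadic x → IsDyadic y → IsDyadic z → x < y → y < z → P x y → P y z → P x z)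
    (hloc : ∀ t ∈ Icc a b, ∃ N ∈ 𝓝 t, ∀ x y, IsDyadic x → IsDyadic y → x < y → Icc x y ⊆ N → P x y) :
    P a b := by
  choose! N hN hP using hloc
  obtain ⟨δ, hδ, hleb⟩ := lebesgue_number_lemma_of_metric (s := Icc a b)
    (c := fun t : Icc a b => interior (N t)) isCompact_Icc (fun t => isOpen_interior)
    fun t ht => mem_iUnion.2 ⟨⟨t, ht⟩, mem_interior_iff_mem_nhds.2 (hN t ht)⟩
  obtain ⟨k, hk⟩ := pow_unbounded_of_one_lt ((b - a) / δ) (one_lt_two (α := ℝ))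
  have h2 : (0 : ℝ) < 2 ^ k := by positivity
  set e := (b - a) / 2 ^ k with he
  have he0 : 0 < e := div_pos (sub_pos.2 hab) h2
  have heδ : e < δ := by
    rw [he, div_lt_iff₀ h2]; rw [div_lt_iff₀ hδ] at hk; linarith
  have hde : ∀ i : ℕ, IsDyadic (a + i * e) := fun i => ha.add ((hb.sub ha).mul_div_two_pow i k)
  have hend : a + (2 ^ k : ℕ) * e = b := by
    rw [he]; push_cast; field_simp; ring
  have step : ∀ i : ℕ, i < 2 ^ k → P (a + i * e) (a + (i + 1 : ℕ) * e) := by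
    intro i hi
    have h3 : ((i + 1 : ℕ) : ℝ) ≤ (2 ^ k : ℕ) := by exact_mod_cast hi
    have h4 : a + (i + 1 : ℕ) * e ≤ b := by
      rw [← hend]; gcongr
    have h5 : a + i * e < a + (i + 1 : ℕ) * e := by push_cast; linarith
    have h6 : 0 ≤ i * e := by positivity
    obtain ⟨t, ht⟩ := hleb (a + i * e) ⟨by linarith, by linarith⟩
    refine hP t t.2 _ _ (hde _) (hde _) h5 (fun y hy => interior_subset (ht ?_))
    rw [Real.ball_eq_Ioo]
    have := hy.2
    push_cast at this
    exact ⟨by linarith [hy.1], by linarith⟩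
  have main : ∀ i : ℕ, i < 2 ^ k → P a (a + (i + 1 : ℕ) * e) := by
    intro i
    induction i with
    | zero => intro hi; simpa using step 0 hi
    | succ i ih =>
      intro hi
      refine htrans _ _ _ ha (hde _) (hde _) ?_ ?_ (ih (by omega)) (step _ hi)
      · have : (0 : ℝ) < (i + 1 : ℕ) * e := by positivity
        linarith
      · push_cast; linarith
  -- `main i` reaches the division point `i + 1`, so the endpoint `b` is index `2 ^ k - 1`.
  have := main (2 ^ k - 1) (Nat.sub_lt (by positivity) one_pos)
  rwa [Nat.sub_add_cancel Nat.one_le_two_pow, hend] at this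

/-! ### Compactly supported elements -/

/-- The order isomorphisms with support in a compact subset of `U`. -/
def Kc (U : Set ℝ) : Subgroup (ℝ ≃o ℝ) where
  carrier := {f | ∃ K, IsCompact K ∧ K ⊆ U ∧ ∀ t ∉ K, f t = t}
  mul_mem' := by
    rintro f g ⟨K, hK, hKU, hf⟩ ⟨L, hL, hLU, hg⟩
    refine ⟨K ∪ L, hK.union hL, union_subset hKU hLU, fun t ht => ?_⟩
    rw [mem_union, not_or] at ht
    rw [RelIso.mul_apply, hg t ht.2, hf t ht.1]
  one_mem' := ⟨∅, isCompact_empty, empty_subset _, fun _ _ => rfl⟩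
  inv_mem' := by
    rintro f ⟨K, hK, hKU, hf⟩
    exact ⟨K, hK, hKU, fun t ht => f.symm_apply_eq.2 (hf t ht).symm⟩

/-- Compactly supported PL homeomorphisms. -/
def PLc (U : Set ℝ) : Subgroup (ℝ ≃o ℝ) := PL ⊓ Kc U

/-- Compactly supported homeomorphisms of type `𝔇`. -/
def Dc (U : Set ℝ) : Subgroup (ℝ ≃o ℝ) := DD ⊓ Kc U

theorem Kc_mono {U V : Set ℝ} (h : U ⊆ V) : Kc U ≤ Kc V :=
  fun _ ⟨K, hK, hKU, hf⟩ => ⟨K, hK, hKU.trans h, hf⟩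

theorem PLc_mono {U V : Set ℝ} (h : U ⊆ V) : PLc U ≤ PLc V := inf_le_inf_left _ (Kc_mono h)

theorem PLc_le_Dc (U : Set ℝ) : PLc U ≤ Dc U := inf_le_inf_right _ PL_le_DD

theorem mem_Kc_of_Ioo {U : Set ℝ} {f : ℝ ≃o ℝ} {p q : ℝ} (hU : Icc p q ⊆ U)
    (hf : ∀ t ∉ Ioo p q, f t = t) : f ∈ Kc U :=
  ⟨Icc p q, isCompact_Icc, hU, fun t ht => hf t fun h => ht (Ioo_subset_Icc_self h)⟩

theorem exists_dyadic_Ioo_of_mem_Kc {a b : ℝ} (hab : a < b) {f : ℝ ≃o ℝ} (hf : f ∈ Kc (Ioo a b)) :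
    ∃ p q, IsDyadic p ∧ IsDyadic q ∧ a < p ∧ p < q ∧ q < b ∧ ∀ t ∉ Ioo p q, f t = t := by
  obtain ⟨K, hK, hKU, hf⟩ := hf
  -- The compact set may be empty; adjoining a point `m` of the interval makes its infimum and
  -- supremum meaningful and gives `p < q`.
  obtain ⟨m, hm, ham, hmb⟩ := exists_isDyadic_btwn hab
  have hK' : IsCompact (insert m K) := hK.insert m
  have hsub : insert m K ⊆ Ioo a b := insert_subset ⟨ham, hmb⟩ hKU
  have hne : (insert m K).Nonempty := insert_nonempty _ _
  obtain ⟨p, hp, hap, hp'⟩ := exists_isDyadic_btwn (hsub (hK'.sInf_mem hne)).1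
  obtain ⟨q, hq, hq', hqb⟩ := exists_isDyadic_btwn (hsub (hK'.sSup_mem hne)).2
  have hl : ∀ t ∈ insert m K, p < t := fun t ht => hp'.trans_le (csInf_le hK'.bddBelow ht)
  have hr : ∀ t ∈ insert m K, t < q := fun t ht => (le_csSup hK'.bddAbove ht).trans_lt hq'
  exact ⟨p, q, hp, hq, hap, (hl m (mem_insert _ _)).trans (hr m (mem_insert _ _)), hqb,
    fun t ht => hf t fun h => ht ⟨hl t (mem_insert_of_mem _ h), hr t (mem_insert_of_mem _ h)⟩⟩

theorem exists_int_Ioo_of_mem_Kc {f : ℝ ≃o ℝ} (hf : f ∈ Kc univ) :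
    ∃ n : ℕ, 0 < n ∧ ∀ t ∉ Ioo (-n : ℝ) n, f t = t := by
  obtain ⟨K, hK, -, hf⟩ := hf
  obtain ⟨r, hr⟩ := hK.isBounded.subset_ball 0
  obtain ⟨n, hn⟩ := exists_nat_gt (max r 0)
  refine ⟨n, ?_, fun t ht => hf t fun h => ht ?_⟩
  · exact_mod_cast (le_max_right r 0).trans_lt hn
  · have := hr h
    rw [Real.ball_eq_Ioo] at this
    have h2 := (le_max_left r 0).trans_lt hn
    exact ⟨by linarith [this.1], by linarith [this.2]⟩

theorem mapsTo_of_fix_compl {f : ℝ ≃o ℝ} {S : Set ℝ} (hf : ∀ t ∉ S, f t = t) {t : ℝ} :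
    f t ∈ S ↔ t ∈ S := by
  by_cases ht : t ∈ S
  · refine iff_of_true ?_ ht
    by_contra h
    have := f.injective (hf _ h)
    rw [this] at h
    exact h ht
  · rw [hf t ht]

theorem commute_of_fix {f h : ℝ ≃o ℝ} {S : Set ℝ} (hf : ∀ t ∉ S, f t = t) (hh : ∀ t ∈ S, h t = t) :
    Commute h f := by
  ext t
  rw [RelIso.mul_apply, RelIso.mul_apply]
  by_cases ht : t ∈ S
  · rw [hh t ht, hh _ ((mapsTo_of_fix_compl hf).2 ht)]
  · have : h t ∉ S := fun h' => ht (h.injective (hh _ h') ▸ h')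
    rw [hf t ht, hf _ this]

/-- `k⁻¹ * g` is the identity on the support of `f`, hence commutes with `f`: conjugating `f` only
sees the conjugator on that support. -/
theorem conj_eq_of_eqOn {f g k : ℝ ≃o ℝ} {S : Set ℝ} (hf : ∀ t ∉ S, f t = t)
    (hgk : ∀ t ∈ S, k t = g t) : g * f * g⁻¹ = k * f * k⁻¹ := by
  have : Commute (k⁻¹ * g) f := commute_of_fix hf fun t ht => by
    rw [RelIso.mul_apply, ← hgk t ht]
    exact k.symm_apply_apply t
  have h2 := this.eq
  calc g * f * g⁻¹ = k * ((k⁻¹ * g) * f) * g⁻¹ := by group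
    _ = _ := by rw [h2]; group

/-- An element of `PL` agrees on any bounded interval with a compactly supported one. -/
theorem exists_PLc_eqOn {g : ℝ ≃o ℝ} (hg : g ∈ PL) {p q : ℝ} (hp : IsDyadic p) (hq : IsDyadic q)
    (hpq : p < q) : ∃ k ∈ PLc univ, ∀ t ∈ Icc p q, k t = g t := by
  obtain ⟨c, hc, -, hc'⟩ := exists_isDyadic_btwn (sub_one_lt (min p (g p)))
  obtain ⟨d, hd, hd', -⟩ := exists_isDyadic_btwn (lt_add_one (max q (g q)))
  obtain ⟨k, -, hk, hk', hkP⟩ := exists_patch (PL_le_DD hg) hc hp hq hd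
    (hc'.trans_le (min_le_left _ _)) hpq ((le_max_left _ _).trans_lt hd')
    (hc'.trans_le (min_le_right _ _)) ((le_max_right _ _).trans_lt hd')
  exact ⟨k, ⟨fun t => hkP t fun _ => hg t, mem_Kc_of_Ioo (subset_univ _) hk'⟩, hk⟩

/-- On the bounded support of `f` the map `g` agrees with a compactly supported `k`, and the
conjugate does not notice the replacement. Consequently `⁅PLc univ, PLc univ⁆` is normal in `PL`,
and `PLc univ` becomes central in the quotient. -/
theorem conj_mul_inv_mem_commutator {f g : ℝ ≃o ℝ} (hf : f ∈ PLc univ) (hg : g ∈ PL) :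
    g * f * g⁻¹ * f⁻¹ ∈ ⁅PLc univ, PLc univ⁆ := by
  obtain ⟨n, hn, hfn⟩ := exists_int_Ioo_of_mem_Kc hf.2
  have hdn : IsDyadic (n : ℝ) := by exact_mod_cast IsDyadic.int n
  have hn' : (0 : ℝ) < n := by exact_mod_cast hn
  obtain ⟨k, hk, hkg⟩ := exists_PLc_eqOn hg hdn.neg hdn (by linarith)
  rw [conj_eq_of_eqOn hfn fun t ht => hkg t (Ioo_subset_Icc_self ht)]
  exact Subgroup.commutator_mem_commutator hk hf

/-! ### Germs at infinity -/

/-- `f` is the identity near `-∞` and `t ↦ 2 ^ n * t + b` near `+∞`. -/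
def AffAtInfty (f : ℝ ≃o ℝ) (n : ℤ) (b : ℝ) : Prop :=
  (∀ᶠ t in atBot, f t = t) ∧ ∀ᶠ t in atTop, f t = 2 ^ n * t + b

theorem AffAtInfty.one : AffAtInfty 1 0 0 :=
  ⟨Eventually.of_forall fun _ => rfl, Eventually.of_forall fun _ => by simp⟩

theorem AffAtInfty.mul {f g : ℝ ≃o ℝ} {n m : ℤ} {b c : ℝ} (hf : AffAtInfty f n b)
    (hg : AffAtInfty g m c) : AffAtInfty (f * g) (n + m) (2 ^ n * c + b) := by
  constructor
  · filter_upwards [hf.1, hg.1] with t h1 h2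
    rw [RelIso.mul_apply, h2, h1]
  · filter_upwards [g.tendsto_atTop.eventually hf.2, hg.2] with t h1 h2
    rw [RelIso.mul_apply, h1, h2, zpow_add₀ (by norm_num)]
    ring

theorem AffAtInfty.inv {f : ℝ ≃o ℝ} {n : ℤ} {b : ℝ} (hf : AffAtInfty f n b) :
    AffAtInfty f⁻¹ (-n) (-(2 ^ (-n) * b)) := by
  constructor
  · filter_upwards [hf.1] with t h1
    exact f.symm_apply_eq.2 h1.symm
  · filter_upwards [f.symm.tendsto_atTop.eventually hf.2] with t h1
    rw [f.apply_symm_apply] at h1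
    change f.symm t = _
    generalize f.symm t = s at *
    rw [h1, zpow_neg]
    field_simp
    ring

theorem AffAtInfty.inv_mul_mem {f g : ℝ ≃o ℝ} {n : ℤ} {b : ℝ} (hf : AffAtInfty f n b)
    (hg : AffAtInfty g n b) : f⁻¹ * g ∈ Kc univ := by
  obtain ⟨p, hp⟩ := eventually_atBot.1 (hf.1.and hg.1)
  obtain ⟨q, hq⟩ := eventually_atTop.1 (hf.2.and hg.2)
  refine mem_Kc_of_Ioo (p := p) (q := q) (subset_univ _) fun t ht => f.symm_apply_eq.2 ?_
  change g t = f t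
  rcases le_or_gt t p with h | h
  · rw [(hp t h).1, (hp t h).2]
  · have : q ≤ t := by
      by_contra h'
      exact ht ⟨h, not_le.1 h'⟩
    rw [(hq t this).1, (hq t this).2]

theorem AffAtInfty.zpow {f : ℝ ≃o ℝ} {b : ℝ} (hf : AffAtInfty f 0 b) (m : ℤ) :
    AffAtInfty (f ^ m) 0 (m * b) := by
  induction m with
  | zero => simpa using AffAtInfty.one
  | succ m ih =>
    have := ih.mul hf
    rw [← zpow_add_one] at this
    convert this using 1
    push_cast; simp; ring
  | pred m ih =>
    have := ih.mul hf.inv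
    rw [← zpow_sub_one] at this
    convert this using 1
    push_cast; simp; ring

/-- The map with a single breakpoint `p`, equal to the identity on the left and of slope `2` on
the right. -/
noncomputable def kink (p : ℝ) : ℝ ≃o ℝ := glue 1 (aff 1 (-p)) p (by simp; ring)

theorem kink_of_le {p t : ℝ} (h : t ≤ p) : kink p t = t := glue_of_le _ h

theorem kink_of_ge {p t : ℝ} (h : p ≤ t) : kink p t = 2 * t - p := by
  rw [kink, glue_of_ge _ h]
  simp [sub_eq_add_neg]

theorem kink_mem_PL {p : ℝ} (hp : IsDyadic p) : kink p ∈ PL :=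
  glue_mem_PL _ hp (one_mem _) (aff_mem_PL _ hp.neg)

theorem kink_affAtInfty (p : ℝ) : AffAtInfty (kink p) 1 (-p) :=
  ⟨(eventually_le_atBot p).mono fun _ h => kink_of_le h,
    (eventually_ge_atTop p).mono fun _ h => by rw [kink_of_ge h]; simp [sub_eq_add_neg]⟩

/-! ### Conjugation of kinks. -/

theorem conj_kink {g : ℝ ≃o ℝ} {p : ℝ} {n : ℤ} {b : ℝ} (hg : ∀ t, p ≤ t → g t = 2 ^ n * t + b) :
    g * kink p * g⁻¹ = kink (g p) := by
  rw [mul_inv_eq_iff_eq_mul]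
  ext t
  rw [RelIso.mul_apply, RelIso.mul_apply]
  rcases le_total t p with h | h
  · rw [kink_of_le h, kink_of_le (g.monotone h)]
  · rw [kink_of_ge h, kink_of_ge (g.monotone h), hg _ (by linarith), hg _ h, hg _ le_rfl]
    ring

/-- This map has the germ of `kink q` at `+∞` but is already affine from `p` on, even when `p < q`.
It can therefore replace `kink q` as a conjugator of `kink p`. -/
theorem exists_affAtInfty {p q : ℝ} (hp : IsDyadic p) (hq : IsDyadic q) :
    ∃ g ∈ PL, AffAtInfty g 1 (-q) ∧ ∀ t, p ≤ t → g t = 2 ^ (1 : ℤ) * t + -q := by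
  obtain ⟨c, hc, -, hc'⟩ := exists_isDyadic_btwn (sub_one_lt (min p (aff 1 (-q) p)))
  obtain ⟨m, hm, hm1, hm2⟩ := exists_PL_interp hc hp hc (PL_le_DD (aff_mem_PL 1 hq.neg) |> (DD.dyadic · hp))
    (hc'.trans_le (min_le_left _ _)) (hc'.trans_le (min_le_right _ _))
  have hcp := hc'.trans_le (min_le_left _ _)
  have e1 : (1 : ℝ ≃o ℝ) c = m c := hm1.symm
  have e2 : glue 1 m c e1 p = aff 1 (-q) p := by rw [glue_of_ge e1 hcp.le, hm2]
  have h : ∀ t, p ≤ t → glue _ _ p e2 t = 2 ^ (1 : ℤ) * t + -q := fun t ht => by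
    rw [glue_of_ge e2 ht, aff_apply]
  refine ⟨_, glue_mem_PL e2 hp (glue_mem_PL e1 hc (one_mem _) hm) (aff_mem_PL 1 hq.neg),
    ⟨?_, (eventually_ge_atTop p).mono h⟩, h⟩
  filter_upwards [eventually_le_atBot c] with t ht
  rw [glue_of_le e2 (ht.trans hcp.le), glue_of_le e1 ht]
  rfl

/-- Up to the compactly supported correction `g⁻¹ * kink q`, conjugation by `kink q` sends `kink p`
to the kink at the image `2 * p - q` of `p` under the germ of `kink q` at infinity. -/
theorem kink_conj_kink {p q : ℝ} (hp : IsDyadic p) (hq : IsDyadic q) :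
    ∃ g ∈ PL, g⁻¹ * kink q ∈ PLc univ ∧ g * kink p * g⁻¹ = kink (2 * p - q) := by
  obtain ⟨g, hg, hg1, hg2⟩ := exists_affAtInfty hp hq
  refine ⟨g, hg, ⟨PL.mul_mem (inv_mem hg) (kink_mem_PL hq), hg1.inv_mul_mem (kink_affAtInfty q)⟩, ?_⟩
  rw [conj_kink hg2, hg2 p le_rfl]
  simp [sub_eq_add_neg]

/-! ### A group generated by a dyadic family -/

section Rack

variable {Q : Type*} [Group Q] {b : ℝ → Q}

theorem IsDyadic.half {x : ℝ} (hx : IsDyadic x) : IsDyadic (x / 2) := by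
  simpa using hx.mul_div_two_pow 1 1

theorem IsDyadic.two_mul {x : ℝ} (hx : IsDyadic x) : IsDyadic (2 * x) := by
  rw [_root_.two_mul]; exact hx.add hx

variable (hb : ∀ p q, IsDyadic p → IsDyadic q → b q * b p * (b q)⁻¹ = b (2 * p - q))
  (hcomm : ∀ p q, IsDyadic p → IsDyadic q → Commute (b p * (b 0)⁻¹) (b q * (b 0)⁻¹))
include hb

theorem rack_conj_zero {q : ℝ} (hq : IsDyadic q) : (b 0)⁻¹ * b q * b 0 = b (q / 2) := by
  have := hb (q / 2) 0 hq.half .zero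
  rw [show 2 * (q / 2) - 0 = q by ring] at this
  rw [← this]; group

theorem rack_zero_mul (k : ℤ) {q : ℝ} (hq : IsDyadic q) :
    b 0 ^ k * b q = b (2 ^ k * q) * b 0 ^ k := by
  induction k with
  | zero => simp
  | succ k ih =>
    have h := hb (2 ^ (k : ℤ) * q) 0 ((IsDyadic.two_zpow _).mul hq) .zero
    rw [mul_inv_eq_iff_eq_mul] at h
    rw [add_comm (k : ℤ), zpow_add, zpow_one, mul_assoc, ih, ← mul_assoc, h, mul_assoc]
    congr 2
    rw [zpow_add₀ (by norm_num)]
    ring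
  | pred k ih =>
    have h := rack_conj_zero hb ((IsDyadic.two_zpow (-k)).mul hq)
    rw [sub_eq_neg_add (-(k : ℤ)), zpow_add, zpow_neg_one, mul_assoc, ih]
    rw [mul_assoc, inv_mul_eq_iff_eq_mul] at h
    have h' : (b 0)⁻¹ * b (2 ^ (-(k : ℤ)) * q) = b (2 ^ (-(k : ℤ)) * q / 2) * (b 0)⁻¹ := by
      rw [eq_mul_inv_iff_mul_eq, mul_assoc, h]; group
    rw [← mul_assoc, h', mul_assoc]
    congr 2
    rw [zpow_add₀ (by norm_num)]
    ring_nf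

include hcomm

/-- Put `T r = b r * (b 0)⁻¹`. Conjugation by `T r` shifts `b s` to `b (s - r)`. As `T r` commutes
with `T (s + r)`, this conjugation leaves `T (s + r)` unchanged while turning it into `b s * (b
(-r))⁻¹`. The cases `s = q` and `s = 0` combine to additivity. -/
theorem rack_add {q r : ℝ} (hq : IsDyadic q) (hr : IsDyadic r) :
    (b q * (b 0)⁻¹) * (b r * (b 0)⁻¹) = b (q + r) * (b 0)⁻¹ := by
  have key : ∀ s, IsDyadic s → b r * (b 0)⁻¹ * b s * (b r * (b 0)⁻¹)⁻¹ = b (s - r) := by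
    intro s hs
    have h1 := rack_conj_zero hb hs
    have h2 := hb (s / 2) r hs.half hr
    rw [show 2 * (s / 2) - r = s - r by ring] at h2
    rw [← h2, ← h1]
    group
  have h0 := key 0 .zero
  have h6 : ∀ s, IsDyadic s → b (s + r) * (b 0)⁻¹ = b s * (b (0 - r))⁻¹ := by
    intro s hs
    have h1 := key (s + r) (hs.add hr)
    rw [add_sub_cancel_right] at h1
    have h3 : b (s + r) * (b 0)⁻¹ =
        b r * (b 0)⁻¹ * (b (s + r) * (b 0)⁻¹) * (b r * (b 0)⁻¹)⁻¹ := by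
      rw [(hcomm r (s + r) hr (hs.add hr)).eq]; group
    rw [h3, ← h1, ← h0]; group
  have h7 := h6 0 .zero
  rw [zero_add] at h7
  rw [h6 q hq, h7]; group

/-- The pair `(k, p)` in the normal form `b p * (b 0)⁻¹ * b 0 ^ k` stands for the affine map `t ↦ 2
^ k * t - p`. Right multiplication by a generator follows the composition law of these maps. -/
theorem rack_mul {p q : ℝ} (k : ℤ) (hp : IsDyadic p) (hq : IsDyadic q) :
    b p * (b 0)⁻¹ * b 0 ^ k * b q = b (p + 2 ^ k * q) * (b 0)⁻¹ * b 0 ^ (k + 1) := by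
  have hkq := (IsDyadic.two_zpow k).mul hq
  rw [mul_assoc, rack_zero_mul hb k hq, ← rack_add hb hcomm hp hkq, add_comm k 1, zpow_one_add]
  simp only [mul_assoc, inv_mul_cancel_left]

theorem rack_mul_inv {p q : ℝ} (k : ℤ) (hp : IsDyadic p) (hq : IsDyadic q) :
    b p * (b 0)⁻¹ * b 0 ^ k * (b q)⁻¹ =
      b (p - 2 ^ (k - 1) * q) * (b 0)⁻¹ * b 0 ^ (k - 1) := by
  have hkq := (IsDyadic.two_zpow (k - 1)).mul hq
  rw [mul_inv_eq_iff_eq_mul, rack_mul hb hcomm _ (hp.sub hkq) hq]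
  simp

end Rack

/-! ### The group of compactly supported PL homeomorphisms is perfect -/

theorem commutator_PLc_le : ⁅PLc univ, PLc univ⁆ ≤ PLc univ := Subgroup.commutator_le_self _

instance normal_commutator_PLc : (⁅PLc univ, PLc univ⁆.subgroupOf PL).Normal where
  conj_mem := by
    rintro ⟨n, hn⟩ hn' ⟨g, hg⟩
    rw [Subgroup.mem_subgroupOf] at hn' ⊢
    have := mul_mem (conj_mul_inv_mem_commutator (commutator_PLc_le hn') hg) hn'
    simpa using this

/-- `PL` modulo the commutator subgroup of its compactly supported part. -/
abbrev PLQuot : Type := PL ⧸ (⁅PLc univ, PLc univ⁆.subgroupOf PL)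

open Classical in
/-- The class of an element of `PL`. -/
noncomputable def plClass (g : ℝ ≃o ℝ) : PLQuot :=
  if h : g ∈ PL then QuotientGroup.mk ⟨g, h⟩ else 1

theorem plClass_mul {g h : ℝ ≃o ℝ} (hg : g ∈ PL) (hh : h ∈ PL) :
    plClass (g * h) = plClass g * plClass h := by
  rw [plClass, plClass, plClass, dif_pos hg, dif_pos hh, dif_pos (mul_mem hg hh)]
  rfl

theorem plClass_inv {g : ℝ ≃o ℝ} (hg : g ∈ PL) : plClass g⁻¹ = (plClass g)⁻¹ := by
  rw [plClass, plClass, dif_pos hg, dif_pos (inv_mem hg)]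
  rfl

theorem plClass_eq_one_iff {g : ℝ ≃o ℝ} (hg : g ∈ PL) :
    plClass g = 1 ↔ g ∈ ⁅PLc univ, PLc univ⁆ := by
  rw [plClass, dif_pos hg, QuotientGroup.eq_one_iff, Subgroup.mem_subgroupOf]

theorem plClass_central {f g : ℝ ≃o ℝ} (hf : f ∈ PLc univ) (hg : g ∈ PL) :
    Commute (plClass g) (plClass f) := by
  have h := conj_mul_inv_mem_commutator hf hg
  have hfP : f ∈ PL := hf.1
  rw [← plClass_eq_one_iff (mul_mem (mul_mem (mul_mem hg hfP) (inv_mem hg)) (inv_mem hfP)),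
    plClass_mul (mul_mem (mul_mem hg hfP) (inv_mem hg)) (inv_mem hfP),
    plClass_mul (mul_mem hg hfP) (inv_mem hg), plClass_mul hg hfP, plClass_inv hg,
    plClass_inv hfP] at h
  rw [Commute, SemiconjBy, ← mul_inv_eq_one, mul_inv_rev, ← mul_assoc]
  exact h

/-- `kink q` is `g` times a compactly supported map, whose class is central. So `kink q` and `g` act
by the same conjugation on classes. -/
theorem plClass_conj_kink {p q : ℝ} (hp : IsDyadic p) (hq : IsDyadic q) :
    plClass (kink q) * plClass (kink p) * (plClass (kink q))⁻¹ = plClass (kink (2 * p - q)) := by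
  obtain ⟨g, hg, hgq, hgp⟩ := kink_conj_kink hp hq
  have hkp := kink_mem_PL hp
  have e : kink q = g * (g⁻¹ * kink q) := by group
  have hc := plClass_central hgq hkp
  rw [← hgp, plClass_mul (mul_mem hg hkp) (inv_mem hg), plClass_mul hg hkp, plClass_inv hg, e,
    plClass_mul hg hgq.1, mul_assoc (plClass g), ← hc.eq]
  group

/-- `kink p * (kink 0)⁻¹` is the translation by `-p` near `+∞`. Over a common denominator, two of
them are powers of a single such map up to compactly supported factors, which are central modulo
commutators. -/
theorem plClass_shift_commute {p q : ℝ} (hp : IsDyadic p) (hq : IsDyadic q) :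
    Commute (plClass (kink p) * (plClass (kink 0))⁻¹) (plClass (kink q) * (plClass (kink 0))⁻¹) := by
  have hk0 := kink_mem_PL .zero
  have hsh : ∀ r, AffAtInfty (kink r * (kink 0)⁻¹) 0 (-r) := fun r => by
    have := (kink_affAtInfty r).mul (kink_affAtInfty 0).inv
    simpa using this
  have hshP : ∀ r, IsDyadic r → kink r * (kink 0)⁻¹ ∈ PL :=
    fun r hr => mul_mem (kink_mem_PL hr) (inv_mem hk0)
  have key : ∀ r (m : ℤ), IsDyadic r → ∃ z ∈ PLc univ,
      kink (m * r) * (kink 0)⁻¹ = (kink r * (kink 0)⁻¹) ^ m * z := by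
    intro r m hr
    refine ⟨((kink r * (kink 0)⁻¹) ^ m)⁻¹ * (kink (m * r) * (kink 0)⁻¹),
      ⟨PL.mul_mem (inv_mem (zpow_mem (hshP r hr) m)) (hshP _ ((IsDyadic.int m).mul hr)),
      ((hsh r).zpow m).inv_mul_mem ?_⟩, by group⟩
    have := hsh (m * r)
    rwa [← mul_neg] at this
  obtain ⟨m, k, rfl⟩ := hp
  obtain ⟨n, l, rfl⟩ := hq
  have hr : IsDyadic (1 / 2 ^ (k + l)) := ⟨1, k + l, by simp⟩
  have e1 : (m : ℝ) / 2 ^ k = ((m * 2 ^ l : ℤ) : ℝ) * (1 / 2 ^ (k + l)) := by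
    push_cast; rw [pow_add]; field_simp
  have e2 : (n : ℝ) / 2 ^ l = ((n * 2 ^ k : ℤ) : ℝ) * (1 / 2 ^ (k + l)) := by
    push_cast; rw [pow_add]; field_simp
  rw [e1, e2]
  have hP : ∀ (m : ℤ), plClass (kink (m * (1 / 2 ^ (k + l)))) * (plClass (kink 0))⁻¹ =
      plClass (kink (m * (1 / 2 ^ (k + l))) * (kink 0)⁻¹) := fun m => by
    rw [plClass_mul (kink_mem_PL ((IsDyadic.int m).mul hr)) (inv_mem hk0), plClass_inv hk0]
  rw [hP, hP]
  obtain ⟨z, hz, hze⟩ := key _ (m * 2 ^ l) hr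
  obtain ⟨w, hw, hwe⟩ := key _ (n * 2 ^ k) hr
  have h1 := zpow_mem (hshP _ hr) (m * 2 ^ l)
  have h2 := zpow_mem (hshP _ hr) (n * 2 ^ k)
  rw [hze, hwe, plClass_mul h1 hz.1, plClass_mul h2 hw.1]
  refine Commute.mul_left (Commute.mul_right ?_ (plClass_central hw h1))
    (Commute.mul_right (plClass_central hz h2).symm (plClass_central hw hz.1))
  rw [Commute, SemiconjBy, ← plClass_mul h1 h2, ← plClass_mul h2 h1, ← zpow_add, ← zpow_add,
    add_comm (m * 2 ^ l)]

/-- The class of a product of kinks and the germ of the product at `+∞` are expressed by the same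
pair `(k, p)`, so the germ determines the class. -/
theorem plClass_of_mem_closure {g : ℝ ≃o ℝ} (hg : g ∈ Subgroup.closure (kink '' {p | IsDyadic p})) :
    g ∈ PL ∧ ∃ (k : ℤ) (p : ℝ), IsDyadic p ∧ AffAtInfty g k (-p) ∧
      plClass g = plClass (kink p) * (plClass (kink 0))⁻¹ * plClass (kink 0) ^ k := by
  induction hg using Subgroup.closure_induction_right with
  | one =>
    refine ⟨one_mem _, 0, 0, .zero, by simpa using AffAtInfty.one, ?_⟩
    simp [(plClass_eq_one_iff (one_mem PL)).2 (one_mem _)]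
  | mul_right x hx y hy ih =>
    obtain ⟨q, hq, rfl⟩ := hy
    obtain ⟨hxP, k, p, hp, hxa, hxe⟩ := ih
    refine ⟨mul_mem hxP (kink_mem_PL hq), k + 1, p + 2 ^ k * q,
      hp.add ((IsDyadic.two_zpow k).mul hq), ?_, ?_⟩
    · convert hxa.mul (kink_affAtInfty q) using 1
      ring
    · rw [plClass_mul hxP (kink_mem_PL hq), hxe,
        rack_mul (b := fun p => plClass (kink p)) (fun _ _ => plClass_conj_kink)
        (fun _ _ => plClass_shift_commute) k hp hq]
  | mul_inv_cancel x hx y hy ih =>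
    obtain ⟨q, hq, rfl⟩ := hy
    obtain ⟨hxP, k, p, hp, hxa, hxe⟩ := ih
    refine ⟨mul_mem hxP (inv_mem (kink_mem_PL hq)), k - 1, p - 2 ^ (k - 1) * q,
      hp.sub ((IsDyadic.two_zpow (k - 1)).mul hq), ?_, ?_⟩
    · have := hxa.mul (kink_affAtInfty q).inv
      rwa [← sub_eq_add_neg, show (2 : ℝ) ^ k * -(2 ^ (-1 : ℤ) * -q) + -p =
        -(p - 2 ^ (k - 1) * q) by rw [zpow_sub₀ (by norm_num), zpow_neg]; ring] at this
    · rw [plClass_mul hxP (inv_mem (kink_mem_PL hq)), hxe, plClass_inv (kink_mem_PL hq),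
        rack_mul_inv (b := fun p => plClass (kink p)) (fun _ _ => plClass_conj_kink)
        (fun _ _ => plClass_shift_commute) k hp hq]

/-! ### Products of kinks and perfection of the PL group. -/

theorem kink_zpow_of_le {p t : ℝ} (k : ℤ) (h : t ≤ p) : (kink p ^ k) t = t := by
  have h1 : kink p t = t := kink_of_le h
  have h2 : (kink p)⁻¹ t = t := (kink p).symm_apply_eq.2 h1.symm
  induction k with
  | zero => rfl
  | succ k ih => rw [zpow_add_one, RelIso.mul_apply, h1, ih]
  | pred k ih => rw [zpow_sub_one, RelIso.mul_apply, h2, ih]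

theorem kink_inv_of_ge {p t : ℝ} (h : p ≤ t) : (kink p)⁻¹ t = (t + p) / 2 := by
  refine (kink p).symm_apply_eq.2 ?_
  rw [kink_of_ge (by linarith)]
  ring

theorem kink_zpow_of_ge {p t : ℝ} (k : ℤ) (h : p ≤ t) :
    (kink p ^ k) t = 2 ^ k * (t - p) + p := by
  induction k generalizing t with
  | zero => simp
  | succ k ih =>
    rw [zpow_add_one, RelIso.mul_apply, kink_of_ge h, ih (by linarith), zpow_add_one₀ (by norm_num)]
    ring
  | pred k ih =>
    rw [zpow_sub_one, RelIso.mul_apply, kink_inv_of_ge h, ih (by linarith),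
      zpow_sub_one₀ (by norm_num)]
    ring

/-- Build `f` from left to right. If a product of kinks agrees with `f` up to `x` and is affine
afterwards, composing on the right with a power of `kink x` changes the slope beyond `x` to the one
`f` has there. -/
theorem PLc_le_closure_kink : PLc univ ≤ Subgroup.closure (kink '' {p | IsDyadic p}) := by
  intro f hf
  obtain ⟨N, hN, hfN⟩ := exists_int_Ioo_of_mem_Kc hf.2
  have hdN : IsDyadic (N : ℝ) := by exact_mod_cast IsDyadic.int N
  have hN' : (0 : ℝ) < N := by exact_mod_cast hN
  let Q : ℝ → Prop := fun t => ∃ g ∈ Subgroup.closure (kink '' {p | IsDyadic p}),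
    (∀ s ≤ t, g s = f s) ∧ ∃ (n : ℤ) (c : ℝ), ∀ s, t ≤ s → g s = 2 ^ n * s + c
  have step : ∀ x y, IsDyadic x → x < y → (∃ (n : ℤ) (c : ℝ), ∀ s ∈ Icc x y, f s = 2 ^ n * s + c) →
      Q x → Q y := by
    rintro x y hx hxy ⟨m, d, hfm⟩ ⟨g, hg, hgf, n, c, hgn⟩
    have hform : ∀ s, x ≤ s → (g * kink x ^ (m - n)) s = 2 ^ m * s + d := by
      intro s hs
      have h0 : 2 ^ n * x + c = 2 ^ m * x + d := by
        rw [← hgn x le_rfl, hgf x le_rfl, hfm x ⟨le_rfl, hxy.le⟩]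
      have hge : x ≤ 2 ^ (m - n) * (s - x) + x := by
        have : 0 ≤ (2 : ℝ) ^ (m - n) * (s - x) := mul_nonneg (by positivity) (by linarith)
        linarith
      rw [RelIso.mul_apply, kink_zpow_of_ge _ hs, hgn _ hge]
      have h1 : (2 : ℝ) ^ n * 2 ^ (m - n) = 2 ^ m := by
        rw [← zpow_add₀ (by norm_num)]; congr 1; ring
      linear_combination (s - x) * h1 + h0
    refine ⟨g * kink x ^ (m - n), mul_mem hg (zpow_mem (Subgroup.subset_closure (mem_image_of_mem kink hx)) _),
      fun s hs => ?_, m, d, fun s hs => hform s (hxy.le.trans hs)⟩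
    rcases le_total s x with h | h
    · rw [RelIso.mul_apply, kink_zpow_of_le _ h, hgf s h]
    · rw [hform s h, hfm s ⟨h, hs⟩]
  have hQ : Q (-N) → Q N := by
    refine dyadic_chain (P := fun x y => Q x → Q y) hdN.neg hdN (by linarith)
      (fun _ _ _ _ _ _ _ _ h1 h2 h => h2 (h1 h)) fun t _ => ?_
    obtain ⟨⟨n, b, hb, hl⟩, ⟨n', b', hb', hr⟩, hmid⟩ := hf.1 t
    have hc := f.continuous.continuousAt (x := t)
    have hlt := side_data hc inferInstance hl
    have hrt := side_data hc inferInstance hr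
    by_cases htd : IsDyadic t
    · obtain ⟨l, hl', hl⟩ := (mem_nhdsLT_iff_exists_Ioo_subset (a := t)).1 hl
      obtain ⟨r, hr', hr⟩ := (mem_nhdsGT_iff_exists_Ioo_subset (a := t)).1 hr
      rw [mem_Iio] at hl'
      rw [mem_Ioi] at hr'
      have hl2 : ∀ s ∈ Ioc l t, f s = 2 ^ n * s + b := fun s hs => by
        rcases hs.2.eq_or_lt with rfl | h
        · exact hlt
        · exact hl ⟨hs.1, h⟩
      have hr2 : ∀ s ∈ Ico t r, f s = 2 ^ n' * s + b' := fun s hs => by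
        rcases hs.1.eq_or_lt with rfl | h
        · exact hrt
        · exact hr ⟨h, hs.2⟩
      refine ⟨Ioo l r, Ioo_mem_nhds hl' hr', fun x y hx hy hxy hsub => ?_⟩
      have hx' := hsub ⟨le_rfl, hxy.le⟩
      have hy' := hsub ⟨hxy.le, le_rfl⟩
      rcases le_or_gt y t with h | h
      · exact step x y hx hxy ⟨n, b, fun s hs => hl2 s ⟨hx'.1.trans_le hs.1, hs.2.trans h⟩⟩
      rcases le_or_gt t x with h' | h'
      · exact step x y hx hxy ⟨n', b', fun s hs => hr2 s ⟨h'.trans hs.1, hs.2.trans_lt hy'.2⟩⟩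
      · exact step t y htd h ⟨n', b', fun s hs => hr2 s ⟨hs.1, hs.2.trans_lt hy'.2⟩⟩ ∘
          step x t hx h' ⟨n, b, fun s hs => hl2 s ⟨hx'.1.trans_le hs.1, hs.2⟩⟩
    · obtain ⟨m, d, -, hm⟩ := hmid.resolve_left htd
      exact ⟨_, hm, fun x y hx hy hxy hsub => step x y hx hxy ⟨m, d, hsub⟩⟩
  obtain ⟨g, hg, hgf, n, c, hgn⟩ := hQ ⟨1, one_mem _, fun s hs => (hfN s fun h => not_lt.2 hs h.1).symm, 0, 0, fun s _ => by simp⟩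
  -- Beyond `N` the product still has slope `2 ^ n`, while `f` is the identity; one last power of
  -- `kink N` corrects this.
  have : g * kink N ^ (-n) = f := by
    ext s
    rcases le_total s N with h | h
    · rw [RelIso.mul_apply, kink_zpow_of_le _ h, hgf s h]
    · have h0 : 2 ^ n * (N : ℝ) + c = N := by
        rw [← hgn N le_rfl, hgf N le_rfl, hfN _ fun h => lt_irrefl _ h.2]
      have hge : (N : ℝ) ≤ 2 ^ (-n) * (s - N) + N := by
        have : 0 ≤ (2 : ℝ) ^ (-n) * (s - N) := mul_nonneg (by positivity) (by linarith)
        linarith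
      rw [RelIso.mul_apply, kink_zpow_of_ge _ h, hgn _ hge, hfN s fun h' => by linarith [h'.2]]
      have h1 : (2 : ℝ) ^ n * 2 ^ (-n) = 1 := by
        rw [← zpow_add₀ (by norm_num)]; simp
      linear_combination (s - N) * h1 + h0
  rw [← this]
  exact mul_mem hg (zpow_mem (Subgroup.subset_closure (mem_image_of_mem kink hdN)) _)

theorem PLc_univ_le_commutator : PLc univ ≤ ⁅PLc univ, PLc univ⁆ := by
  intro f hf
  obtain ⟨hfP, k, p, hp, hfa, hfe⟩ := plClass_of_mem_closure (PLc_le_closure_kink hf)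
  obtain ⟨n, hn, hfn⟩ := exists_int_Ioo_of_mem_Kc hf.2
  obtain ⟨q, hq⟩ := eventually_atTop.1 hfa.2
  have hid : ∀ t, max q n ≤ t → t = 2 ^ k * t - p := fun t ht => by
    rw [sub_eq_add_neg, ← hq t ((le_max_left _ _).trans ht), hfn]
    exact fun h => absurd h.2 (not_lt.2 ((le_max_right _ _).trans ht))
  -- The identity and the affine germ agree at two points at distance `1`, which forces slope `1`
  -- and then `p = 0`.
  have e1 := hid (max q n) le_rfl
  have e2 := hid (max q n + 1) (by linarith)
  have hk : (2 : ℝ) ^ k = 1 := by linarith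
  have hk0 : k = 0 := by
    rwa [zpow_eq_one_iff_right₀ (by norm_num) (by norm_num)] at hk
  have hp0 : p = 0 := by rw [hk] at e1; linarith
  rw [← plClass_eq_one_iff hfP, hfe, hk0, hp0]
  simp

/-- Write `f` as a product of commutators on the whole line. They live in some `(-n, n)`; conjugate
by a PL map that is the identity on the support of `f` and squeezes `(-n, n)` into `(a, b)`. This
leaves `f` unchanged and moves the commutators into `(a, b)`. -/
theorem PLc_Ioo_le_commutator {a b : ℝ} (hab : a < b) :
    PLc (Ioo a b) ≤ ⁅PLc (Ioo a b), PLc (Ioo a b)⁆ := by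
  intro f hf
  obtain ⟨p, q, hp, hq, hap, hpq, hqb, hfpq⟩ := exists_dyadic_Ioo_of_mem_Kc hab hf.2
  -- Only finitely many commutators enter a given element, so one bounded interval contains all
  -- supports.
  have key : ∀ g ∈ ⁅PLc univ, PLc univ⁆, ∃ n : ℕ, 0 < n ∧
      g ∈ ⁅PLc (Ioo (-n : ℝ) n), PLc (Ioo (-n : ℝ) n)⁆ := by
    have mono : ∀ {n m : ℕ}, n ≤ m → ⁅PLc (Ioo (-n : ℝ) n), PLc (Ioo (-n : ℝ) n)⁆ ≤
        ⁅PLc (Ioo (-m : ℝ) m), PLc (Ioo (-m : ℝ) m)⁆ := fun {n m} h => by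
      have h' : (n : ℝ) ≤ m := by exact_mod_cast h
      have := PLc_mono (Ioo_subset_Ioo (neg_le_neg h') h')
      exact Subgroup.commutator_mono this this
    have hloc : ∀ g ∈ PLc univ, ∃ n : ℕ, ∀ m, n ≤ m → g ∈ PLc (Ioo (-m : ℝ) m) := by
      intro g hg
      obtain ⟨n, hn, h⟩ := exists_int_Ioo_of_mem_Kc hg.2
      refine ⟨n + 1, fun m hm => ⟨hg.1, mem_Kc_of_Ioo (fun t ht => ?_) h⟩⟩
      have : (n : ℝ) + 1 ≤ m := by exact_mod_cast hm
      exact ⟨by linarith [ht.1], by linarith [ht.2]⟩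
    intro g hg
    rw [Subgroup.commutator_def] at hg
    induction hg using Subgroup.closure_induction with
    | mem x hx =>
      obtain ⟨g, hg, h, hh, rfl⟩ := hx
      obtain ⟨n, hn⟩ := hloc g hg
      obtain ⟨m, hm⟩ := hloc h hh
      exact ⟨max n m + 1, by omega, Subgroup.commutator_mem_commutator (hn _ (by omega))
        (hm _ (by omega))⟩
    | one => exact ⟨1, one_pos, one_mem _⟩
    | mul x y hx hy ihx ihy =>
      obtain ⟨n, hn, hnx⟩ := ihx
      obtain ⟨m, hm, hmy⟩ := ihy
      exact ⟨max n m, by omega, mul_mem (mono (le_max_left _ _) hnx)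
        (mono (le_max_right _ _) hmy)⟩
    | inv x hx ih =>
      obtain ⟨n, hn, hnx⟩ := ih
      exact ⟨n, hn, inv_mem hnx⟩
  obtain ⟨n, hn, hfn⟩ := key f (PLc_univ_le_commutator (PLc_mono (subset_univ _) hf))
  -- squeeze `(-n, n)` into `(a, b)`
  obtain ⟨p', hp', hap', hpp'⟩ := exists_isDyadic_btwn hap
  obtain ⟨q', hq', hqq', hqb'⟩ := exists_isDyadic_btwn hqb
  obtain ⟨l, hl, -, hl'⟩ := exists_isDyadic_btwn (sub_one_lt (min p (-n)))
  obtain ⟨r, hr, hr', -⟩ := exists_isDyadic_btwn (lt_add_one (max q n))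
  have hlp := hl'.trans_le (min_le_left _ _)
  have hln := hl'.trans_le (min_le_right _ _)
  have hqr := (le_max_left _ _).trans_lt hr'
  have hnr := (le_max_right _ _).trans_lt hr'
  obtain ⟨g1, hg1, hg1l, hg1p⟩ := exists_PL_interp hl hp hp' hp hlp hpp'
  obtain ⟨g2, hg2, hg2q, hg2r⟩ := exists_PL_interp hq hr hq hq' hqr hqq'
  have e1 : g1 p = (1 : ℝ ≃o ℝ) p := hg1p
  have e2 : glue g1 1 p e1 q = g2 q := by rw [glue_of_ge e1 hpq.le, hg2q]; rfl
  set g := glue _ g2 q e2 with hgdef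
  have hg : g ∈ PL := glue_mem_PL e2 hq (glue_mem_PL e1 hp hg1 (one_mem _)) hg2
  have hgid : ∀ t ∈ Ioo p q, g t = t := fun t ht => by
    rw [hgdef, glue_of_le e2 ht.2.le, glue_of_ge e1 ht.1.le]; rfl
  have hgl : g l = p' := by
    rw [hgdef, glue_of_le e2 (by linarith), glue_of_le e1 hlp.le, hg1l]
  have hgr : g r = q' := by rw [hgdef, glue_of_ge e2 hqr.le, hg2r]
  have hconj : MulAut.conj g f = f := by
    rw [MulAut.conj_apply, conj_eq_of_eqOn (k := 1) hfpq fun t ht => (hgid t ht).symm]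
    simp
  have hmap : (PLc (Ioo (-n : ℝ) n)).map (MulAut.conj g).toMonoidHom ≤ PLc (Ioo a b) := by
    rintro _ ⟨h, ⟨hh, K, hK, hKU, hhK⟩, rfl⟩
    refine ⟨PL.mul_mem (mul_mem hg hh) (inv_mem hg), g '' K, hK.image g.continuous, ?_, fun t ht => ?_⟩
    · rintro _ ⟨s, hs, rfl⟩
      have h1 := g.strictMono (hln.trans (hKU hs).1)
      have h2 := g.strictMono ((hKU hs).2.trans hnr)
      exact ⟨by linarith, by linarith⟩
    · change g (h (g⁻¹ t)) = t
      rw [hhK (g⁻¹ t) fun hk => ht ⟨_, hk, g.apply_symm_apply t⟩]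
      exact g.apply_symm_apply t
  have := Subgroup.mem_map_of_mem (MulAut.conj g).toMonoidHom hfn
  rw [Subgroup.map_commutator] at this
  have h2 := Subgroup.commutator_mono hmap hmap this
  change MulAut.conj g f ∈ _ at h2
  rwa [hconj] at h2

/-! ### Disjoint unions of order isomorphisms -/

theorem lt_of_mem_ordConnected_disjoint {I J : Set ℝ} (hI : I.OrdConnected) (hJ : J.OrdConnected)
    (h : ∀ t, t ∈ I → t ∉ J) {s t s' t' : ℝ} (hs : s ∈ I) (ht : t ∈ J) (hst : s < t) (hs' : s' ∈ I)
    (ht' : t' ∈ J) : s' < t' := by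
  have h1 : s < t' := by
    by_contra h1
    exact h s hs (hJ.out ht' ht ⟨not_lt.1 h1, hst.le⟩)
  by_contra h2
  exact h t' (hI.out hs hs' ⟨h1.le, not_lt.1 h2⟩) ht'

/-- Each `f i` preserves `I i`, so the order between points of different intervals, or between an
interval and an outside point, is untouched. -/
theorem exists_union_strictMono {ι : Type*} {I : ι → Set ℝ} {f : ι → ℝ ≃o ℝ}
    (hI : ∀ i, (I i).OrdConnected) (hd : ∀ i j t, t ∈ I i → t ∈ I j → i = j)
    (hf : ∀ i t, f i t ∈ I i ↔ t ∈ I i) :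
    ∃ F : ℝ → ℝ, StrictMono F ∧ (∀ i, ∀ t ∈ I i, F t = f i t) ∧
      ∀ t, (∀ i, t ∉ I i) → F t = t := by
  classical
  let F : ℝ → ℝ := fun t => if h : ∃ i, t ∈ I i then f h.choose t else t
  have h1 : ∀ i, ∀ t ∈ I i, F t = f i t := fun i t ht => by
    have h : ∃ i, t ∈ I i := ⟨i, ht⟩
    have : F t = f h.choose t := dif_pos h
    rw [this, hd _ _ t h.choose_spec ht]
  have h2 : ∀ t, (∀ i, t ∉ I i) → F t = t := fun t ht => dif_neg fun ⟨i, hi⟩ => ht i hi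
  refine ⟨F, fun s t hst => ?_, h1, h2⟩
  by_cases hs : ∃ i, s ∈ I i <;> by_cases ht : ∃ i, t ∈ I i
  · obtain ⟨i, hi⟩ := hs
    obtain ⟨j, hj⟩ := ht
    rw [h1 i s hi, h1 j t hj]
    by_cases hij : i = j
    · rw [hij]; exact (f j).strictMono hst
    · exact lt_of_mem_ordConnected_disjoint (hI i) (hI j) (fun u hu hu' => hij (hd _ _ u hu hu'))
        hi hj hst ((hf i s).2 hi) ((hf j t).2 hj)
  · obtain ⟨i, hi⟩ := hs
    push Not at ht
    rw [h1 i s hi, h2 t ht]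
    exact lt_of_mem_ordConnected_disjoint (hI i) ordConnected_singleton
      (fun u hu hu' => by rw [mem_singleton_iff.1 hu'] at hu; exact ht i hu) hi (mem_singleton t) hst ((hf i s).2 hi) (mem_singleton t)
  · obtain ⟨j, hj⟩ := ht
    push Not at hs
    rw [h1 j t hj, h2 s hs]
    exact lt_of_mem_ordConnected_disjoint ordConnected_singleton (hI j)
      (fun u hu hu' => by rw [mem_singleton_iff.1 hu] at hu'; exact hs j hu') (mem_singleton s) hj hst
      (mem_singleton s) ((hf j t).2 hj)
  · push Not at hs ht
    rwa [h2 s hs, h2 t ht]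

theorem exists_union {ι : Type*} {I : ι → Set ℝ} {f : ι → ℝ ≃o ℝ}
    (hI : ∀ i, (I i).OrdConnected) (hd : ∀ i j t, t ∈ I i → t ∈ I j → i = j)
    (hf : ∀ i t, f i t ∈ I i ↔ t ∈ I i) :
    ∃ F : ℝ ≃o ℝ, (∀ i, ∀ t ∈ I i, F t = f i t) ∧ ∀ t, (∀ i, t ∉ I i) → F t = t := by
  obtain ⟨F, hF, h1, h2⟩ := exists_union_strictMono hI hd hf
  have hf' : ∀ i t, (f i)⁻¹ t ∈ I i ↔ t ∈ I i := fun i t => by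
    rw [← hf i]
    exact iff_of_eq (congrArg (· ∈ I i) ((f i).apply_symm_apply t))
  -- The inverse is assembled from the inverses of the pieces.
  obtain ⟨G, -, h3, h4⟩ := exists_union_strictMono (f := fun i => (f i)⁻¹) hI hd hf'
  refine ⟨StrictMono.orderIsoOfRightInverse F hF G fun t => ?_, h1, h2⟩
  by_cases ht : ∃ i, t ∈ I i
  · obtain ⟨i, hi⟩ := ht
    rw [h3 i t hi, h1 i _ ((hf' i t).2 hi)]
    exact (f i).apply_symm_apply t
  · push Not at ht
    rw [h4 t ht, h2 t ht]

/-! ### Conjugation by isometries -/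

/-- Conjugation by a homeomorphism of the line, possibly reversing the orientation. -/
noncomputable def conjHom (γ : ℝ ≃ₜ ℝ) : (ℝ ≃o ℝ) →* (ℝ ≃o ℝ) where
  toFun f := by
    refine StrictMono.orderIsoOfRightInverse (fun t => γ.symm (f (γ t))) ?_
      (fun t => γ.symm (f.symm (γ t))) fun t => by simp
    rcases γ.continuous.strictMono_of_inj γ.injective with h | h
    · have h' : StrictMono γ.symm := fun s t hst => by
        rwa [← h.lt_iff_lt, γ.apply_symm_apply, γ.apply_symm_apply]
      exact h'.comp (f.strictMono.comp h)
    · have h' : StrictAnti γ.symm := fun s t hst => by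
        rwa [← h.lt_iff_gt, γ.apply_symm_apply, γ.apply_symm_apply]
      exact h'.comp (f.strictMono.comp_strictAnti h)
  map_one' := by ext t; exact γ.symm_apply_apply t
  map_mul' f g := by
    ext t
    change γ.symm (f (g (γ t))) = γ.symm (f (γ (γ.symm (g (γ t)))))
    rw [γ.apply_symm_apply]

theorem conjHom_apply (γ : ℝ ≃ₜ ℝ) (f : ℝ ≃o ℝ) (t : ℝ) : conjHom γ f t = γ.symm (f (γ t)) := rfl

section Isometry

variable {γ : ℝ ≃ₜ ℝ} {ε m : ℤ}

theorem isometry_symm_apply (hε : ε = 1 ∨ ε = -1) (hγ : ∀ t, γ t = ε * t + m) (t : ℝ) :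
    γ.symm t = ε * t + (-(ε * m) : ℤ) := by
  rw [γ.symm_apply_eq, hγ]
  have : (ε : ℝ) * ε = 1 := by rcases hε with rfl | rfl <;> norm_num
  push_cast
  linear_combination (t - m) * (-this)

theorem PLGerm.conjHom (hε : ε = 1 ∨ ε = -1) (hγ : ∀ t, γ t = ε * t + m) {f : ℝ ≃o ℝ} {x : ℝ}
    (h : PLGerm f (γ x)) : PLGerm (conjHom γ f) x := by
  have hε2 : ε * ε = 1 := by rcases hε with rfl | rfl <;> norm_num
  have hγ' := isometry_symm_apply hε hγ
  have hct : Tendsto γ (𝓝 x) (𝓝 (γ x)) := γ.continuous.tendsto x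
  have side : ∀ s t : Set ℝ, (∀ y, y ∈ s → γ y ∈ t) → Tendsto γ (𝓝[s] x) (𝓝[t] (γ x)) :=
    fun s t hst => tendsto_nhdsWithin_of_tendsto_nhds_of_eventually_within _
      (hct.mono_left nhdsWithin_le_nhds) (eventually_nhdsWithin_of_forall hst)
  have conj : ∀ l l' : Filter ℝ, Tendsto γ l l' → AffAlong f l' →
      AffAlong (SolenoidalThompson.conjHom γ f) l :=
    fun l l' hl h => AffAlong.conj (γ := γ.symm) hε2 hγ' h hl
  have h3 : IsDyadic x ∨ AffAlong (SolenoidalThompson.conjHom γ f) (𝓝 x) := by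
    rcases h.2.2 with h | h
    · left
      rw [← γ.symm_apply_apply x, hγ']
      exact ((IsDyadic.int ε).mul h).add (.int _)
    · exact Or.inr (conj _ _ hct h)
  rcases hε with rfl | rfl
  · refine ⟨conj _ _ (side (Iio x) (Iio (γ x)) fun y hy => ?_) h.1,
      conj _ _ (side (Ioi x) (Ioi (γ x)) fun y hy => ?_) h.2.1, h3⟩ <;> simp_all
  · refine ⟨conj _ _ (side (Iio x) (Ioi (γ x)) fun y hy => ?_) h.2.1,
      conj _ _ (side (Ioi x) (Iio (γ x)) fun y hy => ?_) h.1, h3⟩ <;> simp_all <;> linarith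

theorem DGerm.conjHom (hε : ε = 1 ∨ ε = -1) (hγ : ∀ t, γ t = ε * t + m) {f : ℝ ≃o ℝ} {x : ℝ}
    (h : DGerm f (γ x)) : DGerm (conjHom γ f) x := by
  have hγ' := isometry_symm_apply hε hγ
  have hdy : ∀ t, IsDyadic t → IsDyadic (γ t) := fun t ht => by
    rw [hγ]; exact ((IsDyadic.int ε).mul ht).add (.int m)
  have hdy' : ∀ t, IsDyadic t → IsDyadic (γ.symm t) := fun t ht => by
    rw [hγ']; exact ((IsDyadic.int ε).mul ht).add (.int _)
  refine ⟨?_, fun hx => ⟨hx, hdy' _ (h.2.1 (hdy x hx)).2.1, ?_⟩, fun hx => ?_⟩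
  · filter_upwards [(tendsto_nhdsNE_of_injective γ.continuous γ.injective x).eventually h.1]
      with y hy
    exact hy.conjHom hε hγ
  · have hds : ∀ a b, doubling (γ a) (γ b) = γ (doubling a b) := fun a b => by
      simp only [doubling, hγ]; ring
    have hds' : ∀ a b, doubling (γ.symm a) (γ.symm b) = γ.symm (doubling a b) := fun a b => by
      simp only [doubling, hγ']; ring
    filter_upwards [(γ.continuous.tendsto x).eventually (h.2.1 (hdy x hx)).2.2] with y hy
    rw [conjHom_apply, conjHom_apply, conjHom_apply, hds', ← hy, hds]
  · have hx' : ¬ IsDyadic (γ x) := fun h' => hx (by simpa using hdy' _ h')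
    exact (PLGerm.conjHom hε hγ (AffAlong.plGerm (h.2.2 hx'))).2.2.resolve_left hx

end Isometry

/-! ### Maps commuting with the doubling map -/

/-- The group of homeomorphisms that are the identity on `(-∞, 0]`, commute with `t ↦ 2 t` and are
dyadic PL away from `0`. -/
def Tt : Subgroup (ℝ ≃o ℝ) where
  carrier := {f | (∀ t, f (2 * t) = 2 * f t) ∧ (∀ t ≤ 0, f t = t) ∧ ∀ t, t ≠ 0 → PLGerm f t}
  one_mem' := ⟨fun _ => rfl, fun _ _ => rfl, fun t _ => PL.one_mem t⟩
  mul_mem' := by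
    rintro f g ⟨h1, h2, h3⟩ ⟨k1, k2, k3⟩
    refine ⟨fun t => ?_, fun t ht => ?_, fun t ht => (k3 t ht).comp (h3 _ fun h => ht ?_)
      g.continuous.continuousAt⟩
    · simp only [RelIso.mul_apply, k1, h1]
    · simp only [RelIso.mul_apply, k2 t ht, h2 t ht]
    · exact g.injective (h.trans (k2 0 le_rfl).symm)
  inv_mem' := by
    rintro f ⟨h1, h2, h3⟩
    refine ⟨fun t => f.symm_apply_eq.2 ?_, fun t ht => f.symm_apply_eq.2 (h2 t ht).symm,
      fun t ht => ?_⟩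
    · exact ((h1 _).trans (congrArg (2 * ·) (f.apply_symm_apply t))).symm
    · have := (h3 (f.symm t) fun h => ht ?_).inv
      · rwa [f.apply_symm_apply] at this
      · rw [← f.apply_symm_apply t, h, h2 0 le_rfl]

theorem doubling_zpow {f : ℝ ≃o ℝ} (hf : ∀ t, f (2 * t) = 2 * f t) (n : ℤ) (t : ℝ) :
    f (2 ^ n * t) = 2 ^ n * f t := by
  induction n with
  | zero => simp
  | succ n ih => rw [zpow_add_one₀ two_ne_zero, mul_right_comm, mul_comm _ (2 : ℝ), hf, ih]; ring
  | pred n ih =>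
    have h1 : f (2 * (2 ^ (-(n : ℤ) - 1) * t)) = 2 * f (2 ^ (-(n : ℤ) - 1) * t) := hf _
    have h2 : 2 * ((2 : ℝ) ^ (-(n : ℤ) - 1) * t) = 2 ^ (-(n : ℤ)) * t := by
      rw [zpow_sub_one₀ two_ne_zero]; ring
    rw [h2, ih] at h1
    have h3 : (2 : ℝ) ^ (-(n : ℤ)) = 2 * 2 ^ (-(n : ℤ) - 1) := by
      rw [zpow_sub_one₀ two_ne_zero]; ring
    rw [h3] at h1
    linarith

theorem mem_DD_of_doubling {f : ℝ ≃o ℝ} (h1 : ∀ t, f (2 * t) = 2 * f t)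
    (h3 : ∀ t, t ≠ 0 → PLGerm f t) : f ∈ DD := by
  have h0 : f 0 = 0 := by have := h1 0; rw [mul_zero] at this; linarith
  intro t
  by_cases ht : t = 0
  · subst ht
    refine ⟨eventually_nhdsWithin_of_forall fun y hy => h3 y hy, fun _ => ⟨.zero, ?_, ?_⟩,
      fun h => absurd .zero h⟩
    · rw [h0]; exact .zero
    · refine Eventually.of_forall fun y => ?_
      rw [h0]
      simp only [doubling, sub_zero, add_zero, h1]
  · exact (h3 t ht).dGerm f.continuous.continuousAt

theorem Tt_le_DD : Tt ≤ DD := fun _ hf => mem_DD_of_doubling hf.1 hf.2.2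

theorem exists_zpow_mul_mem_Ico {u t : ℝ} (hu : 0 < u) (ht : 0 < t) :
    ∃ (n : ℤ) (s : ℝ), s ∈ Ico u (2 * u) ∧ t = 2 ^ n * s := by
  obtain ⟨n, h1, h2⟩ := exists_mem_Ico_zpow (div_pos ht hu) (one_lt_two (α := ℝ))
  have hp : (0 : ℝ) < 2 ^ n := by positivity
  rw [le_div_iff₀ hu] at h1
  rw [div_lt_iff₀ hu, zpow_add_one₀ two_ne_zero] at h2
  refine ⟨n, t / 2 ^ n, ⟨(le_div_iff₀ hp).2 (by linarith), (div_lt_iff₀ hp).2 (by linarith)⟩, ?_⟩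
  field_simp

theorem Tt_ext {f g : ℝ ≃o ℝ} (hf : f ∈ Tt) (hg : g ∈ Tt) {u : ℝ} (hu : 0 < u)
    (h : ∀ t ∈ Icc u (2 * u), f t = g t) : f = g := by
  ext t
  rcases le_or_gt t 0 with ht | ht
  · rw [hf.2.1 t ht, hg.2.1 t ht]
  · obtain ⟨n, s, hs, rfl⟩ := exists_zpow_mul_mem_Ico hu ht
    rw [doubling_zpow hf.1, doubling_zpow hg.1, h s (Ico_subset_Icc_self hs)]

/-- The periodic extension of a map supported in a fundamental domain of `t ↦ 2 t`. -/
theorem exists_periodic_extension {u : ℝ} (hu : 0 < u) {f : ℝ ≃o ℝ}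
    (hf : f ∈ PLc (Ioo u (2 * u))) : ∃ g ∈ Tt, ∀ t ∈ Icc u (2 * u), g t = f t := by
  obtain ⟨hfP, hfK⟩ := hf
  obtain ⟨p, q, -, -, hup, hpq, hqu, hfpq⟩ := exists_dyadic_Ioo_of_mem_Kc (by linarith) hfK
  have hoff : ∀ t ∉ Ioo u (2 * u), f t = t := fun t ht => hfpq t fun h =>
    ht ⟨hup.trans h.1, h.2.trans hqu⟩
  have hp2 : ∀ n : ℤ, (0 : ℝ) < 2 ^ n := fun n => by positivity
  let I : ℤ → Set ℝ := fun n => aff n 0 '' Ioo u (2 * u)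
  let F : ℤ → ℝ ≃o ℝ := fun n => aff n 0 * f * (aff n 0)⁻¹
  have hF : ∀ n s, F n (2 ^ n * s) = 2 ^ n * f s := fun n s => by
    have e : (aff n 0)⁻¹ (2 ^ n * s) = s := (aff n 0).symm_apply_eq.2 (by simp)
    simp only [F, RelIso.mul_apply, e]
    simp
  have hIm : ∀ n t, t ∈ I n ↔ ∃ s ∈ Ioo u (2 * u), t = 2 ^ n * s := fun n t => by
    simp only [I, mem_image, aff_apply, add_zero, eq_comm]
  have hIord : ∀ n, (I n).OrdConnected := fun n => by
    simp only [I, OrderIso.image_Ioo]; exact ordConnected_Ioo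
  have hdisj : ∀ i j t, t ∈ I i → t ∈ I j → i = j := by
    have : ∀ i j t, t ∈ I i → t ∈ I j → ¬ i < j := by
      intro i j t hi hj hij
      obtain ⟨s, hs, rfl⟩ := (hIm _ _).1 hi
      obtain ⟨s', hs', h⟩ := (hIm _ _).1 hj
      have h1 : (2 : ℝ) ^ (i + 1) ≤ 2 ^ j := zpow_le_zpow_right₀ one_le_two (by omega)
      rw [zpow_add_one₀ two_ne_zero] at h1
      have h2 := mul_lt_mul_of_pos_left hs.2 (hp2 i)
      have h3 := mul_lt_mul_of_pos_left hs'.1 (hp2 j)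
      nlinarith
    intro i j t hi hj
    by_contra hne
    rcases lt_or_gt_of_ne hne with h | h
    · exact this i j t hi hj h
    · exact this j i t hj hi h
  have hFI : ∀ i t, F i t ∈ I i ↔ t ∈ I i := by
    intro i t
    obtain ⟨s, rfl⟩ : ∃ s, t = 2 ^ i * s := ⟨t / 2 ^ i, by field_simp⟩
    rw [hF, hIm, hIm]
    have hinj : ∀ a b : ℝ, 2 ^ i * a = 2 ^ i * b ↔ a = b := fun a b =>
      mul_right_inj' (hp2 i).ne'
    simp only [hinj, exists_eq_right']
    exact mapsTo_of_fix_compl hoff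
  obtain ⟨g, hg, hg'⟩ := exists_union hIord hdisj hFI
  have hpos : ∀ n, ∀ t ∈ I n, 0 < t := fun n t ht => by
    obtain ⟨s, hs, rfl⟩ := (hIm _ _).1 ht
    exact mul_pos (hp2 n) (hu.trans hs.1)
  have hg0 : ∀ t ≤ 0, g t = t := fun t ht => hg' t fun n hn => ht.not_gt (hpos n t hn)
  have hgu : ∀ n : ℤ, ∀ s ∈ Icc u (2 * u), g (2 ^ n * s) = 2 ^ n * f s := by
    intro n s hs
    by_cases h : s ∈ Ioo u (2 * u)
    · rw [hg n _ ((hIm _ _).2 ⟨s, h, rfl⟩), hF]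
    · rw [hoff s h, hg']
      intro m hm
      obtain ⟨s', hs', he⟩ := (hIm _ _).1 hm
      -- `s` is `u` or `2 * u`, whose dyadic multiples lie in no translate
      have key : ∀ k : ℤ, (2 : ℝ) ^ k * u ≠ 2 ^ m * s' := by
        intro k hk
        rcases le_or_gt k m with hkm | hkm
        · have h1 : (2 : ℝ) ^ k ≤ 2 ^ m := zpow_le_zpow_right₀ one_le_two hkm
          have h2 := mul_lt_mul_of_pos_left hs'.1 (hp2 m)
          nlinarith
        · have h1 : (2 : ℝ) ^ (m + 1) ≤ 2 ^ k := zpow_le_zpow_right₀ one_le_two (by omega)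
          rw [zpow_add_one₀ two_ne_zero] at h1
          have h2 := mul_lt_mul_of_pos_left hs'.2 (hp2 m)
          nlinarith
      rcases hs.1.eq_or_lt with h1 | h1
      · exact key n (h1 ▸ he)
      · have h2 : s = 2 * u := by
          by_contra h3
          exact h ⟨h1, lt_of_le_of_ne hs.2 h3⟩
        refine key (n + 1) ?_
        rw [zpow_add_one₀ two_ne_zero, mul_assoc, ← h2, he]
  have hg2 : ∀ t, g (2 * t) = 2 * g t := by
    intro t
    rcases le_or_gt t 0 with ht | ht
    · rw [hg0 t ht, hg0 _ (by linarith)]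
    · obtain ⟨n, s, hs, rfl⟩ := exists_zpow_mul_mem_Ico hu ht
      have e : (2 : ℝ) * (2 ^ n * s) = 2 ^ (n + 1) * s := by
        rw [zpow_add_one₀ two_ne_zero]; ring
      rw [e, hgu _ s (Ico_subset_Icc_self hs), hgu _ s (Ico_subset_Icc_self hs),
        zpow_add_one₀ two_ne_zero]
      ring
  refine ⟨g, ⟨hg2, hg0, fun t ht => ?_⟩, fun t ht => by simpa using hgu 0 t ht⟩
  rcases lt_or_gt_of_ne ht with ht | ht
  · exact (PL.one_mem t).congr (mem_of_superset (Iio_mem_nhds ht) fun s hs => hg0 s (le_of_lt hs))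
  · obtain ⟨n, s, hs, rfl⟩ := exists_zpow_mul_mem_Ico hu ht
    have hFP : F n ∈ PL := mul_mem (mul_mem (aff_mem_PL n .zero) hfP) (inv_mem (aff_mem_PL n .zero))
    rcases hs.1.eq_or_lt with rfl | h1
    · refine (PL.one_mem _).congr ?_
      -- At an endpoint of a translated fundamental domain, `g` is the identity on both sides. On
      -- the right `f` has not begun to move before `p`; on the left, doubling lands in `(q, 2 *
      -- u]`, where `f` has stopped moving.
      have h2 : 2 ^ n * (q / 2) < 2 ^ n * u := mul_lt_mul_of_pos_left (by linarith) (hp2 n)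
      have h3 : 2 ^ n * u < 2 ^ n * p := mul_lt_mul_of_pos_left hup (hp2 n)
      filter_upwards [Ioo_mem_nhds h2 h3] with y hy
      obtain ⟨z, rfl⟩ : ∃ z, y = 2 ^ n * z := ⟨y / 2 ^ n, by field_simp⟩
      have hz1 := lt_of_mul_lt_mul_left hy.1 (hp2 n).le
      have hz2 := lt_of_mul_lt_mul_left hy.2 (hp2 n).le
      rcases le_total u z with h | h
      · rw [hgu n z ⟨h, by linarith⟩, hfpq z fun h' => lt_asymm hz2 h'.1]
        rfl
      · have e : (2 : ℝ) ^ n * z = 2 ^ (n - 1) * (2 * z) := by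
          rw [zpow_sub_one₀ two_ne_zero]; ring
        rw [e, hgu _ (2 * z) ⟨by linarith, by linarith⟩, hfpq _ fun h' => by linarith [h'.2]]
        rfl
    · refine (hFP _).congr ?_
      have : Ioo (2 ^ n * u) (2 ^ n * (2 * u)) ∈ 𝓝 (2 ^ n * s) := Ioo_mem_nhds
        (mul_lt_mul_of_pos_left h1 (hp2 n)) (mul_lt_mul_of_pos_left hs.2 (hp2 n))
      filter_upwards [this] with y hy
      obtain ⟨z, rfl⟩ : ∃ z, y = 2 ^ n * z := ⟨y / 2 ^ n, by field_simp⟩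
      exact hg n _ ((hIm _ _).2 ⟨z, ⟨lt_of_mul_lt_mul_left hy.1 (hp2 n).le,
        lt_of_mul_lt_mul_left hy.2 (hp2 n).le⟩, rfl⟩)

/-- `f` is a product of commutators inside `(u, 2 * u)`. Extending each factor periodically turns
them into commutators in `Tt`, and products are respected because all maps involved preserve `[u, 2
* u]`. -/
theorem exists_mem_commutator_Tt {u : ℝ} (hu : 0 < u) {f : ℝ ≃o ℝ}
    (hf : f ∈ PLc (Ioo u (2 * u))) : ∃ g ∈ ⁅Tt, Tt⁆, ∀ t ∈ Icc u (2 * u), g t = f t := by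
  have hmaps : ∀ h : ℝ ≃o ℝ, h ∈ PLc (Ioo u (2 * u)) → ∀ t ∈ Icc u (2 * u), h t ∈ Icc u (2 * u) := by
    rintro h ⟨-, K, -, hKU, hK⟩ t ht
    exact (mapsTo_of_fix_compl fun s hs => hK s fun h' =>
      hs (Ioo_subset_Icc_self (hKU h'))).2 ht
  have hinv : ∀ h g : ℝ ≃o ℝ, h ∈ PLc (Ioo u (2 * u)) → (∀ t ∈ Icc u (2 * u), g t = h t) →
      ∀ t ∈ Icc u (2 * u), g⁻¹ t = h⁻¹ t := by
    intro h g hh hg t ht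
    refine g.symm_apply_eq.2 ?_
    rw [hg _ (hmaps _ (inv_mem hh) t ht)]
    exact (h.apply_symm_apply t).symm
  have hf' := PLc_Ioo_le_commutator (by linarith) hf
  have key : f ∈ PLc (Ioo u (2 * u)) ∧ ∃ g ∈ ⁅Tt, Tt⁆, ∀ t ∈ Icc u (2 * u), g t = f t := by
    clear hf
    rw [Subgroup.commutator_def] at hf'
    induction hf' using Subgroup.closure_induction with
    | mem x hx =>
      obtain ⟨f1, h1, f2, h2, rfl⟩ := hx
      obtain ⟨g1, hg1, he1⟩ := exists_periodic_extension hu h1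
      obtain ⟨g2, hg2, he2⟩ := exists_periodic_extension hu h2
      have i1 := inv_mem h1
      have i2 := inv_mem h2
      refine ⟨mul_mem (mul_mem (mul_mem h1 h2) i1) i2, g1 * g2 * g1⁻¹ * g2⁻¹,
        Subgroup.commutator_mem_commutator hg1 hg2, fun t ht => ?_⟩
      simp only [commutatorElement_def, RelIso.mul_apply]
      have m1 := hmaps _ i2 t ht
      have m2 := hmaps _ i1 _ m1
      have m3 := hmaps _ h2 _ m2
      rw [hinv _ _ h2 he2 t ht, hinv _ _ h1 he1 _ m1, he2 _ m2, he1 _ m3]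
    | one => exact ⟨one_mem _, 1, one_mem _, fun _ _ => rfl⟩
    | mul x y hx hy ihx ihy =>
      obtain ⟨h1, g1, hg1, he1⟩ := ihx
      obtain ⟨h2, g2, hg2, he2⟩ := ihy
      refine ⟨mul_mem h1 h2, g1 * g2, mul_mem hg1 hg2, fun t ht => ?_⟩
      rw [RelIso.mul_apply, RelIso.mul_apply, he2 t ht, he1 _ (hmaps _ h2 t ht)]
    | inv x hx ih =>
      obtain ⟨h1, g1, hg1, he1⟩ := ih
      exact ⟨inv_mem h1, g1⁻¹, inv_mem hg1, hinv _ _ h1 he1⟩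
  exact key.2

/-- Being the identity near `u`, `θ` is also the identity near `2 * u` by doubling. Cut down to `[u,
2 * u]` it is compactly supported inside, and `θ` is the periodic extension of that piece. -/
theorem mem_commutator_Tt_of_eventually {θ : ℝ ≃o ℝ} (hθ : θ ∈ Tt) {u : ℝ} (hu : 0 < u)
    (hud : IsDyadic u) (h : ∀ᶠ s in 𝓝 u, θ s = s) : θ ∈ ⁅Tt, Tt⁆ := by
  obtain ⟨ε, hε, hball⟩ := Metric.eventually_nhds_iff_ball.1 h
  rw [Real.ball_eq_Ioo] at hball
  have h2 : θ (2 * u) = 2 * u := by rw [hθ.1, h.self_of_nhds]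
  have e1 : (1 : ℝ ≃o ℝ) u = θ u := h.self_of_nhds.symm
  have e2 : glue 1 θ u e1 (2 * u) = (1 : ℝ ≃o ℝ) (2 * u) := by
    rw [glue_of_ge e1 (by linarith), h2]; rfl
  have hin : ∀ t ∈ Icc u (2 * u), glue _ 1 _ e2 t = θ t := fun t ht => by
    rw [glue_of_le e2 ht.2, glue_of_ge e1 ht.1]
  have hmem : glue _ 1 _ e2 ∈ PLc (Ioo u (2 * u)) := by
    refine ⟨fun t => glue_PLGerm e2 hud.two_mul (fun _ => glue_PLGerm e1 hud (fun _ => PL.one_mem t) fun ht =>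
      hθ.2.2 t (hu.trans_le ht).ne') fun _ => PL.one_mem t,
      Icc (u + min ε u / 2) (2 * u - min ε u / 2), isCompact_Icc, ?_, ?_⟩
    · have := lt_min hε hu
      exact fun t ht => ⟨by linarith [ht.1], by linarith [ht.2]⟩
    · intro t ht
      have h0 := lt_min hε hu
      have h1 := min_le_left ε u
      by_cases h3 : t ∈ Icc u (2 * u)
      · rw [hin t h3]
        by_cases h4 : t < u + min ε u / 2
        · exact hball t ⟨by linarith [h3.1], by linarith⟩
        · have h5 : 2 * u - min ε u / 2 < t := by
            by_contra h5
            exact ht ⟨not_lt.1 h4, not_lt.1 h5⟩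
          have := hθ.1 (t / 2)
          rw [hball (t / 2) ⟨by linarith, by linarith [h3.2]⟩] at this
          rwa [show 2 * (t / 2) = t by ring] at this
      · by_cases h4 : t < u
        · rw [glue_of_le e2 (by linarith), glue_of_le e1 h4.le]; rfl
        · have : 2 * u ≤ t := by
            by_contra h5
            exact h3 ⟨not_lt.1 h4, (not_le.1 h5).le⟩
          rw [glue_of_ge e2 this]; rfl
  obtain ⟨g, hg, hge⟩ := exists_mem_commutator_Tt hu hmem
  rwa [Tt_ext hθ (Subgroup.commutator_le_self _ hg) hu
    fun t ht => ((hge t ht).trans (hin t ht)).symm]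

/-- Short moves are made inside a single fundamental domain, where periodic extensions are
available; `dyadic_chain` composes them to long ones. -/
theorem exists_commutator_Tt_apply {x y : ℝ} (hx : IsDyadic x) (hy : IsDyadic y) (hx0 : 0 < x)
    (hxy : x < y) : ∃ g ∈ ⁅Tt, Tt⁆, g x = y := by
  refine dyadic_chain (P := fun x y => ∃ g ∈ ⁅Tt, Tt⁆, g x = y) hx hy hxy ?_ ?_
  · rintro x y z - - - - - ⟨g, hg, rfl⟩ ⟨h, hh, rfl⟩
    exact ⟨h * g, mul_mem hh hg, rfl⟩
  · intro t ht
    have ht0 : 0 < t := hx0.trans_le ht.1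
    refine ⟨Ioo (3 / 4 * t) (5 / 4 * t), Ioo_mem_nhds (by linarith) (by linarith),
      fun a b ha hb hab hsub => ?_⟩
    have h1 := hsub ⟨le_rfl, hab.le⟩
    have h2 := hsub ⟨hab.le, le_rfl⟩
    -- With this `u` the domain `(u, 2 * u) = (11/16 * t, 22/16 * t)` contains the neighbourhood
    -- `(3/4 * t, 5/4 * t)`.
    set u := 11 / 16 * t with hu
    obtain ⟨p, hp, hp1, hp2⟩ := exists_isDyadic_btwn (show u < a by linarith [h1.1])
    obtain ⟨q, hq, hq1, hq2⟩ := exists_isDyadic_btwn (show b < 2 * u by linarith [h2.2])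
    obtain ⟨f, hf, hfa, hfpq⟩ := exists_PL_move hp hq ha hb hp2 (hp2.trans hab) (hab.trans hq1) hq1
    obtain ⟨g, hg, hge⟩ := exists_mem_commutator_Tt (u := u) (by linarith) (f := f)
      ⟨hf, mem_Kc_of_Ioo (fun s hs => ⟨hp1.trans_le hs.1, hs.2.trans_lt hq2⟩) hfpq⟩
    exact ⟨g, hg, by rw [hge a ⟨by linarith, by linarith⟩, hfa]⟩

/-- Correct `θ` by commutator products in two stages: first make it fix `1`, then make it the
identity near `1`. What remains is the periodic extension of a compactly supported map. -/
theorem Tt_le_commutator : Tt ≤ ⁅Tt, Tt⁆ := by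
  have hle := Subgroup.commutator_le_self Tt
  have fix : ∀ θ ∈ Tt, θ 1 = 1 → θ ∈ ⁅Tt, Tt⁆ := by
    intro θ hθ h1
    have hc := θ.continuous.tendsto 1
    rw [h1] at hc
    have hnear : ∀ᶠ s in 𝓝 (1 : ℝ), 4 / 5 < s ∧ s < 6 / 5 ∧ 4 / 5 < θ s ∧ θ s < 6 / 5 := by
      filter_upwards [lt_mem_nhds (show (4 / 5 : ℝ) < 1 by norm_num),
        gt_mem_nhds (show (1 : ℝ) < 6 / 5 by norm_num),
        hc.eventually (lt_mem_nhds (show (4 / 5 : ℝ) < 1 by norm_num)),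
        hc.eventually (gt_mem_nhds (show (1 : ℝ) < 6 / 5 by norm_num))] with s a b c d
      exact ⟨a, b, c, d⟩
    obtain ⟨p, q, hp, hq, hp1, hq1, hsub⟩ := exists_dyadic_Icc_subset hnear
    obtain ⟨c, hcd, hc1, hc2⟩ := exists_isDyadic_btwn (show (3 / 4 : ℝ) < 4 / 5 by norm_num)
    obtain ⟨d, hdd, hd1, hd2⟩ := exists_isDyadic_btwn (show (6 / 5 : ℝ) < 3 / 2 by norm_num)
    obtain ⟨-, -, hp4, hp5⟩ := hsub ⟨le_rfl, (hp1.trans hq1).le⟩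
    obtain ⟨-, -, hq4, hq5⟩ := hsub ⟨(hp1.trans hq1).le, le_rfl⟩
    have hp3 := (hsub ⟨le_rfl, (hp1.trans hq1).le⟩).1
    have hq3 := (hsub ⟨(hp1.trans hq1).le, le_rfl⟩).2.1
    -- The patch `k` copies `θ` near `1` and is supported inside the fundamental domain `(3/4,
    -- 3/2)`, which has `1` in its interior.
    obtain ⟨k, -, hk, hkoff, hkP⟩ := exists_patch (Tt_le_DD hθ) hcd hp hq hdd (by linarith)
      (hp1.trans hq1) (by linarith) (by linarith) (by linarith)
    obtain ⟨g, hg, hge⟩ := exists_mem_commutator_Tt (u := 3 / 4) (by norm_num) (f := k)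
      ⟨fun t => hkP t fun ht => hθ.2.2 t (by linarith [ht.1]),
        mem_Kc_of_Ioo (fun t ht => ⟨by linarith [ht.1], by linarith [ht.2]⟩) hkoff⟩
    have h2 : g⁻¹ * θ ∈ ⁅Tt, Tt⁆ := by
      refine mem_commutator_Tt_of_eventually (mul_mem (inv_mem (hle hg)) hθ) one_pos .one ?_
      filter_upwards [Ioo_mem_nhds hp1 hq1] with s hs
      refine g.symm_apply_eq.2 ?_
      rw [hge s ⟨by linarith [hs.1], by linarith [hs.2]⟩, hk s (Ioo_subset_Icc_self hs)]
      rfl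
    simpa using mul_mem hg h2
  intro θ hθ
  have hd : IsDyadic (θ 1) := DD.dyadic (Tt_le_DD hθ) .one
  have h0 : 0 < θ 1 := by
    have := θ.strictMono one_pos
    rwa [hθ.2.1 0 le_rfl] at this
  have : ∃ g ∈ ⁅Tt, Tt⁆, g 1 = θ 1 := by
    rcases lt_trichotomy 1 (θ 1) with h | h | h
    · exact exists_commutator_Tt_apply .one hd one_pos h
    · exact ⟨1, one_mem _, h⟩
    · obtain ⟨g, hg, hg1⟩ := exists_commutator_Tt_apply hd .one h0 h
      exact ⟨g⁻¹, inv_mem hg, g.symm_apply_eq.2 hg1.symm⟩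
  obtain ⟨g, hg, hg1⟩ := this
  have := fix (g⁻¹ * θ) (mul_mem (inv_mem (hle hg)) hθ) (g.symm_apply_eq.2 hg1.symm)
  simpa using mul_mem hg this

/-! ### Germs at a dyadic fixed point -/

/-- Compactly supported maps that fix `x₀` and are dyadic PL away from `x₀`. -/
def Dat (x₀ : ℝ) (U : Set ℝ) : Subgroup (ℝ ≃o ℝ) where
  carrier := {k | k ∈ Dc U ∧ k x₀ = x₀ ∧ ∀ t, t ≠ x₀ → PLGerm k t}
  one_mem' := ⟨one_mem _, rfl, fun t _ => PL.one_mem t⟩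
  mul_mem' := by
    rintro f g ⟨h1, h2, h3⟩ ⟨k1, k2, k3⟩
    refine ⟨mul_mem h1 k1, by rw [RelIso.mul_apply, k2, h2], fun t ht =>
      (k3 t ht).comp (h3 _ fun h => ht (g.injective (h.trans k2.symm))) g.continuous.continuousAt⟩
  inv_mem' := by
    rintro f ⟨h1, h2, h3⟩
    refine ⟨inv_mem h1, f.symm_apply_eq.2 h2.symm, fun t ht => ?_⟩
    have := (h3 (f.symm t) fun h => ht ?_).inv
    · rwa [f.apply_symm_apply] at this
    · rw [← f.apply_symm_apply t, h, h2]

theorem Dat_le_Dc (x₀ : ℝ) (U : Set ℝ) : Dat x₀ U ≤ Dc U := fun _ h => h.1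

theorem exists_Dat_eventuallyEq {f : ℝ ≃o ℝ} (hf : f ∈ DD) {x₀ a b : ℝ} (hfx : f x₀ = x₀)
    (ha : a < x₀) (hb : x₀ < b) : ∃ k ∈ Dat x₀ (Ioo a b), k =ᶠ[𝓝 x₀] f := by
  have hc := f.continuous.tendsto x₀
  rw [hfx] at hc
  have hnear : ∀ᶠ s in 𝓝 x₀, a < s ∧ s < b ∧ a < f s ∧ f s < b ∧ (s ≠ x₀ → PLGerm f s) := by
    filter_upwards [lt_mem_nhds ha, gt_mem_nhds hb, hc.eventually (lt_mem_nhds ha),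
      hc.eventually (gt_mem_nhds hb), eventually_nhdsWithin_iff.1 (hf x₀).1] with s h1 h2 h3 h4 h5
    exact ⟨h1, h2, h3, h4, h5⟩
  obtain ⟨p, q, hp, hq, hp1, hq1, hsub⟩ := exists_dyadic_Icc_subset hnear
  have hpq := hp1.trans hq1
  have hP := hsub ⟨le_rfl, hpq.le⟩
  have hQ := hsub ⟨hpq.le, le_rfl⟩
  obtain ⟨c, hcd, hc1, hc2⟩ := exists_isDyadic_btwn (lt_min hP.1 hP.2.2.1)
  obtain ⟨d, hdd, hd1, hd2⟩ := exists_isDyadic_btwn (max_lt hQ.2.1 hQ.2.2.2.1)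
  obtain ⟨k, hkD, hk, hkoff, hkP⟩ := exists_patch hf hcd hp hq hdd
    (hc2.trans_le (min_le_left _ _)) hpq ((le_max_left _ _).trans_lt hd1)
    (hc2.trans_le (min_le_right _ _)) ((le_max_right _ _).trans_lt hd1)
  refine ⟨k, ⟨⟨hkD, mem_Kc_of_Ioo (fun t ht => ⟨hc1.trans_le ht.1, ht.2.trans_lt hd2⟩) hkoff⟩,
    ?_, fun t ht => hkP t fun h => (hsub h).2.2.2.2 ht⟩, ?_⟩
  · rw [hk x₀ ⟨hp1.le, hq1.le⟩, hfx]
  · filter_upwards [Ioo_mem_nhds hp1 hq1] with t ht using hk t (Ioo_subset_Icc_self ht)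

theorem eventuallyEq_mul {f f' g g' : ℝ ≃o ℝ} {x : ℝ} (hf : f =ᶠ[𝓝 x] f') (hg : g =ᶠ[𝓝 x] g')
    (h : g' x = x) : (f * g : ℝ ≃o ℝ) =ᶠ[𝓝 x] (f' * g' : ℝ ≃o ℝ) := by
  have hc := g'.continuous.tendsto x
  rw [h] at hc
  filter_upwards [hg, hc.eventually hf] with t h1 h2
  rw [RelIso.mul_apply, RelIso.mul_apply, h1, h2]

theorem eventuallyEq_inv {f f' : ℝ ≃o ℝ} {x : ℝ} (hf : f =ᶠ[𝓝 x] f') (h : f' x = x) :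
    (f⁻¹ : ℝ ≃o ℝ) =ᶠ[𝓝 x] (f'⁻¹ : ℝ ≃o ℝ) := by
  have hc := f'.symm.continuous.tendsto x
  rw [f'.symm_apply_eq.2 h.symm] at hc
  filter_upwards [hc.eventually hf] with t h1
  refine f.symm_apply_eq.2 ?_
  change t = f (f'.symm t)
  rw [h1, f'.apply_symm_apply]

/-- Taking germs at `0` is multiplicative on maps fixing `0`, so each factor of a commutator product
may be replaced by a compactly supported map with the same germ. -/
theorem exists_commutator_Dat_of_mem_Tt {a b : ℝ} (ha : a < 0) (hb : 0 < b) {θ : ℝ ≃o ℝ}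
    (hθ : θ ∈ Tt) : ∃ k ∈ ⁅Dat 0 (Ioo a b), Dat 0 (Ioo a b)⁆, k =ᶠ[𝓝 0] θ := by
  have hfix : ∀ g ∈ Tt, g 0 = 0 := fun g hg => hg.2.1 0 le_rfl
  have h := Tt_le_commutator hθ
  clear hθ
  suffices θ 0 = 0 ∧ ∃ k ∈ ⁅Dat 0 (Ioo a b), Dat 0 (Ioo a b)⁆, k =ᶠ[𝓝 0] θ from this.2
  rw [Subgroup.commutator_def] at h
  induction h using Subgroup.closure_induction with
  | mem x hx =>
    obtain ⟨f, hf, g, hg, rfl⟩ := hx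
    obtain ⟨k, hk, hke⟩ := exists_Dat_eventuallyEq (Tt_le_DD hf) (hfix f hf) ha hb
    obtain ⟨l, hl, hle⟩ := exists_Dat_eventuallyEq (Tt_le_DD hg) (hfix g hg) ha hb
    have hf' := hfix _ (inv_mem hf)
    have hg' := hfix _ (inv_mem hg)
    exact ⟨hfix _ (mul_mem (mul_mem (mul_mem hf hg) (inv_mem hf)) (inv_mem hg)),
      k * l * k⁻¹ * l⁻¹, Subgroup.commutator_mem_commutator hk hl,
      eventuallyEq_mul (eventuallyEq_mul (eventuallyEq_mul hke hle (hfix g hg))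
      (eventuallyEq_inv hke (hfix f hf)) hf') (eventuallyEq_inv hle (hfix g hg)) hg'⟩
  | one => exact ⟨rfl, 1, one_mem _, EventuallyEq.rfl⟩
  | mul x y hx hy ihx ihy =>
    obtain ⟨hx0, k, hk, hke⟩ := ihx
    obtain ⟨hy0, l, hl, hle⟩ := ihy
    exact ⟨by rw [RelIso.mul_apply, hy0, hx0], k * l, mul_mem hk hl, eventuallyEq_mul hke hle hy0⟩
  | inv x hx ih =>
    obtain ⟨hx0, k, hk, hke⟩ := ih
    exact ⟨x.symm_apply_eq.2 hx0.symm, k⁻¹, inv_mem hk, eventuallyEq_inv hke hx0⟩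

/-- The rescalings `2 ^ n * f (t / 2 ^ n)` stop depending on `n` once `t / 2 ^ n` lies in the range
where `f` commutes with doubling. Their common value extends the germ of `f` to the line. -/
theorem exists_doubling_limit {f : ℝ → ℝ} (hf : ∀ᶠ y in 𝓝 0, f (2 * y) = 2 * f y) :
    ∃ (θ : ℝ → ℝ) (ε : ℝ), 0 < ε ∧ ∀ (t : ℝ) (n : ℕ), |t| < ε * 2 ^ n →
      θ t = 2 ^ n * f (t / 2 ^ n) := by
  obtain ⟨ε, hε, hball⟩ := Metric.eventually_nhds_iff_ball.1 hf
  have key : ∀ (t : ℝ) (n k : ℕ), |t| < ε * 2 ^ n →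
      2 ^ (n + k) * f (t / 2 ^ (n + k)) = 2 ^ n * f (t / 2 ^ n) := by
    intro t n k ht
    induction k with
    | zero => rfl
    | succ k ih =>
      have h2 : (2 : ℝ) ^ n ≤ 2 ^ (n + (k + 1)) := pow_le_pow_right₀ one_le_two (by omega)
      have := hball (t / 2 ^ (n + (k + 1))) (by
        rw [mem_ball_zero_iff, Real.norm_eq_abs, abs_div, abs_of_pos (by positivity : (0 : ℝ) < 2 ^ _),
          div_lt_iff₀ (by positivity)]
        nlinarith)
      rw [← ih, ← add_assoc, pow_succ, mul_assoc]
      rw [← add_assoc, pow_succ] at this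
      rw [← this]
      congr 2
      field_simp
  have hN : ∀ t : ℝ, ∃ n : ℕ, |t| < ε * 2 ^ n := fun t => by
    obtain ⟨n, hn⟩ := pow_unbounded_of_one_lt (|t| / ε) (one_lt_two (α := ℝ))
    exact ⟨n, by rwa [div_lt_iff₀' hε] at hn⟩
  choose N hN using hN
  refine ⟨fun t => 2 ^ N t * f (t / 2 ^ N t), ε, hε, fun t n ht => ?_⟩
  have h1 := key t (N t) n (hN t)
  have h2 := key t n (N t) ht
  rw [add_comm] at h2
  exact h1.symm.trans h2

theorem eventually_doubling {f : ℝ ≃o ℝ} (hf : f ∈ DD) (h0 : f 0 = 0) :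
    ∀ᶠ y in 𝓝 0, f (2 * y) = 2 * f y := by
  filter_upwards [((hf 0).2.1 .zero).2.2] with y hy
  rw [h0] at hy
  simpa [doubling] using hy

/-- The rescaling limits of `f` and of its inverse are inverse to each other. Away from `0` the
limit is a dyadic affine conjugate of `f` read close to `0`, where `f` is PL. -/
theorem exists_doubling_eventuallyEq {f : ℝ ≃o ℝ} (hf : f ∈ DD) (h0 : f 0 = 0) :
    ∃ θ : ℝ ≃o ℝ, (∀ t, θ (2 * t) = 2 * θ t) ∧ (∀ t, t ≠ 0 → PLGerm θ t) ∧ θ =ᶠ[𝓝 0] f := by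
  obtain ⟨θ, ε, hε, hθ⟩ := exists_doubling_limit (eventually_doubling hf h0)
  obtain ⟨θ', ε', hε', hθ'⟩ := exists_doubling_limit
    (eventually_doubling (inv_mem hf) (f.symm_apply_eq.2 h0.symm))
  have large : ∀ δ : ℝ, 0 < δ → ∀ t : ℝ, ∀ᶠ n : ℕ in atTop, |t| < δ * 2 ^ n := fun δ hδ t => by
    have := (tendsto_pow_atTop_atTop_of_one_lt (one_lt_two (α := ℝ))).eventually_gt_atTop (|t| / δ)
    filter_upwards [this] with n hn
    rwa [div_lt_iff₀' hδ] at hn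
  have hmono : StrictMono θ := by
    intro s t hst
    obtain ⟨n, h1, h2⟩ := ((large ε hε s).and (large ε hε t)).exists
    rw [hθ s n h1, hθ t n h2]
    refine mul_lt_mul_of_pos_left (f.strictMono ?_) (by positivity)
    exact div_lt_div_of_pos_right hst (by positivity)
  refine ⟨StrictMono.orderIsoOfRightInverse θ hmono θ' fun t => ?_, fun t => ?_, fun t ht => ?_, ?_⟩
  · obtain ⟨n, h1, h2⟩ := ((large ε' hε' t).and (large ε hε (θ' t))).exists
    rw [hθ _ n h2, hθ' t n h1, mul_div_cancel_left₀ _ (by positivity)]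
    have : f (f⁻¹ (t / 2 ^ n)) = t / 2 ^ n := f.apply_symm_apply _
    rw [this]
    field_simp
  · obtain ⟨n, h1⟩ := (large ε hε t).exists
    change θ (2 * t) = 2 * θ t
    rw [hθ t n h1, hθ (2 * t) (n + 1), pow_succ, mul_comm 2 t, mul_div_mul_right _ _ two_ne_zero]
    · ring
    · rw [abs_mul, pow_succ, abs_two]; linarith
  · obtain ⟨δ, hδ, hball⟩ := Metric.eventually_nhds_iff_ball.1 (eventually_nhdsWithin_iff.1 (hf 0).1)
    obtain ⟨n, h1, h2⟩ := ((large ε hε t).and (large δ hδ t)).exists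
    have hpl : PLGerm (aff n 0 * f * aff (-n) 0 : ℝ ≃o ℝ) t := by
      refine PLGerm.comp (f := aff (-n) 0) (g := (aff n 0 * f : ℝ ≃o ℝ)) (aff_mem_PL _ .zero t)
        (PLGerm.comp (g := aff n 0) (hball _ ?_ ?_) (aff_mem_PL _ .zero _)
        f.continuous.continuousAt) (aff (-n) 0).continuous.continuousAt
      · rw [mem_ball_zero_iff, Real.norm_eq_abs]
        simp only [aff_apply, zpow_neg, zpow_natCast, add_zero]
        rw [abs_mul, abs_inv, abs_of_pos (by positivity : (0 : ℝ) < 2 ^ n),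
          inv_mul_lt_iff₀ (by positivity)]
        linarith
      · simpa using ht
    refine hpl.congr ?_
    filter_upwards [continuous_abs.continuousAt.eventually (gt_mem_nhds h1)] with s hs
    change θ s = _
    rw [hθ s n hs]
    simp [div_eq_inv_mul]
  · have : ∀ᶠ s : ℝ in 𝓝 0, |s| < ε := by
      have := continuous_abs.tendsto (0 : ℝ)
      rw [abs_zero] at this
      exact this.eventually (gt_mem_nhds hε)
    filter_upwards [this] with s hs
    change θ s = f s
    have := hθ s 0 (by simpa using hs)
    simpa using this

theorem map_commutator_le {G : Type*} [Group G] {H K : Subgroup G} (φ : G →* G)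
    (h : ∀ x ∈ H, φ x ∈ K) {x : G} (hx : x ∈ ⁅H, H⁆) : φ x ∈ ⁅K, K⁆ := by
  have hm : H.map φ ≤ K := by
    rintro _ ⟨y, hy, rfl⟩
    exact h y hy
  have := Subgroup.mem_map_of_mem φ hx
  rw [Subgroup.map_commutator] at this
  exact Subgroup.commutator_mono hm hm this

theorem conjHom_mem_DD {γ : ℝ ≃ₜ ℝ} {ε m : ℤ} (hε : ε = 1 ∨ ε = -1) (hγ : ∀ t, γ t = ε * t + m)
    {f : ℝ ≃o ℝ} (hf : f ∈ DD) : conjHom γ f ∈ DD := fun x => (hf (γ x)).conjHom hε hγ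

theorem conjHom_mem_Kc {γ : ℝ ≃ₜ ℝ} {U : Set ℝ} {f : ℝ ≃o ℝ} (hf : f ∈ Kc U) :
    conjHom γ f ∈ Kc (γ ⁻¹' U) := by
  obtain ⟨K, hK, hKU, hf⟩ := hf
  refine ⟨γ ⁻¹' K, γ.isCompact_preimage.2 hK, preimage_mono hKU, fun t ht => ?_⟩
  rw [conjHom_apply, hf _ ht, γ.symm_apply_apply]

/-- Extend the germ of `f` to a map commuting with doubling and split it at `0`. The right half lies
in `Tt`, and so does the left half after reflection; `Tt` being perfect, both germs are realised by
commutators. -/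
theorem exists_commutator_Dat_zero {a b : ℝ} (ha : a < 0) (hb : 0 < b) {f : ℝ ≃o ℝ} (hf : f ∈ DD)
    (h0 : f 0 = 0) : ∃ k ∈ ⁅Dat 0 (Ioo a b), Dat 0 (Ioo a b)⁆, k =ᶠ[𝓝 0] f := by
  obtain ⟨θ, h1, h2, h3⟩ := exists_doubling_eventuallyEq hf h0
  have hθ0 : θ 0 = 0 := by rw [h3.self_of_nhds, h0]
  have er : (1 : ℝ ≃o ℝ) 0 = θ 0 := hθ0.symm
  have el : θ 0 = (1 : ℝ ≃o ℝ) 0 := hθ0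
  have hR : glue 1 θ 0 er ∈ Tt := by
    refine ⟨fun t => ?_, fun t ht => glue_of_le er ht, fun t ht => glue_PLGerm er .zero
      (fun _ => PL.one_mem t) fun _ => h2 t ht⟩
    rcases le_total t 0 with h | h
    · rw [glue_of_le er h, glue_of_le er (by linarith)]; rfl
    · rw [glue_of_ge er h, glue_of_ge er (by linarith), h1]
  let γ : ℝ ≃ₜ ℝ := Homeomorph.neg ℝ
  have hγ : ∀ t, γ t = ((-1 : ℤ) : ℝ) * t + ((0 : ℤ) : ℝ) := fun t => by simp [γ]
  have hγ0 : ∀ t, γ t = -t := fun t => rfl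
  have hγs : ∀ t, γ.symm t = -t := fun t => rfl
  have hL : conjHom γ (glue θ 1 0 el) ∈ Tt := by
    refine ⟨fun t => ?_, fun t ht => ?_, fun t ht => PLGerm.conjHom (Or.inr rfl) hγ
      (glue_PLGerm el .zero (fun _ => h2 _ ?_) fun _ => PL.one_mem _)⟩
    · rw [conjHom_apply, conjHom_apply, hγ0, hγ0, hγs, hγs]
      rcases le_total t 0 with h | h
      · rw [glue_of_ge el (by linarith), glue_of_ge el (by linarith)]
        simp
      · rw [glue_of_le el (by linarith), glue_of_le el (by linarith),
          show -(2 * t) = 2 * -t by ring, h1]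
        ring
    · rw [conjHom_apply, hγ0, hγs, glue_of_ge el (by linarith)]
      simp
    · simpa [hγ0] using ht
  obtain ⟨k, hk, hke⟩ := exists_commutator_Dat_of_mem_Tt ha hb hR
  obtain ⟨l, hl, hle⟩ := exists_commutator_Dat_of_mem_Tt (neg_lt_zero.2 hb) (neg_pos.2 ha) hL
  have hl' : conjHom γ l ∈ ⁅Dat 0 (Ioo a b), Dat 0 (Ioo a b)⁆ := by
    refine map_commutator_le _ (fun x hx => ?_) hl
    obtain ⟨⟨hx1, hx2⟩, hx3, hx4⟩ := hx
    refine ⟨⟨conjHom_mem_DD (Or.inr rfl) hγ hx1, ?_⟩, ?_, fun t ht =>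
      PLGerm.conjHom (Or.inr rfl) hγ (hx4 _ (by simpa [hγ0] using ht))⟩
    · have := conjHom_mem_Kc (γ := γ) hx2
      refine Kc_mono (fun t ht => ?_) this
      simp only [mem_preimage, hγ0, mem_Ioo] at ht ⊢
      exact ⟨by linarith, by linarith⟩
    · rw [conjHom_apply, hγ0, neg_zero, hx3, hγs, neg_zero]
  have hle' : conjHom γ l =ᶠ[𝓝 0] glue θ 1 0 el := by
    have := γ.continuous.tendsto 0
    rw [hγ0, neg_zero] at this
    filter_upwards [this.eventually hle] with t ht
    rw [conjHom_apply, ht, conjHom_apply, hγs, hγs, hγ0, hγ0, neg_neg, neg_neg]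
  refine ⟨conjHom γ l * k, mul_mem hl' hk, (eventuallyEq_mul hle' hke ?_).trans ?_⟩
  · rw [glue_of_le er le_rfl]; rfl
  · filter_upwards [h3] with t ht
    rw [← ht, RelIso.mul_apply]
    rcases le_total t 0 with h | h
    · rw [glue_of_le er h]
      exact glue_of_le el h
    · rw [glue_of_ge er h]
      refine glue_of_ge el ?_
      rw [← hθ0]
      exact θ.monotone h

theorem exists_commutator_Dat {a b x₀ : ℝ} (hx₀ : IsDyadic x₀) (ha : a < x₀) (hb : x₀ < b)
    {f : ℝ ≃o ℝ} (hf : f ∈ DD) (h0 : f x₀ = x₀) :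
    ∃ k ∈ ⁅Dat x₀ (Ioo a b), Dat x₀ (Ioo a b)⁆, k =ᶠ[𝓝 x₀] f := by
  set τ := aff 0 x₀ with hτ
  have hτD : τ ∈ PL := aff_mem_PL 0 hx₀
  have hτa : ∀ t, τ t = t + x₀ := fun t => by simp [hτ]
  have hτi : ∀ t, τ⁻¹ t = t - x₀ := fun t => τ.symm_apply_eq.2 (by rw [hτa]; ring)
  have h1 : τ⁻¹ * f * τ ∈ DD :=
    mul_mem (mul_mem (inv_mem (PL_le_DD hτD)) hf) (PL_le_DD hτD)
  obtain ⟨k, hk, hke⟩ := exists_commutator_Dat_zero (sub_neg.2 ha) (sub_pos.2 hb) h1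
    (by simp only [RelIso.mul_apply]; rw [hτa, zero_add, h0, hτi, sub_self])
  refine ⟨MulAut.conj τ k, map_commutator_le (MulAut.conj τ).toMonoidHom (fun x hx => ?_) hk, ?_⟩
  · obtain ⟨⟨hx1, K, hK, hKU, hxK⟩, hx3, hx4⟩ := hx
    refine ⟨⟨DD.mul_mem (mul_mem (PL_le_DD hτD) hx1) (inv_mem (PL_le_DD hτD)), τ '' K,
      hK.image τ.continuous, ?_, fun t ht => ?_⟩, ?_, fun t ht => ?_⟩
    · rintro _ ⟨s, hs, rfl⟩
      have := hKU hs
      rw [hτa]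
      exact ⟨by linarith [this.1], by linarith [this.2]⟩
    · change τ (x (τ⁻¹ t)) = t
      rw [hxK (τ⁻¹ t) fun hk => ht ⟨_, hk, τ.apply_symm_apply t⟩]
      exact τ.apply_symm_apply t
    · change τ (x (τ⁻¹ x₀)) = x₀
      rw [hτi, sub_self, hx3, hτa, zero_add]
    · refine PLGerm.comp (f := (τ⁻¹ : ℝ ≃o ℝ)) (g := (τ * x : ℝ ≃o ℝ)) (inv_mem hτD t)
        (PLGerm.comp (g := τ) (hx4 _ ?_) (hτD _) x.continuous.continuousAt)
        (OrderIso.continuous (τ⁻¹ : ℝ ≃o ℝ)).continuousAt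
      rw [hτi]
      exact sub_ne_zero.2 ht
  · have hc := (τ⁻¹).continuous.tendsto x₀
    rw [hτi, sub_self] at hc
    filter_upwards [hc.eventually hke] with t ht
    change τ (k (τ⁻¹ t)) = f t
    rw [ht]
    change τ (τ.symm (f (τ (τ.symm t)))) = f t
    rw [τ.apply_symm_apply, τ.apply_symm_apply]

/-- Induction on the number of points where `f` is not PL. The PL case is known, and the germ at one
bad point is cancelled by a product of commutators that is PL everywhere else. -/
theorem Dc_Ioo_le_commutator {a b : ℝ} (hab : a < b) :
    Dc (Ioo a b) ≤ ⁅Dc (Ioo a b), Dc (Ioo a b)⁆ := by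
  have hPL : PLc (Ioo a b) ≤ ⁅Dc (Ioo a b), Dc (Ioo a b)⁆ := (PLc_Ioo_le_commutator hab).trans
    (Subgroup.commutator_mono (PLc_le_Dc _) (PLc_le_Dc _))
  have hle := Subgroup.commutator_le_self (Dc (Ioo a b))
  have hsub : ∀ f ∈ Dc (Ioo a b), ∃ K, IsCompact K ∧ K ⊆ Ioo a b ∧ (∀ t ∉ K, f t = t) ∧
      {x | ¬ PLGerm f x} ⊆ {x ∈ K | ¬ PLGerm f x} := by
    rintro f ⟨hf, K, hK, hKU, hfK⟩
    refine ⟨K, hK, hKU, hfK, fun x hx => ⟨?_, hx⟩⟩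
    by_contra hxK
    refine hx ((PL.one_mem x).congr ?_)
    filter_upwards [hK.isClosed.isOpen_compl.mem_nhds hxK] with t ht using hfK t ht
  have hfin : ∀ f ∈ Dc (Ioo a b), {x | ¬ PLGerm f x}.Finite := fun f hf => by
    obtain ⟨K, hK, -, -, h⟩ := hsub f hf
    exact (finite_not_PLGerm hK fun x _ => (hf.1 x).1).subset h
  suffices ∀ n : ℕ, ∀ f ∈ Dc (Ioo a b), {x | ¬ PLGerm f x}.ncard ≤ n →
      f ∈ ⁅Dc (Ioo a b), Dc (Ioo a b)⁆ from fun f hf => this _ f hf le_rfl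
  intro n
  induction n with
  | zero =>
    intro f hf hn
    refine hPL ⟨fun x => ?_, hf.2⟩
    have := (ncard_eq_zero (hfin f hf)).1 (Nat.le_zero.1 hn)
    by_contra h
    exact (this ▸ h : x ∈ (∅ : Set ℝ))
  | succ n ih =>
    intro f hf hn
    rcases (eq_empty_or_nonempty {x | ¬ PLGerm f x}) with he | ⟨x₀, hx₀⟩
    · exact ih f hf (by rw [he]; simp)
    obtain ⟨K, hK, hKU, hfK, hKs⟩ := hsub f hf
    have hxK : x₀ ∈ K := (hKs hx₀).1
    have hfxK : f x₀ ∈ K := (mapsTo_of_fix_compl hfK).2 hxK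
    have hd : IsDyadic x₀ := by
      by_contra hd
      exact hx₀ (AffAlong.plGerm ((hf.1 x₀).2.2 hd))
    have hfd := DD.dyadic hf.1 hd
    have hxa := hKU hxK
    have hfa := hKU hfxK
    -- A bad point and its image are dyadic, so a PL map `m` supported in `(a, b)` brings `f x₀`
    -- back to `x₀` and gives a germ with a fixed point.
    obtain ⟨p, hp, hp1, hp2⟩ := exists_isDyadic_btwn (lt_min hxa.1 hfa.1)
    obtain ⟨q, hq, hq1, hq2⟩ := exists_isDyadic_btwn (max_lt hxa.2 hfa.2)
    obtain ⟨m, hm, hmx, hmoff⟩ := exists_PL_move hp hq hfd hd (hp2.trans_le (min_le_right _ _))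
      (hp2.trans_le (min_le_left _ _)) ((le_max_right _ _).trans_lt hq1)
      ((le_max_left _ _).trans_lt hq1)
    have hmc : m ∈ PLc (Ioo a b) :=
      ⟨hm, mem_Kc_of_Ioo (fun t ht => ⟨hp1.trans_le ht.1, ht.2.trans_lt hq2⟩) hmoff⟩
    have hmf : m * f ∈ Dc (Ioo a b) := mul_mem (PLc_le_Dc _ hmc) hf
    have hmfx : (m * f) x₀ = x₀ := hmx
    obtain ⟨k, hk, hke⟩ := exists_commutator_Dat hd hxa.1 hxa.2 hmf.1 hmfx
    have hkD : k ∈ Dat x₀ (Ioo a b) := Subgroup.commutator_le_self _ hk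
    have hkc : k ∈ ⁅Dc (Ioo a b), Dc (Ioo a b)⁆ :=
      Subgroup.commutator_mono (Dat_le_Dc _ _) (Dat_le_Dc _ _) hk
    have hg : k⁻¹ * (m * f) ∈ Dc (Ioo a b) := mul_mem (inv_mem hkD.1) hmf
    -- `k` and `m * f` have the same germ at `x₀`, so this bad point disappears. No new one arises,
    -- since `m` is PL and `k` is PL away from `x₀`.
    have hlt : {x | ¬ PLGerm (k⁻¹ * (m * f) : ℝ ≃o ℝ) x} ⊂ {x | ¬ PLGerm f x} := by
      refine ⟨fun x hx hxf => hx ?_, fun h => h hx₀ ?_⟩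
      · by_cases hxx : x = x₀
        · exact absurd (hxx ▸ hxf) hx₀
        · have h1 : PLGerm (m * f : ℝ ≃o ℝ) x := hxf.comp (hm _) f.continuous.continuousAt
          refine h1.comp (g := (k⁻¹ : ℝ ≃o ℝ)) ((inv_mem hkD).2.2 _ fun h => hxx ?_)
            (m * f).continuous.continuousAt
          exact (m * f).injective (h.trans hmfx.symm)
      · refine (PL.one_mem x₀).congr ?_
        filter_upwards [hke] with t ht
        exact k.symm_apply_eq.2 ht.symm
    have := ih _ hg (by
      have := ncard_lt_ncard hlt (hfin f hf)
      omega)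
    have h3 : f = m⁻¹ * (k * (k⁻¹ * (m * f))) := by group
    rw [h3]
    exact mul_mem (inv_mem (hPL hmc)) (mul_mem hkc this)

namespace ReversibleSystem

/-! ### The dihedral group and equivariant families of order isomorphisms -/

section Dihedral

variable {X : Type*} [TopologicalSpace X] (S : ReversibleSystem X)

theorem σ_mul_zpow (n : ℤ) : S.σ * S.φ ^ n = S.φ ^ (-n) * S.σ :=
  Homeomorph.ext fun x => S.σ_zpow n x

theorem σ_mul_σ : S.σ * S.σ = 1 := Homeomorph.ext S.σ_σ

/-- The infinite dihedral group acting on `X` and on `ℝ`. -/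
def Dih : Subgroup ((X ≃ₜ X) × (ℝ ≃ₜ ℝ)) where
  carrier := {δ | ∃ n : ℤ, (δ.1 = S.φ ^ n ∧ ∀ t, δ.2 t = t - n) ∨
    (δ.1 = S.φ ^ n * S.σ ∧ ∀ t, δ.2 t = -t - n)}
  one_mem' := ⟨0, Or.inl ⟨by simp, fun t => by simp⟩⟩
  mul_mem' := by
    rintro δ η ⟨n, ⟨h1, h2⟩ | ⟨h1, h2⟩⟩ ⟨m, ⟨k1, k2⟩ | ⟨k1, k2⟩⟩
    · refine ⟨n + m, Or.inl ⟨?_, fun t => ?_⟩⟩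
      · rw [Prod.fst_mul, h1, k1, zpow_add]
      · rw [Prod.snd_mul, Homeomorph.mul_apply, h2, k2]; push_cast; ring
    · refine ⟨n + m, Or.inr ⟨?_, fun t => ?_⟩⟩
      · rw [Prod.fst_mul, h1, k1, zpow_add, mul_assoc]
      · rw [Prod.snd_mul, Homeomorph.mul_apply, h2, k2]; push_cast; ring
    · refine ⟨n - m, Or.inr ⟨?_, fun t => ?_⟩⟩
      · rw [Prod.fst_mul, h1, k1, mul_assoc, σ_mul_zpow, ← mul_assoc, ← zpow_add, sub_eq_add_neg]
      · rw [Prod.snd_mul, Homeomorph.mul_apply, h2, k2]; push_cast; ring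
    · refine ⟨n - m, Or.inl ⟨?_, fun t => ?_⟩⟩
      · rw [Prod.fst_mul, h1, k1, mul_assoc, ← mul_assoc S.σ, σ_mul_zpow, mul_assoc, σ_mul_σ,
          mul_one, ← zpow_add, sub_eq_add_neg]
      · rw [Prod.snd_mul, Homeomorph.mul_apply, h2, k2]; push_cast; ring
  inv_mem' := by
    rintro δ ⟨n, ⟨h1, h2⟩ | ⟨h1, h2⟩⟩
    · refine ⟨-n, Or.inl ⟨by rw [Prod.fst_inv, h1, zpow_neg], fun t => ?_⟩⟩
      refine δ.2.symm_apply_eq.2 ?_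
      rw [h2]; push_cast; ring
    · refine ⟨n, Or.inr ⟨?_, fun t => ?_⟩⟩
      · rw [Prod.fst_inv, h1, mul_inv_rev, ← zpow_neg, inv_eq_of_mul_eq_one_left S.σ_mul_σ,
          σ_mul_zpow, neg_neg]
      · refine δ.2.symm_apply_eq.2 ?_
        rw [h2]; ring

variable {S}

theorem sameOrbit_iff {p q : X × ℝ} : S.SameOrbit p q ↔ ∃ δ ∈ S.Dih, q = (δ.1 p.1, δ.2 p.2) := by
  constructor
  · rintro ⟨n, h | h⟩
    · exact ⟨(S.φ ^ n, Homeomorph.addRight (-(n : ℝ))), ⟨n, Or.inl ⟨rfl, fun t => rfl⟩⟩, h⟩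
    · exact ⟨(S.φ ^ n * S.σ, (Homeomorph.neg ℝ).trans (Homeomorph.addRight (-(n : ℝ)))),
        ⟨n, Or.inr ⟨rfl, fun t => rfl⟩⟩, h⟩
  · rintro ⟨δ, ⟨n, ⟨h1, h2⟩ | ⟨h1, h2⟩⟩, rfl⟩
    · exact ⟨n, Or.inl (by rw [h1, h2])⟩
    · exact ⟨n, Or.inr (by rw [h1, h2]; rfl)⟩

theorem Dih.exists_affine {δ : (X ≃ₜ X) × (ℝ ≃ₜ ℝ)} (hδ : δ ∈ S.Dih) :
    ∃ ε m : ℤ, (ε = 1 ∨ ε = -1) ∧ ∀ t, δ.2 t = ε * t + m := by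
  obtain ⟨n, ⟨-, h⟩ | ⟨-, h⟩⟩ := hδ
  · exact ⟨1, -n, Or.inl rfl, fun t => by rw [h]; push_cast; ring⟩
  · exact ⟨-1, -n, Or.inr rfl, fun t => by rw [h]; push_cast; ring⟩

theorem Dih.dist_apply {δ : (X ≃ₜ X) × (ℝ ≃ₜ ℝ)} (hδ : δ ∈ S.Dih) (s t : ℝ) :
    |δ.2 s - δ.2 t| = |s - t| := by
  obtain ⟨ε, m, hε, h⟩ := Dih.exists_affine hδ
  rw [h, h]
  rcases hε with rfl | rfl
  · congr 1; push_cast; ring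
  · rw [abs_sub_comm s t]; congr 1; push_cast; ring

theorem Dih.flip_ne (n : ℤ) (x : X) : (S.φ ^ n * S.σ) x ≠ x := by
  intro h
  refine S.σ_ne x (-n) ?_
  have := congrArg (S.φ ^ (-n)) h
  rwa [Homeomorph.mul_apply, zpow_zpow, neg_add_cancel, zpow_zero] at this

/-- A nontrivial translation has no fixed point on the line, and a flip has none on `X` because `σ`
preserves no orbit: the action on `X × ℝ` is free. -/
theorem Dih.eq_one {δ : (X ≃ₜ X) × (ℝ ≃ₜ ℝ)} (hδ : δ ∈ S.Dih) {x : X} {t : ℝ} (hx : δ.1 x = x)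
    (ht : δ.2 t = t) : δ = 1 := by
  obtain ⟨n, ⟨h1, h2⟩ | ⟨h1, h2⟩⟩ := hδ
  · have hn : (n : ℝ) = 0 := by rw [h2] at ht; linarith
    have hn' : n = 0 := by exact_mod_cast hn
    subst hn'
    refine Prod.ext (by simpa using h1) (Homeomorph.ext fun s => ?_)
    rw [h2]; simp
  · rw [h1] at hx
    exact absurd hx (flip_ne n x)

theorem zpow_apply_ne {x : X} (hx : x ∉ Function.periodicPts S.φ) {n : ℤ} (hn : n ≠ 0) :
    (S.φ ^ n) x ≠ x := by
  have hpow : ∀ (k : ℕ), ⇑(S.φ ^ k) = S.φ^[k] := fun k => by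
    induction k with
    | zero => rfl
    | succ k ih =>
      ext y
      rw [pow_succ, Homeomorph.mul_apply, ih, Function.iterate_succ_apply]
  have key : ∀ k : ℕ, 0 < k → (S.φ ^ k) x ≠ x := by
    intro k hk h
    rw [hpow] at h
    exact hx ⟨k, hk, h⟩
  intro h
  rcases n.eq_nat_or_neg with ⟨k, rfl | rfl⟩
  · refine key k (by omega) ?_
    rwa [zpow_natCast] at h
  · refine key k (by omega) ?_
    have h' := congrArg (S.φ ^ (k : ℤ)) h
    rw [zpow_zpow, add_neg_cancel, zpow_zero] at h'
    rw [← zpow_natCast]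
    exact h'.symm

theorem Dih.eq_one_of_nonperiodic {δ : (X ≃ₜ X) × (ℝ ≃ₜ ℝ)} (hδ : δ ∈ S.Dih) {x : X}
    (hx : x ∉ Function.periodicPts S.φ) (h : δ.1 x = x) : δ = 1 := by
  obtain ⟨n, ⟨h1, h2⟩ | ⟨h1, h2⟩⟩ := id hδ
  · have hn : n = 0 := by
      by_contra hn
      rw [h1] at h
      exact zpow_apply_ne hx hn h
    subst hn
    exact Dih.eq_one hδ (t := 0) h (by rw [h2]; simp)
  · rw [h1] at h
    exact absurd h (flip_ne n x)

theorem π_eq_iff_Dih {p q : X × ℝ} : S.π p = S.π q ↔ ∃ δ ∈ S.Dih, q = (δ.1 p.1, δ.2 p.2) :=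
  π_eq_iff.trans sameOrbit_iff

theorem π_Dih {δ : (X ≃ₜ X) × (ℝ ≃ₜ ℝ)} (hδ : δ ∈ S.Dih) (x : X) (t : ℝ) :
    S.π (δ.1 x, δ.2 t) = S.π (x, t) :=
  (π_eq_iff_Dih.2 ⟨δ, hδ, rfl⟩ : S.π (x, t) = S.π (δ.1 x, δ.2 t)).symm

/-- A non-periodic point has trivial stabiliser, so its line injects into `Z`. This is how
equalities in `Z` become equalities of lifts. -/
theorem eq_of_π_eq {x : X} (hx : x ∉ Function.periodicPts S.φ) {s t : ℝ}
    (h : S.π (x, s) = S.π (x, t)) : s = t := by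
  obtain ⟨δ, hδ, he⟩ := π_eq_iff_Dih.1 h
  rw [Prod.mk.injEq] at he
  rw [he.2, Dih.eq_one_of_nonperiodic hδ hx he.1.symm]
  rfl

variable (S)

/-- The group of lifts to `X × ℝ`: equivariant, locally constant families of order isomorphisms
of the line that are locally of type `𝔇`. -/
def lifts : Subgroup (X → (ℝ ≃o ℝ)) where
  carrier := {F | (∀ x, F x ∈ DD) ∧ (∀ x t, ∀ᶠ p : X × ℝ in 𝓝 (x, t), F p.1 p.2 = F x p.2) ∧
    ∀ δ ∈ S.Dih, ∀ x t, F (δ.1 x) (δ.2 t) = δ.2 (F x t)}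
  one_mem' := ⟨fun _ => one_mem _, fun _ _ => Eventually.of_forall fun _ => rfl,
    fun _ _ _ _ => rfl⟩
  mul_mem' := by
    rintro F G ⟨h1, h2, h3⟩ ⟨k1, k2, k3⟩
    refine ⟨fun x => mul_mem (h1 x) (k1 x), fun x t => ?_, fun δ hδ x t => ?_⟩
    · have hc : Tendsto (fun p : X × ℝ => (p.1, G x p.2)) (𝓝 (x, t)) (𝓝 (x, G x t)) :=
        (continuous_fst.prodMk ((G x).continuous.comp continuous_snd)).tendsto (x, t)
      filter_upwards [k2 x t, hc.eventually (h2 x (G x t))] with p hp hp'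
      simp only [Pi.mul_apply, RelIso.mul_apply]
      rw [hp, hp']
    · simp only [Pi.mul_apply, RelIso.mul_apply]
      rw [k3 δ hδ, h3 δ hδ]
  inv_mem' := by
    rintro F ⟨h1, h2, h3⟩
    refine ⟨fun x => inv_mem (h1 x), fun x t => ?_, fun δ hδ x t => ?_⟩
    · have hc : Tendsto (fun p : X × ℝ => (p.1, (F x).symm p.2)) (𝓝 (x, t))
          (𝓝 (x, (F x).symm t)) :=
        (continuous_fst.prodMk ((F x).symm.continuous.comp continuous_snd)).tendsto (x, t)
      filter_upwards [hc.eventually (h2 x ((F x).symm t))] with p hp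
      refine (F p.1).symm_apply_eq.2 ?_
      change p.2 = F p.1 ((F x).symm p.2)
      rw [hp, (F x).apply_symm_apply]
    · refine (F (δ.1 x)).symm_apply_eq.2 ?_
      have := h3 δ hδ x ((F x).symm t)
      rw [(F x).apply_symm_apply] at this
      exact this.symm

variable {S}

theorem lifts.continuous {F : X → (ℝ ≃o ℝ)} (hF : F ∈ S.lifts) :
    Continuous fun p : X × ℝ => F p.1 p.2 := by
  refine continuous_iff_continuousAt.2 fun ⟨x, t⟩ => ?_
  refine ContinuousAt.congr (f := fun p : X × ℝ => F x p.2) ?_ ?_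
  · exact ((F x).continuous.comp continuous_snd).continuousAt
  · filter_upwards [hF.2.1 x t] with p hp using hp.symm

/-- The map of `Z` induced by an element of `lifts`. -/
def descendFun (F : S.lifts) : S.DihedralSuspension → S.DihedralSuspension :=
  Quotient.lift (fun p : X × ℝ => S.π (p.1, F.1 p.1 p.2)) (by
    intro p q h
    obtain ⟨δ, hδ, rfl⟩ := sameOrbit_iff.1 (show S.SameOrbit p q from h)
    rw [F.2.2.2 δ hδ, π_Dih hδ])

theorem continuous_π : Continuous S.π := continuous_quotient_mk'

theorem continuous_descendFun (F : S.lifts) : Continuous (descendFun F) :=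
  Continuous.quotient_lift
    (continuous_π.comp (continuous_fst.prodMk (lifts.continuous F.2))) _

theorem descendFun_mul (F G : S.lifts) (z : S.DihedralSuspension) :
    descendFun (F * G) z = descendFun F (descendFun G z) := by
  obtain ⟨x, t, rfl⟩ := exists_rep z
  rfl

theorem descendFun_one (z : S.DihedralSuspension) : descendFun (1 : S.lifts) z = z := by
  obtain ⟨x, t, rfl⟩ := exists_rep z
  rfl

/-- The homeomorphism of `Z` induced by an element of `lifts`. -/
def descendHomeo (F : S.lifts) : S.DihedralSuspension ≃ₜ S.DihedralSuspension where
  toFun := descendFun F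
  invFun := descendFun F⁻¹
  left_inv z := by rw [← descendFun_mul, inv_mul_cancel, descendFun_one]
  right_inv z := by rw [← descendFun_mul, mul_inv_cancel, descendFun_one]
  continuous_toFun := continuous_descendFun F
  continuous_invFun := continuous_descendFun F⁻¹

variable [CompactSpace X] [T2Space X] [TotallyDisconnectedSpace X]

theorem exists_isClopen_subset {x : X} {U : Set X} (hU : U ∈ 𝓝 x) :
    ∃ C, IsClopen C ∧ x ∈ C ∧ C ⊆ U := by
  obtain ⟨V, hVU, hV, hxV⟩ := mem_nhds_iff.1 hU
  obtain ⟨C, hC, hxC, hCV⟩ := compact_exists_isClopen_in_isOpen hV hxV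
  exact ⟨C, hC, hxC, hCV.trans hVU⟩

theorem descendHomeo_mem (F : S.lifts) : descendHomeo F ∈ S.groupT := by
  intro z
  obtain ⟨x, t, rfl⟩ := exists_rep z
  refine LocalForm.isLocallyTypeD ?_
  obtain ⟨C, hC, hxC, hinj⟩ := exists_injOn (S := S) x t
  obtain ⟨U, hU, V, hV, hUV⟩ := mem_nhds_prod_iff.1 (F.2.2.1 x t)
  obtain ⟨C', hC', hxC', hCU⟩ := exists_isClopen_subset hU
  obtain ⟨p, q, hp, hq, hpt, htq, hpq⟩ := exists_dyadic_Icc_subset (inter_mem hV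
    (Ioo_mem_nhds (show t - 1 / 4 < t by linarith) (show t < t + 1 / 4 by linarith)))
  obtain ⟨k, hk, hks, hkF⟩ := DD.exists_isTypeD (F.2.1 x) hp hq (hpt.trans htq)
  have hsub : Ioo p q ⊆ Icc p q := Ioo_subset_Icc_self
  refine ⟨C ∩ C', k, hk, hC.inter hC', hinj.mono ?_, ⟨hxC, hxC'⟩, hks ▸ ⟨hpt, htq⟩, ?_⟩
  · rw [hks]
    exact prod_mono inter_subset_left fun s hs => (hpq (hsub hs)).2
  · intro y hy s hs
    rw [hks] at hs
    change S.π (y, F.1 y s) = _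
    have : F.1 y s = F.1 x s := @hUV (y, s) ⟨hCU hy.2, (hpq (hsub hs)).1⟩
    rw [this, hkF]

variable (S) in
/-- The homomorphism from lifts to homeomorphisms of `Z`. -/
def descend : S.lifts →* S.groupT :=
  MonoidHom.mk' (fun F => ⟨descendHomeo F, descendHomeo_mem F⟩) fun F G =>
    Subtype.ext (Homeomorph.ext fun z => descendFun_mul F G z)

theorem descend_π (F : S.lifts) (x : X) (t : ℝ) :
    (descend S F).1 (S.π (x, t)) = S.π (x, F.1 x t) := rfl

end Dihedral

/-! ### Every element of the group lifts -/

section Lift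

variable {X : Type*} [TopologicalSpace X] {S : ReversibleSystem X}
  (hfree : Dense {x : X | x ∉ Function.periodicPts S.φ})

/-- `F` is a lift of `g` that locally has the form prescribed for elements of the group. -/
def IsLift (g : S.DihedralSuspension ≃ₜ S.DihedralSuspension) (F : X → ℝ → ℝ) : Prop :=
  (∀ x t, g (S.π (x, t)) = S.π (x, F x t)) ∧ ∀ x t, ∃ f : OpenPartialHomeomorph ℝ ℝ,
    IsTypeD f ∧ t ∈ f.source ∧ ∀ᶠ p : X × ℝ in 𝓝 (x, t), F p.1 p.2 = f p.2

include hfree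

/-- Two local forms overlapping over a clopen set agree there: they do not depend on the point of
`X`, and they can be compared over a non-periodic point of the overlap. -/
theorem exists_isLift {g : S.DihedralSuspension ≃ₜ S.DihedralSuspension}
    (hg : ∀ p, LocalForm g p) : ∃ F, IsLift g F := by
  choose C f hf hC hi h1 h2 hform using hg
  have uniq : ∀ p q : X × ℝ, q.1 ∈ C p → q.2 ∈ (f p).source → f q q.2 = f p q.2 := by
    intro p q hq1 hq2
    obtain ⟨y, ⟨hy1, hy2⟩, hy⟩ := hfree.inter_open_nonempty (C p ∩ C q)
      ((hC p).isOpen.inter (hC q).isOpen) ⟨q.1, hq1, h1 q⟩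
    refine eq_of_π_eq hy ?_
    rw [← hform p y hy1 _ hq2, ← hform q y hy2 _ (h2 q)]
  refine ⟨fun x t => f (x, t) t, fun x t => hform (x, t) x (h1 (x, t)) t (h2 (x, t)),
    fun x t => ⟨f (x, t), hf _, h2 _, ?_⟩⟩
  filter_upwards [prod_mem_nhds ((hC (x, t)).isOpen.mem_nhds (h1 (x, t)))
    ((f (x, t)).open_source.mem_nhds (h2 (x, t)))] with p hp
  exact uniq (x, t) p hp.1 hp.2

omit hfree in
theorem IsLift.eventually {g : S.DihedralSuspension ≃ₜ S.DihedralSuspension} {F : X → ℝ → ℝ}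
    (hF : IsLift g F) (x : X) (t : ℝ) : ∀ᶠ p : X × ℝ in 𝓝 (x, t), F p.1 p.2 = F x p.2 := by
  obtain ⟨f, hf, ht, h⟩ := hF.2 x t
  have hc : Tendsto (fun p : X × ℝ => (x, p.2)) (𝓝 (x, t)) (𝓝 (x, t)) :=
    (continuous_const.prodMk continuous_snd).tendsto (x, t)
  filter_upwards [h, hc.eventually h] with p h1 h2
  rw [h1, h2]

omit hfree in
theorem IsLift.eventually_left {g : S.DihedralSuspension ≃ₜ S.DihedralSuspension} {F : X → ℝ → ℝ}
    (hF : IsLift g F) (x : X) (t : ℝ) : ∀ᶠ y in 𝓝 x, F y t = F x t := by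
  have hc : Tendsto (fun y : X => (y, t)) (𝓝 x) (𝓝 (x, t)) :=
    (continuous_id.prodMk continuous_const).tendsto x
  exact hc.eventually (hF.eventually x t)

theorem exists_nonperiodic {x : X} {p : X → Prop} (h : ∀ᶠ y in 𝓝 x, p y) :
    ∃ y, y ∉ Function.periodicPts S.φ ∧ p y := by
  obtain ⟨U, hU, hUo, hxU⟩ := mem_nhds_iff.1 h
  obtain ⟨y, hyU, hy⟩ := hfree.inter_open_nonempty U hUo ⟨x, hxU⟩
  exact ⟨y, hy, hU hyU⟩

/-- At fixed `t` the lifts are locally constant in `x`, so the identity may be checked over a nearby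
non-periodic point, where it follows from the one in `Z`. Equivariance below is obtained in the same
way. -/
theorem IsLift.comp_eq {g h : S.DihedralSuspension ≃ₜ S.DihedralSuspension} {F G : X → ℝ → ℝ}
    (hF : IsLift g F) (hG : IsLift h G) (hgh : ∀ z, h (g z) = z) (x : X) (t : ℝ) :
    G x (F x t) = t := by
  obtain ⟨y, hy, h1, h2⟩ := exists_nonperiodic hfree
    ((hF.eventually_left x t).and (hG.eventually_left x (F x t)))
  rw [← h2, ← h1]
  refine eq_of_π_eq hy ?_
  rw [← hG.1, ← hF.1, hgh]

theorem IsLift.equivariant {g : S.DihedralSuspension ≃ₜ S.DihedralSuspension} {F : X → ℝ → ℝ}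
    (hF : IsLift g F) {δ : (X ≃ₜ X) × (ℝ ≃ₜ ℝ)} (hδ : δ ∈ S.Dih) (x : X) (t : ℝ) :
    F (δ.1 x) (δ.2 t) = δ.2 (F x t) := by
  obtain ⟨y, hy, h1, h2⟩ := exists_nonperiodic hfree ((hF.eventually_left x t).and
    ((δ.1.continuous.tendsto x).eventually (hF.eventually_left (δ.1 x) (δ.2 t))))
  rw [← h2, ← h1, ← δ.2.symm_apply_eq]
  refine eq_of_π_eq hy ?_
  rw [← π_Dih hδ, δ.2.apply_symm_apply, ← hF.1, π_Dih hδ, hF.1]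

omit hfree in
theorem IsLift.dGerm {g : S.DihedralSuspension ≃ₜ S.DihedralSuspension} {F : X → ℝ → ℝ}
    (hF : IsLift g F) (x : X) (t : ℝ) : DGerm (F x) t ∧ ContinuousAt (F x) t := by
  obtain ⟨f, hf, ht, h⟩ := hF.2 x t
  have hc : Tendsto (fun s : ℝ => (x, s)) (𝓝 t) (𝓝 (x, t)) :=
    (continuous_const.prodMk continuous_id).tendsto t
  have he : F x =ᶠ[𝓝 t] f := hc.eventually h
  exact ⟨(hf.dGerm ht).congr he, (f.continuousAt ht).congr he.symm⟩

-- An injective continuous map is monotone or antitone, and dyadic affine pieces have positive slope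
-- `2 ^ n`.
omit hfree in
theorem strictMono_of_dGerm {f : ℝ → ℝ} (hc : Continuous f) (hi : Function.Injective f)
    (hd : DGerm f 0) : StrictMono f := by
  rcases hc.strictMono_of_inj hi with h | h
  · exact h
  obtain ⟨s, hs⟩ := hd.1.exists
  obtain ⟨n, b, -, hb⟩ := hs.1
  obtain ⟨l, hl, hlb⟩ := (mem_nhdsLT_iff_exists_Ioo_subset (a := s)).1 hb
  obtain ⟨u, hu1, hu2⟩ := exists_between (mem_Iio.1 hl)
  obtain ⟨v, hv1, hv2⟩ := exists_between hu2
  have h1 := h hv1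
  have e1 : f u = 2 ^ n * u + b := hlb ⟨hu1, hu2⟩
  have e2 : f v = 2 ^ n * v + b := hlb ⟨hu1.trans hv1, hv2⟩
  have : (0 : ℝ) < 2 ^ n := by positivity
  rw [e1, e2] at h1
  have := mul_lt_mul_of_pos_left hv1 this
  linarith

variable [CompactSpace X] [T2Space X] [TotallyDisconnectedSpace X]

theorem descend_surjective : Function.Surjective (descend S) := by
  rintro ⟨g, hg⟩
  obtain ⟨F, hF⟩ := exists_isLift hfree (g := g) fun p => (hg _).localForm
  have hg' := S.groupT.inv_mem hg
  obtain ⟨G, hG⟩ := exists_isLift hfree (g := g⁻¹) fun p => (hg' _).localForm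
  have hGF := hF.comp_eq hfree hG fun z => g.symm_apply_apply z
  have hFG := hG.comp_eq hfree hF fun z => g.apply_symm_apply z
  have hmono : ∀ x, StrictMono (F x) := fun x => strictMono_of_dGerm
    (continuous_iff_continuousAt.2 fun t => (hF.dGerm x t).2)
    (Function.LeftInverse.injective (hGF x)) (hF.dGerm x 0).1
  refine ⟨⟨fun x => StrictMono.orderIsoOfRightInverse (F x) (hmono x) (G x) (hFG x),
    fun x t => (hF.dGerm x t).1, hF.eventually, fun δ hδ x t => hF.equivariant hfree hδ x t⟩, ?_⟩
  refine Subtype.ext (Homeomorph.ext fun z => ?_)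
  obtain ⟨x, t, rfl⟩ := exists_rep z
  exact (hF.1 x t).symm

end Lift

/-! ### Lifts supported on the translates of a small box -/

section Bump

variable {X : Type*} [TopologicalSpace X] {S : ReversibleSystem X}

/-- Properness of the action on the line, which makes the translates of a bounded box locally
finite. -/
theorem Dih.finite_visits (a b c d : ℝ) :
    {δ | δ ∈ S.Dih ∧ ∃ s ∈ Icc a b, δ.2 s ∈ Icc c d}.Finite := by
  let rot : ℤ → (X ≃ₜ X) × (ℝ ≃ₜ ℝ) := fun n => (S.φ ^ n, Homeomorph.addRight (-(n : ℝ)))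
  let flip : ℤ → (X ≃ₜ X) × (ℝ ≃ₜ ℝ) := fun n =>
    (S.φ ^ n * S.σ, (Homeomorph.neg ℝ).trans (Homeomorph.addRight (-(n : ℝ))))
  refine (((finite_Icc ⌈a - d⌉ ⌊b - c⌋).image rot).union
    ((finite_Icc ⌈-b - d⌉ ⌊-a - c⌋).image flip)).subset ?_
  rintro δ ⟨⟨n, ⟨h1, h2⟩ | ⟨h1, h2⟩⟩, s, hs, hδs⟩
  · rw [h2] at hδs
    refine Or.inl ⟨n, ⟨Int.ceil_le.2 ?_, Int.le_floor.2 ?_⟩, Prod.ext h1.symm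
      (Homeomorph.ext fun t => (h2 t).symm)⟩
    · linarith [hs.1, hδs.2]
    · linarith [hs.2, hδs.1]
  · rw [h2] at hδs
    refine Or.inr ⟨n, ⟨Int.ceil_le.2 ?_, Int.le_floor.2 ?_⟩, Prod.ext h1.symm
      (Homeomorph.ext fun t => (h2 t).symm)⟩
    · linarith [hs.2, hδs.2]
    · linarith [hs.1, hδs.1]

variable (S) in
/-- `W` meets each orbit at most once, and its points have trivial stabilisers. -/
def IsFree (W : Set (X × ℝ)) : Prop :=
  ∀ δ ∈ S.Dih, ∀ x t, (x, t) ∈ W → (δ.1 x, δ.2 t) ∈ W → δ = 1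

theorem IsFree.mono {W W' : Set (X × ℝ)} (h : S.IsFree W) (hW : W' ⊆ W) : S.IsFree W' :=
  fun δ hδ x t h1 h2 => h δ hδ x t (hW h1) (hW h2)

theorem isFree_of_injOn {W : Set (X × ℝ)} (h : InjOn S.π W) : S.IsFree W := by
  intro δ hδ x t h1 h2
  have := h h2 h1 (π_Dih hδ x t)
  rw [Prod.mk.injEq] at this
  exact Dih.eq_one hδ this.1 this.2

/-- A map that is the identity away from the translates of `W`. -/
def FixesOff (S : ReversibleSystem X) (W : Set (X × ℝ)) (B : X → (ℝ ≃o ℝ)) : Prop :=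
  ∀ x t, (∀ δ ∈ S.Dih, (δ.1 x, δ.2 t) ∉ W) → B x t = t

/-- `B` is given by `f` on the translates of `D × (a, b)` and is the identity elsewhere. -/
def IsBump (S : ReversibleSystem X) (D : Set X) (a b : ℝ) (f : ℝ ≃o ℝ) (B : X → (ℝ ≃o ℝ)) : Prop :=
  (∀ δ ∈ S.Dih, ∀ x t, δ.1 x ∈ D → δ.2 t ∈ Ioo a b → δ.2 (B x t) = f (δ.2 t)) ∧
    S.FixesOff (D ×ˢ Ioo a b) B

variable {D : Set X} {a b : ℝ}

theorem mem_Ioo_iff_of_mem_Kc {f : ℝ ≃o ℝ} {U : Set ℝ} (hf : f ∈ Kc U) (t : ℝ) :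
    f t ∈ U ↔ t ∈ U := by
  obtain ⟨K, -, hKU, hf⟩ := hf
  exact mapsTo_of_fix_compl fun t ht => hf t fun h => ht (hKU h)

/-- Over a fixed `x`, freeness makes the intervals `δ.2 ⁻¹' (a, b)` with `δ.1 x ∈ D` pairwise
disjoint, so the conjugates of `f` on them can be united. -/
theorem exists_isBump (hfree : S.IsFree (D ×ˢ Ioo a b)) {f : ℝ ≃o ℝ} (hf : f ∈ Kc (Ioo a b)) :
    ∃ B, S.IsBump D a b f B := by
  have key : ∀ x : X, ∃ F : ℝ ≃o ℝ,
      (∀ i : {δ // δ ∈ S.Dih ∧ δ.1 x ∈ D}, ∀ t ∈ i.1.2 ⁻¹' Ioo a b, F t = conjHom i.1.2 f t) ∧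
      ∀ t, (∀ i : {δ // δ ∈ S.Dih ∧ δ.1 x ∈ D}, t ∉ i.1.2 ⁻¹' Ioo a b) → F t = t := by
    intro x
    refine exists_union (fun i => ?_) (fun i j t hi hj => ?_) fun i t => ?_
    · rcases i.1.2.continuous.strictMono_of_inj i.1.2.injective with h | h
      · exact ordConnected_Ioo.preimage_mono h.monotone
      · exact ordConnected_Ioo.preimage_anti h.antitone
    · have h := hfree (j.1 * i.1⁻¹) (mul_mem j.2.1 (inv_mem i.2.1)) (i.1.1 x) (i.1.2 t)
        ⟨i.2.2, hi⟩ ⟨?_, ?_⟩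
      · exact Subtype.ext (mul_inv_eq_one.1 h).symm
      · change j.1.1 (i.1.1.symm (i.1.1 x)) ∈ D
        rw [Homeomorph.symm_apply_apply]
        exact j.2.2
      · change j.1.2 (i.1.2.symm (i.1.2 t)) ∈ Ioo a b
        rw [Homeomorph.symm_apply_apply]
        exact hj
    · rw [mem_preimage, conjHom_apply, Homeomorph.apply_symm_apply]
      exact mem_Ioo_iff_of_mem_Kc hf _
  choose B h1 h2 using key
  refine ⟨B, fun δ hδ x t hx ht => ?_, fun x t h => h2 x t fun i hi => h _ i.2.1 ⟨i.2.2, hi⟩⟩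
  rw [h1 x ⟨δ, hδ, hx⟩ t ht, conjHom_apply, Homeomorph.apply_symm_apply]

theorem IsBump.unique {f : ℝ ≃o ℝ} {B B' : X → (ℝ ≃o ℝ)} (hB : S.IsBump D a b f B)
    (hB' : S.IsBump D a b f B') : B = B' := by
  funext x
  ext t
  by_cases h : ∃ δ ∈ S.Dih, (δ.1 x, δ.2 t) ∈ D ×ˢ Ioo a b
  · obtain ⟨δ, hδ, hx, ht⟩ := h
    exact δ.2.injective ((hB.1 δ hδ x t hx ht).trans (hB'.1 δ hδ x t hx ht).symm)
  · push Not at h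
    rw [hB.2 x t h, hB'.2 x t h]

theorem IsBump.mul {f g : ℝ ≃o ℝ} {B B' : X → (ℝ ≃o ℝ)} (hB : S.IsBump D a b f B)
    (hB' : S.IsBump D a b g B') (hg : g ∈ Kc (Ioo a b)) : S.IsBump D a b (f * g) (B * B') := by
  refine ⟨fun δ hδ x t hx ht => ?_, fun x t h => ?_⟩
  · have h1 := hB'.1 δ hδ x t hx ht
    change δ.2 (B x (B' x t)) = f (g (δ.2 t))
    rw [hB.1 δ hδ x _ hx, h1]
    rw [h1]
    exact (mem_Ioo_iff_of_mem_Kc hg _).2 ht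
  · change B x (B' x t) = t
    rw [hB'.2 x t h, hB.2 x t h]

theorem IsBump.eventually_of_mem {f : ℝ ≃o ℝ} {B : X → (ℝ ≃o ℝ)} (hB : S.IsBump D a b f B)
    (hD : IsOpen D) {δ : (X ≃ₜ X) × (ℝ ≃ₜ ℝ)} (hδ : δ ∈ S.Dih) {x : X} {t : ℝ} (hx : δ.1 x ∈ D)
    (ht : δ.2 t ∈ Ioo a b) : ∀ᶠ p : X × ℝ in 𝓝 (x, t), B p.1 p.2 = conjHom δ.2 f p.2 := by
  filter_upwards [prod_mem_nhds ((hD.preimage δ.1.continuous).mem_nhds hx)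
    ((isOpen_Ioo.preimage δ.2.continuous).mem_nhds ht)] with p hp
  rw [conjHom_apply, ← hB.1 δ hδ p.1 p.2 hp.1 hp.2, Homeomorph.symm_apply_apply]

/-- Only finitely many translates of the compact `K` come near `t`. Each closed translate of `D × K`
misses `(x, t)`, hence a neighbourhood of it. -/
theorem IsBump.eventually_of_notMem {f : ℝ ≃o ℝ} {B : X → (ℝ ≃o ℝ)} (hB : S.IsBump D a b f B)
    (hD : IsClosed D) {K : Set ℝ} (hK : IsCompact K) (hf : ∀ t ∉ K, f t = t) {x : X} {t : ℝ}
    (h : ∀ δ ∈ S.Dih, (δ.1 x, δ.2 t) ∉ D ×ˢ K) :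
    ∀ᶠ p : X × ℝ in 𝓝 (x, t), B p.1 p.2 = p.2 := by
  obtain ⟨c, hc⟩ := hK.bddBelow
  obtain ⟨d, hd⟩ := hK.bddAbove
  have hfin := Dih.finite_visits (S := S) (t - 1) (t + 1) c d
  have hev : ∀ᶠ p : X × ℝ in 𝓝 (x, t),
      ∀ δ ∈ {δ | δ ∈ S.Dih ∧ ∃ s ∈ Icc (t - 1) (t + 1), δ.2 s ∈ Icc c d},
        (δ.1 p.1, δ.2 p.2) ∉ D ×ˢ K := by
    refine (eventually_all_finite hfin).2 fun δ hδ => ?_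
    have hcl : IsClosed ((fun p : X × ℝ => (δ.1 p.1, δ.2 p.2)) ⁻¹' (D ×ˢ K)) :=
      (hD.prod hK.isClosed).preimage (by fun_prop)
    exact hcl.isOpen_compl.mem_nhds (h δ hδ.1)
  filter_upwards [hev, prod_mem_nhds univ_mem
    (Icc_mem_nhds (show t - 1 < t by linarith) (show t < t + 1 by linarith))] with p hp hpt
  by_cases hv : ∃ δ ∈ S.Dih, (δ.1 p.1, δ.2 p.2) ∈ D ×ˢ Ioo a b
  · obtain ⟨δ, hδ, hx, ht⟩ := hv
    refine δ.2.injective ((hB.1 δ hδ _ _ hx ht).trans (hf _ fun hk => ?_))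
    exact hp δ ⟨hδ, p.2, hpt.2, hc hk, hd hk⟩ ⟨hx, hk⟩
  · push Not at hv
    exact hB.2 _ _ hv

theorem IsBump.mem_lifts {f : ℝ ≃o ℝ} {B : X → (ℝ ≃o ℝ)} (hB : S.IsBump D a b f B)
    (hD : IsClopen D) (hf : f ∈ Dc (Ioo a b)) : B ∈ S.lifts := by
  obtain ⟨hfD, K, hK, hKU, hfK⟩ := hf
  have hr : ∀ (x : X) (t : ℝ), Tendsto (fun s : ℝ => (x, s)) (𝓝 t) (𝓝 (x, t)) := fun x t =>
    (continuous_const.prodMk continuous_id).tendsto t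
  have key : ∀ x t, ∃ g ∈ DD, ∀ᶠ p : X × ℝ in 𝓝 (x, t), B p.1 p.2 = g p.2 := by
    intro x t
    by_cases h : ∃ δ ∈ S.Dih, (δ.1 x, δ.2 t) ∈ D ×ˢ K
    · obtain ⟨δ, hδ, hx, ht⟩ := h
      obtain ⟨ε, m, hε, hδ2⟩ := Dih.exists_affine hδ
      exact ⟨conjHom δ.2 f, conjHom_mem_DD hε hδ2 hfD,
        hB.eventually_of_mem hD.isOpen hδ hx (hKU ht)⟩
    · push Not at h
      exact ⟨1, one_mem _, hB.eventually_of_notMem hD.isClosed hK hfK h⟩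
  refine ⟨fun x t => ?_, fun x t => ?_, fun δ hδ x t => ?_⟩
  · obtain ⟨g, hg, h⟩ := key x t
    exact (hg t).congr ((hr x t).eventually h)
  · obtain ⟨g, hg, h⟩ := key x t
    have hc : Tendsto (fun p : X × ℝ => (x, p.2)) (𝓝 (x, t)) (𝓝 (x, t)) :=
      (continuous_const.prodMk continuous_snd).tendsto (x, t)
    filter_upwards [h, hc.eventually h] with p h1 h2
    rw [h1, h2]
  · by_cases h : ∃ η ∈ S.Dih, (η.1 x, η.2 t) ∈ D ×ˢ Ioo a b
    · obtain ⟨η, hη, hx, ht⟩ := h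
      have e1 : (η * δ⁻¹).1 (δ.1 x) = η.1 x := congrArg η.1 (δ.1.symm_apply_apply x)
      have e2 : ∀ s, (η * δ⁻¹).2 (δ.2 s) = η.2 s := fun s =>
        congrArg η.2 (δ.2.symm_apply_apply s)
      have := hB.1 (η * δ⁻¹) (mul_mem hη (inv_mem hδ)) (δ.1 x) (δ.2 t) (by rwa [e1]) (by rwa [e2])
      refine (η * δ⁻¹).2.injective ?_
      rw [this, e2, e2, hB.1 η hη x t hx ht]
    · push Not at h
      rw [hB.2 x t h, hB.2]
      exact fun η hη => h (η * δ) (mul_mem hη hδ)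

/-! ### Bumps as products of commutators. -/

theorem mem_commutator_of_mem {G : Type*} [Group G] {H : Subgroup G} {x : H}
    (hx : (x : G) ∈ ⁅H, H⁆) : x ∈ commutator H := by
  rw [← Subgroup.map_subtype_commutator] at hx
  obtain ⟨y, hy, he⟩ := hx
  rwa [← Subtype.ext he]

theorem map_mem_commutator {G G' : Type*} [Group G] [Group G'] (Φ : G →* G') {x : G}
    (hx : x ∈ commutator G) : Φ x ∈ commutator G' := by
  have := Subgroup.mem_map_of_mem Φ hx
  rw [commutator_def, Subgroup.map_commutator] at this
  exact Subgroup.commutator_mono le_top le_top this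

/-- For a fixed box, `f ↦` bump is a homomorphism, by uniqueness of bumps. Its source `Dc (Ioo a b)`
is perfect, so its image lies in the commutator subgroup. -/
theorem exists_bump (hD : IsClopen D) (hab : a < b) (hfree : S.IsFree (D ×ˢ Ioo a b)) {f : ℝ ≃o ℝ}
    (hf : f ∈ Dc (Ioo a b)) : ∃ B : S.lifts, B ∈ commutator S.lifts ∧ S.IsBump D a b f B := by
  choose B hB using fun f : Dc (Ioo a b) => exists_isBump hfree f.2.2
  let Φ : Dc (Ioo a b) →* S.lifts := MonoidHom.mk' (fun f => ⟨B f, (hB f).mem_lifts hD f.2⟩)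
    fun f g => Subtype.ext ((hB (f * g)).unique ((hB f).mul (hB g) g.2.2))
  exact ⟨Φ ⟨f, hf⟩, map_mem_commutator Φ (mem_commutator_of_mem (Dc_Ioo_le_commutator hab hf)),
    hB _⟩

end Bump

/-! ### Simultaneous bumps over all of `X`. -/

section Bumps

variable {X : Type*} [TopologicalSpace X] {S : ReversibleSystem X} {𝒱 : Set (Set (X × ℝ))}

variable (S) in
/-- The subgroup of lifts generated by the products of commutators supported in a member
of `𝒱`. -/
def fragGroup (𝒱 : Set (Set (X × ℝ))) : Subgroup S.lifts :=
  Subgroup.closure {B | B ∈ commutator S.lifts ∧ ∃ V ∈ 𝒱, ∀ x t, B.1 x t ≠ t → (x, t) ∈ V}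

variable (S) in
/-- `V` is a union of orbits. -/
def IsSaturated (V : Set (X × ℝ)) : Prop :=
  ∀ δ ∈ S.Dih, ∀ x t, (δ.1 x, δ.2 t) ∈ V → (x, t) ∈ V

variable [CompactSpace X]

/-- A family `f` that is locally constant in `x` is realised by finitely many bumps over disjoint
clopen sets. Freeness of `W` keeps bumps over disjoint sets from acting on each other's part of `W`.
-/
theorem exists_bumps (h𝒱 : ∀ V ∈ 𝒱, S.IsSaturated V) {W : Set (X × ℝ)} (hW : S.IsFree W)
    {f : X → (ℝ ≃o ℝ)} (hloc : ∀ x, ∃ E, IsClopen E ∧ x ∈ E ∧ ∃ a b : ℝ,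
      (∀ y ∈ E, f y = f x ∧ ∀ t, (y, t) ∈ W ↔ t ∈ Ioo a b) ∧
      (f x = 1 ∨ a < b ∧ f x ∈ Dc (Ioo a b) ∧ ∃ V ∈ 𝒱, E ×ˢ Ioo a b ⊆ V)) :
    ∃ h ∈ S.fragGroup 𝒱, (∀ x t, (x, t) ∈ W → h.1 x t = f x t) ∧ S.FixesOff W h.1 := by
  have hfW : ∀ x t, (x, t) ∈ W → (x, f x t) ∈ W := by
    intro x t ht
    obtain ⟨E, -, hx, a, b, hE, h⟩ := hloc x
    rw [(hE x hx).2] at ht ⊢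
    rcases h with h | ⟨-, h, -⟩
    · rwa [h]
    · exact (mem_Ioo_iff_of_mem_Kc h.2 t).2 ht
  -- The claim is strengthened to every clopen subset `D` of `E`, so that for a union it can be
  -- applied to the disjoint pieces `D ∩ E` and `D \ E`.
  suffices ∃ E : Set X, IsClopen E ∧ univ ⊆ E ∧ ∀ D, IsClopen D → D ⊆ E → ∃ h ∈ S.fragGroup 𝒱,
      (∀ x ∈ D, ∀ t, (x, t) ∈ W → h.1 x t = f x t) ∧ S.FixesOff (W ∩ D ×ˢ univ) h.1 by
    obtain ⟨E, hE, hu, h⟩ := this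
    obtain ⟨h, hh, h1, h2⟩ := h E hE Subset.rfl
    exact ⟨h, hh, fun x => h1 x (hu trivial), fun x t ht => h2 x t fun δ hδ hd => ht δ hδ hd.1⟩
  refine isCompact_univ.induction_on (p := fun s => ∃ E : Set X, IsClopen E ∧ s ⊆ E ∧
    ∀ D, IsClopen D → D ⊆ E → ∃ h ∈ S.fragGroup 𝒱, (∀ x ∈ D, ∀ t, (x, t) ∈ W → h.1 x t = f x t) ∧
      S.FixesOff (W ∩ D ×ˢ univ) h.1) ?_ ?_ ?_ ?_
  · exact ⟨∅, isClopen_empty, Subset.rfl, fun D _ hD => ⟨1, one_mem _,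
      fun x hx => absurd (hD hx) (notMem_empty x), fun _ _ _ => rfl⟩⟩
  · rintro s t hst ⟨E, hE, ht, h⟩
    exact ⟨E, hE, hst.trans ht, h⟩
  · rintro s t ⟨E, hE, hs, h⟩ ⟨E', hE', ht, h'⟩
    refine ⟨E ∪ E', hE.union hE', union_subset_union hs ht, fun D hD hDE => ?_⟩
    obtain ⟨k, hk, k1, k2⟩ := h (D ∩ E) (hD.inter hE) inter_subset_right
    obtain ⟨l, hl, l1, l2⟩ := h' (D \ E) (hD.diff hE) fun x hx => (hDE hx.1).resolve_left hx.2
    have excl : ∀ (A B : Set X), Disjoint A B → ∀ x ∈ A, ∀ t, (x, t) ∈ W →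
        ∀ δ ∈ S.Dih, (δ.1 x, δ.2 t) ∉ W ∩ B ×ˢ univ := by
      intro A B hAB x hx t ht δ hδ h
      obtain rfl := hW δ hδ x t ht h.1
      exact disjoint_left.1 hAB hx h.2.1
    have hdis : Disjoint (D ∩ E) (D \ E) := disjoint_left.2 fun x hx hx' => hx'.2 hx.2
    refine ⟨k * l, mul_mem hk hl, fun x hx t ht => ?_, fun x t hxt => ?_⟩
    · change k.1 x (l.1 x t) = f x t
      by_cases hxE : x ∈ E
      · rw [l2 x t (excl _ _ hdis x ⟨hx, hxE⟩ t ht), k1 x ⟨hx, hxE⟩ t ht]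
      · rw [l1 x ⟨hx, hxE⟩ t ht, k2 x _ (excl _ _ hdis.symm x ⟨hx, hxE⟩ _ (hfW x t ht))]
    · change k.1 x (l.1 x t) = t
      rw [l2 x t fun δ hδ h => hxt δ hδ ⟨h.1, h.2.1.1, h.2.2⟩,
        k2 x t fun δ hδ h => hxt δ hδ ⟨h.1, h.2.1.1, h.2.2⟩]
  · intro x _
    obtain ⟨E, hE, hx, a, b, hE', h⟩ := hloc x
    refine ⟨E, mem_nhdsWithin_of_mem_nhds (hE.isOpen.mem_nhds hx), E, hE, Subset.rfl,
      fun D hD hDE => ?_⟩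
    rcases h with h | ⟨hab, hf, V, hV, hEV⟩
    · exact ⟨1, one_mem _, fun y hy t _ => by rw [(hE' y (hDE hy)).1, h]; rfl, fun _ _ _ => rfl⟩
    · have hDW : D ×ˢ Ioo a b ⊆ W := fun p hp => ((hE' p.1 (hDE hp.1)).2 p.2).2 hp.2
      obtain ⟨B, hB, hB1, hB2⟩ := exists_bump hD hab (hW.mono hDW) hf
      refine ⟨B, Subgroup.subset_closure ⟨hB, V, hV, fun y t hyt => ?_⟩, fun y hy t ht => ?_,
        fun y t hyt => hB2 y t fun δ hδ hd => hyt δ hδ ⟨hDW hd, hd.1, trivial⟩⟩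
      · by_contra hn
        exact hyt (hB2 y t fun δ hδ hd => hn (h𝒱 V hV δ hδ y t (hEV ⟨hDE hd.1, hd.2⟩)))
      · rw [(hE' y (hDE hy)).1]
        exact hB1 1 (one_mem _) y t hy (((hE' y (hDE hy)).2 t).1 ht)

-- Off the translates of `W` the map `h` is the identity; on them, equivariance of `h` and `F`
-- reduces the claim to points of `W`.
omit [CompactSpace X] in
theorem fix_of_fixesOff {W : Set (X × ℝ)} {F h : S.lifts} {f : X → (ℝ ≃o ℝ)}
    (h1 : ∀ x t, (x, t) ∈ W → h.1 x t = f x t) (h2 : S.FixesOff W h.1)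
    (hf : ∀ x t, (x, t) ∈ W → F.1 x t = t → f x t = t) {x : X} {t : ℝ} (hF : F.1 x t = t) :
    h.1 x t = t := by
  by_cases hv : ∃ δ ∈ S.Dih, (δ.1 x, δ.2 t) ∈ W
  · obtain ⟨δ, hδ, hd⟩ := hv
    refine δ.2.injective ?_
    rw [← h.2.2.2 δ hδ, h1 _ _ hd, hf _ _ hd]
    rw [F.2.2.2 δ hδ, hF]
  · push Not at hv
    exact h2 x t hv

/-! ### Matching a lift on larger and larger sets. -/

variable (S) in
/-- Every lift that is the identity off `O` and on `X × Λ` agrees on `Q` with a member of the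
fragmentation group that has all the fixed points of the given lift. -/
def Matches (𝒱 : Set (Set (X × ℝ))) (O : Set (X × ℝ)) (Λ : Set ℝ) (Q : Set (X × ℝ)) : Prop :=
  ∀ F : S.lifts, (∀ x t, F.1 x t ≠ t → (x, t) ∈ O) → (∀ x, ∀ t ∈ Λ, F.1 x t = t) →
    ∃ h ∈ S.fragGroup 𝒱, (∀ x t, F.1 x t = t → h.1 x t = t) ∧ ∀ x t, (x, t) ∈ Q → h.1 x t = F.1 x t

variable {O Q Q' : Set (X × ℝ)} {Λ : Set ℝ}

omit [CompactSpace X] in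
theorem Matches.mono (h : S.Matches 𝒱 O Λ Q) (hQ : Q' ⊆ Q) : S.Matches 𝒱 O Λ Q' := by
  intro F hF hΛ
  obtain ⟨h, hh, h1, h2⟩ := h F hF hΛ
  exact ⟨h, hh, h1, fun x t ht => h2 x t (hQ ht)⟩

omit [CompactSpace X] in
theorem Matches.empty : S.Matches 𝒱 O Λ ∅ :=
  fun _ _ _ => ⟨1, one_mem _, fun _ _ _ => rfl, fun _ _ h => absurd h (notMem_empty _)⟩

omit [CompactSpace X] in
theorem inv_mul_fix {F h : S.lifts} {x : X} {s t : ℝ} (hh : h.1 x t = F.1 x s) :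
    (h⁻¹ * F).1 x s = t := (h.1 x).symm_apply_eq.2 hh.symm

-- Match `F` on `Q` by `k`, then match `k⁻¹ * F` on `Q'` by `l`. As `k` has all fixed points of `F`,
-- the remainder satisfies the same hypotheses; as it is the identity on `Q`, the second factor
-- fixes `Q` and does not spoil the first match.
omit [CompactSpace X] in
theorem Matches.union (h : S.Matches 𝒱 O Λ Q) (h' : S.Matches 𝒱 O Λ Q') :
    S.Matches 𝒱 O Λ (Q ∪ Q') := by
  intro F hF hΛ
  obtain ⟨k, hk, k1, k2⟩ := h F hF hΛ
  have hfix : ∀ x t, F.1 x t = t → (k⁻¹ * F).1 x t = t := fun x t ht =>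
    inv_mul_fix ((k1 x t ht).trans ht.symm)
  obtain ⟨l, hl, l1, l2⟩ := h' (k⁻¹ * F) (fun x t ht => hF x t fun h => ht (hfix x t h))
    fun x t ht => hfix x t (hΛ x t ht)
  refine ⟨k * l, mul_mem hk hl, fun x t ht => ?_, fun x t ht => ?_⟩
  · change k.1 x (l.1 x t) = t
    rw [l1 x t (hfix x t ht), k1 x t ht]
  · change k.1 x (l.1 x t) = F.1 x t
    rcases ht with ht | ht
    · rw [l1 x t (inv_mul_fix (k2 x t ht)), k2 x t ht]
    · rw [l2 x t ht]
      exact (k.1 x).apply_symm_apply _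

omit [CompactSpace X] in
theorem Matches.biUnion {ι : Type*} (s : Finset ι) {Q : ι → Set (X × ℝ)}
    (h : ∀ i ∈ s, S.Matches 𝒱 O Λ (Q i)) : S.Matches 𝒱 O Λ (⋃ i ∈ s, Q i) := by
  classical
  induction s using Finset.induction_on with
  | empty => simpa using Matches.empty
  | insert i s _ ih =>
    rw [Finset.set_biUnion_insert]
    exact (h i (Finset.mem_insert_self i s)).union
      (ih fun j hj => h j (Finset.mem_insert_of_mem hj))

theorem Matches.of_local {T : Set ℝ} (h : ∀ x, ∃ C ∈ 𝓝 x, S.Matches 𝒱 O Λ (C ×ˢ T)) :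
    S.Matches 𝒱 O Λ (univ ×ˢ T) := by
  refine isCompact_univ.induction_on (p := fun s => S.Matches 𝒱 O Λ (s ×ˢ T)) ?_ ?_ ?_ ?_
  · rw [empty_prod]; exact Matches.empty
  · exact fun s t hst h => h.mono (prod_mono_left hst)
  · intro s t hs ht
    rw [union_prod]
    exact hs.union ht
  · intro x _
    obtain ⟨C, hC, h⟩ := h x
    exact ⟨C, mem_nhdsWithin_of_mem_nhds hC, h⟩

end Bumps

/-! ### Moving a section -/

section Move

variable {X : Type*} [TopologicalSpace X] {S : ReversibleSystem X}

/-- A translation moves `c` by a nonzero integer. A flip moves it by `2 * c + n`, which stays at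
least the distance from `2 * c` to the integers. -/
theorem Dih.exists_gap {c : ℝ} (hc : ∀ m : ℤ, 2 * c ≠ m) :
    ∃ g > 0, ∀ δ ∈ S.Dih, δ ≠ 1 → g ≤ |δ.2 c - c| := by
  have hf0 : 0 < Int.fract (2 * c) := lt_of_le_of_ne (Int.fract_nonneg _) fun h =>
    hc ⌊2 * c⌋ (by have := Int.self_sub_floor (2 * c); linarith)
  have hf1 := Int.fract_lt_one (2 * c)
  refine ⟨min (Int.fract (2 * c)) (1 - Int.fract (2 * c)), lt_min hf0 (by linarith), ?_⟩
  rintro δ ⟨n, ⟨h1, h2⟩ | ⟨h1, h2⟩⟩ hne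
  · have hn : n ≠ 0 := by
      rintro rfl
      refine hne (Prod.ext (by simpa using h1) (Homeomorph.ext fun s => ?_))
      rw [h2]; simp
    have h3 : (1 : ℝ) ≤ |(n : ℝ)| := by exact_mod_cast Int.one_le_abs hn
    rw [h2, show c - n - c = -(n : ℝ) by ring, abs_neg]
    exact (min_le_right _ _).trans (by linarith)
  · have e : δ.2 c - c = -((Int.fract (2 * c)) + ((⌊2 * c⌋ + n : ℤ) : ℝ)) := by
      rw [h2]
      have := Int.floor_add_fract (2 * c)
      push_cast
      linarith
    rw [e, abs_neg]
    rcases le_or_gt 0 (⌊2 * c⌋ + n) with h | h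
    · have : (0 : ℝ) ≤ ((⌊2 * c⌋ + n : ℤ) : ℝ) := by exact_mod_cast h
      exact (min_le_left _ _).trans ((by linarith : _ ≤ _).trans (le_abs_self _))
    · have : ((⌊2 * c⌋ + n : ℤ) : ℝ) ≤ -1 := by exact_mod_cast (by omega : ⌊2 * c⌋ + n ≤ -1)
      exact (min_le_right _ _).trans ((by linarith : _ ≤ _).trans (neg_le_abs _))

/-- The map is chosen as a function of `c` and `c'` alone, so locally constant data give a locally
constant family. For equal points, or inadmissible data, it is the identity. -/
theorem exists_PL_step {ρ : ℝ} (c c' : ℝ) : ∃ f : ℝ ≃o ℝ,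
    (IsDyadic c → IsDyadic c' → |c' - c| < ρ → f ∈ Dc (Ioo (c - ρ) (c + ρ)) ∧ f c = c') ∧
      (c = c' → f = 1) := by
  by_cases h : c = c'
  · refine ⟨1, fun _ _ _ => ⟨one_mem _, h⟩, fun _ => rfl⟩
  by_cases h' : IsDyadic c ∧ IsDyadic c' ∧ |c' - c| < ρ
  · obtain ⟨hc, hc', hρ⟩ := h'
    rw [abs_lt] at hρ
    obtain ⟨p, hp, hp1, hp2⟩ := exists_isDyadic_btwn
      (show c - ρ < min c c' from lt_min (by linarith) (by linarith))
    obtain ⟨q, hq, hq1, hq2⟩ := exists_isDyadic_btwn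
      (show max c c' < c + ρ from max_lt (by linarith) (by linarith))
    obtain ⟨f, hf, hfc, hfo⟩ := exists_PL_move hp hq hc hc' (hp2.trans_le (min_le_left _ _))
      (hp2.trans_le (min_le_right _ _)) ((le_max_left _ _).trans_lt hq1)
      ((le_max_right _ _).trans_lt hq1)
    exact ⟨f, fun _ _ _ => ⟨⟨PL_le_DD hf, mem_Kc_of_Ioo
      (fun t ht => ⟨hp1.trans_le ht.1, ht.2.trans_lt hq2⟩) hfo⟩, hfc⟩, fun e => absurd e h⟩
  · exact ⟨1, fun h1 h2 h3 => absurd ⟨h1, h2, h3⟩ h', fun _ => rfl⟩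

/-- For `u > 0`, monotonicity sends a point of the segment strictly beyond `f c`, in the direction
in which `c` moves. -/
theorem segment_moved {f : ℝ ≃o ℝ} {c u : ℝ} (hu : u ∈ Icc (0 : ℝ) 1) (hc : f c ≠ c) :
    f (c + u * (f c - c)) ≠ c + u * (f c - c) := by
  rcases hu.1.eq_or_lt with rfl | hu0
  · simpa using hc
  rcases lt_or_gt_of_ne hc with h | h
  · have h1 : f (c + u * (f c - c)) < f c := f.strictMono (by nlinarith)
    have := hu.2
    nlinarith
  · have h1 : f c < f (c + u * (f c - c)) := f.strictMono (by nlinarith)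
    have := hu.2
    nlinarith

theorem eventually_apply_eq (F : S.lifts) (x : X) (t : ℝ) : ∀ᶠ y in 𝓝 x, F.1 y t = F.1 x t :=
  ((continuous_id.prodMk continuous_const).tendsto x).eventually (F.2.2.1 x t)

theorem continuous_apply (F : S.lifts) (t : ℝ) : Continuous fun x => F.1 x t :=
  (lifts.continuous F.2).comp (continuous_id.prodMk continuous_const)

variable [CompactSpace X] [TopologicalSpace.MetrizableSpace X] [TotallyDisconnectedSpace X]
  {𝒱 : Set (Set (X × ℝ))}

/-- The wall `X × {c}` is carried to its image under `F` through the interpolated sections `P u`.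
Each short step is a family of bumps in a thin free tube around the current section. Points fixed by
`F` stay fixed, because the tube meets only moved points wherever the step is nontrivial. -/
theorem exists_move (h𝒱 : ∀ V ∈ 𝒱, IsOpen V ∧ S.IsSaturated V) (F : S.lifts)
    (hF : ∀ x t, F.1 x t ≠ t → ∃ V ∈ 𝒱, (x, t) ∈ V) {c : ℝ} (hcd : IsDyadic c)
    (hc : ∀ m : ℤ, 2 * c ≠ m) : ∃ h ∈ S.fragGroup 𝒱, (∀ x t, F.1 x t = t → h.1 x t = t) ∧
      ∀ x, h.1 x c = F.1 x c := by
  let := TopologicalSpace.metrizableSpaceMetric X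
  have hFc := continuous_apply F c
  set P : ℝ → X → ℝ := fun u x => c + u * (F.1 x c - c) with hP
  obtain ⟨g, hg, hgap⟩ := Dih.exists_gap (S := S) hc
  -- By compactness, `F x` keeps the images of `c - g`, `c` and `c + g` at least `η` apart,
  -- uniformly in `x`.
  obtain ⟨η, hη, hη'⟩ := isCompact_univ.exists_forall_le' (a := 0)
    (f := fun x => min (F.1 x (c + g) - F.1 x c) (F.1 x c - F.1 x (c - g)))
    (((continuous_apply F _).sub hFc).min (hFc.sub (continuous_apply F _))).continuousOn
    (fun x _ => lt_min (sub_pos.2 ((F.1 x).strictMono (by linarith)))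
      (sub_pos.2 ((F.1 x).strictMono (by linarith))))
  -- `δ` is affine and `F` equivariant, so `δ.2 (P u x)` interpolates between `δ.2 c` and `F.1 (δ.1
  -- x) (δ.2 c)`. Both endpoints lie on the same side of those of `P u (δ.1 x)`, at distances at
  -- least `g` and `η`, and convexity gives the bound.
  have sep : ∀ u ∈ Icc (0 : ℝ) 1, ∀ δ ∈ S.Dih, δ ≠ 1 → ∀ x,
      min g η ≤ |δ.2 (P u x) - P u (δ.1 x)| := by
    intro u hu δ hδ hne x
    have e : δ.2 (P u x) = δ.2 c + u * (F.1 (δ.1 x) (δ.2 c) - δ.2 c) := by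
      obtain ⟨ε, m, -, h⟩ := Dih.exists_affine hδ
      rw [F.2.2.2 δ hδ]
      simp only [hP, h]
      ring
    have h1 := hη' (δ.1 x) trivial
    have h2 := hgap δ hδ hne
    have hm1 := min_le_left g η
    have hm2 := min_le_right g η
    have key : ∀ A B : ℝ, min g η ≤ A → min g η ≤ B → min g η ≤ (1 - u) * A + u * B :=
      fun A B hA hB => by nlinarith [hu.1, hu.2]
    rw [e]
    simp only [hP]
    rcases le_abs.1 h2 with h2 | h2
    · have h3 : F.1 (δ.1 x) (c + g) ≤ F.1 (δ.1 x) (δ.2 c) := (F.1 _).monotone (by linarith)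
      have h4 := h1.trans (min_le_left _ _)
      refine le_trans (key _ _ (hm1.trans h2) (hm2.trans (h4.trans (sub_le_sub_right h3 _)))) ?_
      exact le_trans (le_of_eq (by ring)) (le_abs_self _)
    · have h3 : F.1 (δ.1 x) (δ.2 c) ≤ F.1 (δ.1 x) (c - g) := (F.1 _).monotone (by linarith)
      have h4 := h1.trans (min_le_right _ _)
      refine le_trans (key _ _ (hm1.trans h2) (hm2.trans (h4.trans (sub_le_sub_left h3 _)))) ?_
      exact le_trans (le_of_eq (by ring)) (neg_le_abs _)
  -- At fixed `c` the lift is locally constant in `x`, so the set moved is clopen. The segments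
  -- swept out over it then form a compact set, to which the Lebesgue number lemma applies.
  have hcl : IsClosed {x | F.1 x c ≠ c} := by
    refine isOpen_compl_iff.1 (isOpen_iff_mem_nhds.2 fun x hx => ?_)
    filter_upwards [eventually_apply_eq F x c] with y hy
    have hx' : F.1 x c = c := not_not.1 hx
    exact not_not.2 (hy.trans hx')
  have hO : IsOpen {p : X × ℝ | F.1 p.1 p.2 ≠ p.2} :=
    isOpen_ne_fun (lifts.continuous F.2) continuous_snd
  obtain ⟨r, hr, hball⟩ := lebesgue_number_lemma_of_metric
    (s := (fun p : X × ℝ => (p.1, P p.2 p.1)) '' ({x | F.1 x c ≠ c} ×ˢ Icc 0 1))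
    (c := fun V : 𝒱 => V.1 ∩ {p : X × ℝ | F.1 p.1 p.2 ≠ p.2})
    ((hcl.isCompact.prod isCompact_Icc).image (by fun_prop))
    (fun V => (h𝒱 V.1 V.2).1.inter hO) (by
      rintro _ ⟨⟨x, u⟩, ⟨hx, hu⟩, rfl⟩
      have h1 := segment_moved hu hx
      obtain ⟨V, hV, h⟩ := hF _ _ h1
      exact mem_iUnion.2 ⟨⟨V, hV⟩, h, h1⟩)
  -- `ρ ≤ r` keeps each tube ball over a moved point inside a member of `𝒱` and inside the moved
  -- set. `2 * ρ ≤ min g η` keeps the tube disjoint from its translates.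
  obtain ⟨ρ, hρ, hρr, hρg⟩ : ∃ ρ > 0, ρ ≤ r ∧ 2 * ρ ≤ min g η :=
    ⟨min r (min g η / 2), by positivity, min_le_left _ _, by
      have := min_le_right r (min g η / 2)
      linarith⟩
  obtain ⟨R, hR⟩ := isCompact_univ.exists_bound_of_continuousOn (hFc.sub continuous_const).continuousOn
    (f := fun x => F.1 x c - c)
  obtain ⟨l, hl⟩ := pow_unbounded_of_one_lt (R / ρ) (one_lt_two (α := ℝ))
  rw [div_lt_iff₀ hρ] at hl
  have hM : (0 : ℝ) < 2 ^ l := by positivity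
  choose mv hmv hmv1 using exists_PL_step (ρ := ρ)
  suffices ∀ i : ℕ, i ≤ 2 ^ l → ∃ h ∈ S.fragGroup 𝒱, (∀ x t, F.1 x t = t → h.1 x t = t) ∧
      ∀ x, h.1 x c = P (i / 2 ^ l) x by
    obtain ⟨h, hh, h1, h2⟩ := this (2 ^ l) le_rfl
    refine ⟨h, hh, h1, fun x => (h2 x).trans ?_⟩
    simp only [hP]
    push_cast
    rw [div_self hM.ne']
    ring
  intro i
  induction i with
  | zero => exact fun _ => ⟨1, one_mem _, fun _ _ _ => rfl, fun x => by simp [hP]⟩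
  | succ i ih =>
    intro hi
    obtain ⟨h, hh, h1, h2⟩ := ih (by omega)
    have hi' : (i : ℝ) + 1 ≤ 2 ^ l := by exact_mod_cast hi
    set u : ℝ := i / 2 ^ l with hu
    set u' : ℝ := ((i + 1 : ℕ) : ℝ) / 2 ^ l with hu'
    have hu01 : u ∈ Icc (0 : ℝ) 1 := ⟨by positivity, (div_le_one hM).2 (by linarith)⟩
    -- The number of steps is a power of `2` precisely so that all intermediate positions are
    -- dyadic.
    have hPd : ∀ (j : ℕ) x, IsDyadic (P (j / 2 ^ l) x) := fun j x =>
      hcd.add (IsDyadic.mul ⟨j, l, by simp⟩ ((DD.dyadic (F.2.1 x) hcd).sub hcd))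
    have hstep : ∀ x, |P u' x - P u x| < ρ := fun x => by
      have e : P u' x - P u x = (F.1 x c - c) / 2 ^ l := by
        simp only [hP, hu, hu']; push_cast; ring
      have h3 : |F.1 x c - c| ≤ R := hR x trivial
      rw [e, abs_div, abs_of_pos hM, div_lt_iff₀ hM]
      linarith
    have hPeq : ∀ x, P u x = P u' x ∨ ∃ V ∈ 𝒱, Metric.ball (x, P u x) ρ ⊆
        V ∩ {p : X × ℝ | F.1 p.1 p.2 ≠ p.2} := by
      intro x
      by_cases hx : F.1 x c = c
      · left; simp [hP, hx]
      · obtain ⟨V, hV⟩ := hball _ ⟨(x, u), ⟨hx, hu01⟩, rfl⟩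
        exact Or.inr ⟨V.1, V.2, (Metric.ball_subset_ball hρr).trans hV⟩
    let W : Set (X × ℝ) := {p | p.2 ∈ Ioo (P u p.1 - ρ) (P u p.1 + ρ)}
    have hWabs : ∀ x t, (x, t) ∈ W → |t - P u x| < ρ := fun x t ht =>
      abs_lt.2 ⟨by linarith [ht.1], by linarith [ht.2]⟩
    have hWfree : S.IsFree W := by
      intro δ hδ x t ht ht'
      by_contra hne
      have h3 := sep u hu01 δ hδ hne x
      have h4 := hWabs _ _ ht
      have h5 := hWabs _ _ ht'
      rw [← Dih.dist_apply hδ] at h4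
      have h6 := abs_sub_le (δ.2 (P u x)) (δ.2 t) (P u (δ.1 x))
      rw [abs_sub_comm] at h4
      linarith
    obtain ⟨k, hk, k1, k2⟩ := exists_bumps (fun V hV => (h𝒱 V hV).2) hWfree
      (f := fun x => mv (P u x) (P u' x)) (by
      intro x
      obtain ⟨E, hE, hxE, hEs⟩ := exists_isClopen_subset
        (inter_mem (Metric.ball_mem_nhds x hρ) (eventually_apply_eq F x c))
      have hv : ∀ y ∈ E, F.1 y c = F.1 x c := fun y hy => (hEs hy).2
      refine ⟨E, hE, hxE, P u x - ρ, P u x + ρ, fun y hy => ⟨?_, fun t => ?_⟩, ?_⟩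
      · simp only [hP, hv y hy]
      · change t ∈ Ioo (P u y - ρ) (P u y + ρ) ↔ _
        simp only [hP, hv y hy]
      · rcases hPeq x with he | ⟨V, hV, hVb⟩
        · exact Or.inl (hmv1 _ _ he)
        · refine Or.inr ⟨by linarith, (hmv _ _ (hPd _ _) (hPd _ _) (hstep x)).1, V, hV, ?_⟩
          rintro ⟨y, t⟩ ⟨hy, ht⟩
          refine (hVb ?_).1
          rw [← ball_prod_same, Real.ball_eq_Ioo]
          exact ⟨(hEs hy).1, ht⟩)
    refine ⟨k * h, mul_mem hk hh, fun x t ht => ?_, fun x => ?_⟩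
    · change k.1 x (h.1 x t) = t
      rw [h1 x t ht]
      refine fix_of_fixesOff k1 k2 (fun y s hys hs => ?_) ht
      rcases hPeq y with he | ⟨V, -, hVb⟩
      · rw [hmv1 _ _ he]; rfl
      · refine absurd hs (@hVb (y, s) ?_).2
        rw [← ball_prod_same, Real.ball_eq_Ioo]
        exact ⟨Metric.mem_ball_self hρ, hys⟩
    · change k.1 x (h.1 x c) = _
      rw [h2 x, k1 x _ ⟨by linarith, by linarith⟩]
      exact (hmv _ _ (hPd _ _) (hPd _ _) (hstep x)).2

end Move

end ReversibleSystem

/-! ### Restriction to an invariant interval -/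

theorem DD.exists_restrict {f : ℝ ≃o ℝ} (hf : f ∈ DD) {p q : ℝ} (hp : IsDyadic p) (hq : IsDyadic q)
    (hpq : p < q) (hfp : f p = p) (hfq : f q = q) :
    ∃ r ∈ DD, (∀ t ∈ Icc p q, r t = f t) ∧ ∀ t ∉ Ioo p q, r t = t := by
  have e1 : (1 : ℝ ≃o ℝ) p = f p := hfp.symm
  have e2 : glue 1 f p e1 q = (1 : ℝ ≃o ℝ) q := (glue_of_ge e1 hpq.le).trans hfq
  refine ⟨glue _ 1 q e2, glue_mem_DD e2 hq (glue_mem_DD e1 hp (one_mem _) hf) (one_mem _),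
    fun t ht => ?_, fun t ht => ?_⟩
  · rw [glue_of_le e2 ht.2, glue_of_ge e1 ht.1]
  · rcases le_or_gt t p with h | h
    · rw [glue_of_le e2 (h.trans hpq.le), glue_of_le e1 h]; rfl
    · have : q ≤ t := not_lt.1 fun h' => ht ⟨h, h'⟩
      rw [glue_of_ge e2 this]; rfl

namespace ReversibleSystem

/-! ### Cutting along walls: fragmentation of lifts. -/

section Fragmentation

variable {X : Type*} [TopologicalSpace X] {S : ReversibleSystem X}

theorem eventually_forall_apply_eq (F : S.lifts) (x : X) {K : Set ℝ} (hK : IsCompact K) :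
    ∀ᶠ y in 𝓝 x, ∀ t ∈ K, F.1 y t = F.1 x t :=
  hK.eventually_forall_of_forall_eventually fun t _ => F.2.2.1 x t

variable [CompactSpace X] {𝒱 : Set (Set (X × ℝ))} {O : Set (X × ℝ)} {Λ : Set ℝ}

/-- `F` fixes the walls at `p` and `q`, so its restriction to `[p, q]`, extended by the identity, is
compactly supported in `(a, b)` and is realised by bumps. If the box misses `O`, the restriction is
trivial. -/
theorem matches_cell [T2Space X] [TotallyDisconnectedSpace X] (h𝒱 : ∀ V ∈ 𝒱, S.IsSaturated V)
    {C : Set X} (hC : IsClopen C) {a p q b : ℝ} (hp : IsDyadic p)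
    (hq : IsDyadic q) (hap : a < p) (hpq : p < q) (hqb : q < b) (hpΛ : p ∈ Λ) (hqΛ : q ∈ Λ)
    (hfree : S.IsFree (C ×ˢ Ioo a b))
    (h : (∃ V ∈ 𝒱, C ×ˢ Ioo a b ⊆ V) ∨ Disjoint (C ×ˢ Ioo a b) O) :
    S.Matches 𝒱 O Λ (C ×ˢ Icc p q) := by
  classical
  intro F hF hΛ
  choose r hrD hr1 hr2 using fun x => DD.exists_restrict (F.2.1 x) hp hq hpq (hΛ x p hpΛ)
    (hΛ x q hqΛ)
  have hsub : Icc p q ⊆ Ioo a b := fun t ht => ⟨hap.trans_le ht.1, ht.2.trans_lt hqb⟩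
  -- The restriction depends only on the values of `F x` on `[p, q]`, which makes it locally
  -- constant in `x`.
  have hext : ∀ (x : X) (g : ℝ ≃o ℝ), (∀ t ∈ Icc p q, F.1 x t = g t) → (∀ t ∉ Ioo p q, g t = t) →
      r x = g := by
    intro x g h1 h2
    ext t
    by_cases ht : t ∈ Ioo p q
    · rw [hr1 x t (Ioo_subset_Icc_self ht), h1 t (Ioo_subset_Icc_self ht)]
    · rw [hr2 x t ht, h2 t ht]
  obtain ⟨k, hk, k1, k2⟩ := exists_bumps h𝒱 hfree (f := fun x => if x ∈ C then r x else 1) (by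
    intro x
    by_cases hx : x ∈ C
    · obtain ⟨E, hE, hxE, hEs⟩ := exists_isClopen_subset
        (inter_mem (hC.isOpen.mem_nhds hx) (eventually_forall_apply_eq F x (isCompact_Icc (a := p) (b := q))))
      refine ⟨E, hE, hxE, a, b, fun y hy => ⟨?_, fun t => ?_⟩, ?_⟩
      · simp only [if_pos hx, if_pos (hEs hy).1]
        exact hext y _ (fun t ht => ((hEs hy).2 t ht).trans (hr1 x t ht).symm) (hr2 x)
      · simp [(hEs hy).1]
      · simp only [if_pos hx]
        rcases h with ⟨V, hV, hCV⟩ | h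
        · exact Or.inr ⟨hap.trans (hpq.trans hqb), ⟨hrD x, mem_Kc_of_Ioo hsub (hr2 x)⟩, V, hV,
            (prod_mono_left fun y hy => (hEs hy).1).trans hCV⟩
        · refine Or.inl (hext x 1 (fun t ht => ?_) fun _ _ => rfl)
          by_contra hne
          exact disjoint_left.1 h (show (x, t) ∈ C ×ˢ Ioo a b from ⟨hx, hsub ht⟩) (hF x t hne)
    · refine ⟨Cᶜ, hC.compl, hx, 0, 0, fun y hy => ⟨?_, fun t => ?_⟩, Or.inl (if_neg hx)⟩
      · simp only [if_neg hx, if_neg hy]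
      · have hy' : y ∉ C := hy
        simp [hy'])
  refine ⟨k, hk, fun x t => fix_of_fixesOff k1 k2 fun y s hys hs => ?_, fun x t ht => ?_⟩
  · simp only [if_pos hys.1]
    by_cases h' : s ∈ Ioo p q
    · rw [hr1 y s (Ioo_subset_Icc_self h'), hs]
    · exact hr2 y s h'
  · rw [k1 x t ⟨ht.1, hsub ht.2⟩, if_pos ht.1, hr1 x t ht.2]

-- Integer translations carry every point into `X × [0, 1]`, so equivariance extends the equality.
omit [CompactSpace X] in
theorem eq_of_eq_on_Icc {F G : S.lifts}
    (h : ∀ x t, (x, t) ∈ (univ : Set X) ×ˢ Icc (0 : ℝ) 1 → F.1 x t = G.1 x t) : F = G := by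
  refine Subtype.ext (funext fun x => OrderIso.ext (funext fun t => ?_))
  have hδ : (S.φ ^ ⌊t⌋, Homeomorph.addRight (-(⌊t⌋ : ℝ))) ∈ S.Dih :=
    ⟨⌊t⌋, Or.inl ⟨rfl, fun t => rfl⟩⟩
  refine (Homeomorph.addRight (-(⌊t⌋ : ℝ))).injective ?_
  have h1 := F.2.2.2 _ hδ x t
  have h2 := G.2.2.2 _ hδ x t
  dsimp only at h1 h2
  rw [← h1, ← h2]
  refine h _ _ ⟨trivial, ?_⟩
  change t + -(⌊t⌋ : ℝ) ∈ Icc (0 : ℝ) 1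
  exact ⟨by linarith [Int.floor_le t], by linarith [Int.lt_floor_add_one t]⟩

variable [TopologicalSpace.MetrizableSpace X] [TotallyDisconnectedSpace X]

/-- First match `F` on finitely many walls. The quotient fixes the walls, so it can be matched cell
by cell over a fundamental domain, and there is nothing left. -/
theorem mem_fragGroup (h𝒱 : ∀ V ∈ 𝒱, IsOpen V ∧ S.IsSaturated V) (F : S.lifts)
    (hF : closure {p : X × ℝ | F.1 p.1 p.2 ≠ p.2} ⊆ ⋃₀ 𝒱) : F ∈ S.fragGroup 𝒱 := by
  let := TopologicalSpace.metrizableSpaceMetric X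
  set O := {p : X × ℝ | F.1 p.1 p.2 ≠ p.2} with hO
  let T : Set (Set (X × ℝ)) := {U | IsOpen U ∧ S.IsFree U ∧ ((∃ V ∈ 𝒱, U ⊆ V) ∨ Disjoint U O)}
  obtain ⟨r, hr, hball⟩ := lebesgue_number_lemma_of_metric (s := (univ : Set X) ×ˢ Icc (-1 : ℝ) 1)
    (c := fun U : T => U.1) (isCompact_univ.prod isCompact_Icc) (fun U => U.2.1) (by
      rintro ⟨x, t⟩ -
      obtain ⟨C, hC, hxC, hi⟩ := exists_injOn (S := S) x t
      have hfr := isFree_of_injOn hi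
      have hop : IsOpen (C ×ˢ Ioo (t - 1 / 4) (t + 1 / 4)) := hC.isOpen.prod isOpen_Ioo
      have hm : (x, t) ∈ C ×ˢ Ioo (t - 1 / 4) (t + 1 / 4) :=
        ⟨hxC, by simp only; linarith, by simp only; linarith⟩
      by_cases h : (x, t) ∈ closure O
      · obtain ⟨V, hV, hxV⟩ := hF h
        exact mem_iUnion.2 ⟨⟨_ ∩ V, hop.inter (h𝒱 V hV).1, hfr.mono inter_subset_left,
          Or.inl ⟨V, hV, inter_subset_right⟩⟩, hm, hxV⟩
      · exact mem_iUnion.2 ⟨⟨_ ∩ (closure O)ᶜ, hop.inter isClosed_closure.isOpen_compl,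
          hfr.mono inter_subset_left,
          Or.inr (disjoint_left.2 fun p hp hpO => hp.2 (subset_closure hpO))⟩, hm, h⟩)
  obtain ⟨k, hk⟩ := pow_unbounded_of_one_lt (1 / r) (one_lt_two (α := ℝ))
  have hM : (0 : ℝ) < 2 ^ (k + 1) := by positivity
  have hM1 : (1 : ℝ) ≤ 2 ^ k := one_le_pow₀ one_le_two
  have hkr : 1 / 2 ^ (k + 1) < r := by
    rw [div_lt_iff₀ hr] at hk
    rw [div_lt_iff₀ hM, pow_succ]
    nlinarith
  -- Odd numerators ensure that `2 * c m` is never an integer, as sliding requires. Consecutive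
  -- walls are `1 / 2 ^ (k + 1) < r` apart.
  let c : ℕ → ℝ := fun m => (2 * m - 1) / 2 ^ (k + 2)
  have hcs : ∀ m, c (m + 1) = c m + 1 / 2 ^ (k + 1) := fun m => by
    simp only [c, pow_succ]; push_cast; field_simp; ring
  have hcd : ∀ m, IsDyadic (c m) := fun m => ⟨2 * m - 1, k + 2, by simp [c]⟩
  have hch : ∀ m, ∀ n : ℤ, 2 * c m ≠ n := by
    intro m n h
    have h1 : ((2 * m - 1 : ℤ) : ℝ) = ((n * 2 ^ (k + 1) : ℤ) : ℝ) := by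
      push_cast
      rw [← h]
      simp only [c, pow_succ]
      field_simp
    have h2 : (2 * m - 1 : ℤ) = n * 2 ^ (k + 1) := by exact_mod_cast h1
    rw [pow_succ, ← mul_assoc] at h2
    omega
  -- The first wall lies just below `0`, so one cell more than `2 ^ (k + 1)` is needed to reach past
  -- `1`.
  let N := 2 ^ (k + 1) + 1
  let Λ : Set ℝ := c '' (Finset.range (N + 1))
  have hmv : S.Matches 𝒱 O ∅ (⋃ m ∈ Finset.range (N + 1), univ ×ˢ {c m}) := by
    refine Matches.biUnion _ fun m _ G hG _ => ?_
    obtain ⟨h, hh, h1, h2⟩ := exists_move h𝒱 G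
      (fun x t ht => hF (subset_closure (hG x t ht))) (hcd m) (hch m)
    refine ⟨h, hh, h1, fun x t ht => ?_⟩
    obtain rfl : t = c m := ht.2
    exact h2 x
  have hcell : S.Matches 𝒱 O Λ (⋃ m ∈ Finset.range N, univ ×ˢ Icc (c m) (c (m + 1))) := by
    refine Matches.biUnion _ fun m hm => Matches.of_local fun x => ?_
    rw [Finset.mem_range] at hm
    have hcm : c m ∈ Icc (-1 : ℝ) 1 := by
      have h1 : (m : ℝ) ≤ 2 ^ (k + 1) := by exact_mod_cast Nat.lt_succ_iff.1 hm
      have h2 : (0 : ℝ) ≤ m := by positivity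
      simp only [c]
      rw [pow_succ] at h1
      constructor
      · rw [le_div_iff₀ (by positivity), pow_succ, pow_succ]; linarith
      · rw [div_le_one (by positivity), pow_succ, pow_succ]; linarith
    obtain ⟨⟨U, _, hU, hU'⟩, hb⟩ := hball (x, c m) ⟨trivial, hcm⟩
    obtain ⟨C, hC, hxC, hCs⟩ := exists_isClopen_subset (Metric.ball_mem_nhds x hr)
    have hsub : C ×ˢ Ioo (c m - r) (c m + r) ⊆ U := by
      refine Subset.trans ?_ hb
      rw [← ball_prod_same, Real.ball_eq_Ioo]
      exact prod_mono_left hCs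
    have hpos : 0 < 1 / (2 : ℝ) ^ (k + 1) := by positivity
    refine ⟨C, hC.isOpen.mem_nhds hxC, matches_cell (fun V hV => (h𝒱 V hV).2) hC (hcd m)
      (hcd (m + 1)) (by linarith) (by rw [hcs]; linarith) (by rw [hcs]; linarith)
      (mem_image_of_mem c (by simp; omega)) (mem_image_of_mem c (by simp; omega)) (hU.mono hsub) ?_⟩
    rcases hU' with ⟨V, hV, h⟩ | h
    · exact Or.inl ⟨V, hV, hsub.trans h⟩
    · exact Or.inr (h.mono_left hsub)
  have hcover : (univ : Set X) ×ˢ Icc (0 : ℝ) 1 ⊆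
      ⋃ m ∈ Finset.range N, univ ×ˢ Icc (c m) (c (m + 1)) := by
    rintro ⟨x, t⟩ ⟨-, ht0, ht1⟩
    simp only at ht0 ht1
    have h0 : 0 ≤ t * 2 ^ (k + 1) + 1 / 2 := by positivity
    have h1 := Nat.floor_le h0
    have h2 := Nat.lt_floor_add_one (t * 2 ^ (k + 1) + 1 / 2)
    set m := ⌊t * 2 ^ (k + 1) + 1 / 2⌋₊ with hm
    refine mem_biUnion (x := m) ?_ ⟨trivial, ?_, ?_⟩
    · have h3 : (m : ℝ) < N := by
        simp only [N]
        push_cast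
        nlinarith
      simpa using h3
    · simp only [c]
      rw [div_le_iff₀ (by positivity), pow_succ]
      linarith
    · simp only [c]
      rw [le_div_iff₀ (by positivity), pow_succ]
      push_cast
      linarith
  -- `h` takes care of the walls. Then `h⁻¹ * F` fixes every wall and moves no point fixed by `F`,
  -- so the cell matching applies with the same `O`.
  obtain ⟨h, hh, h1, h2⟩ := hmv F (fun x t ht => ht) fun _ t ht => absurd ht (notMem_empty t)
  obtain ⟨l, hl, -, l2⟩ := (hcell.mono hcover) (h⁻¹ * F)
    (fun x t ht hFt => ht (inv_mul_fix ((h1 x t hFt).trans hFt.symm))) (by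
      rintro x _ ⟨m, hm, rfl⟩
      exact inv_mul_fix (h2 x _ (mem_biUnion hm ⟨trivial, rfl⟩)))
  rw [← mul_inv_cancel_left h F, ← eq_of_eq_on_Icc l2]
  exact mul_mem hh hl

/-! ### Descent to `Z`. -/

theorem mem_closure_supportedIn (hfree : Dense {x : X | x ∉ Function.periodicPts S.φ})
    (g : S.groupT) {𝒰 : Set (Set S.DihedralSuspension)} (h𝒰 : ∀ U ∈ 𝒰, IsOpen U)
    (hg : closure (supp (g : S.DihedralSuspension ≃ₜ S.DihedralSuspension)) ⊆ ⋃₀ 𝒰) :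
    g ∈ Subgroup.closure (⋃ U ∈ 𝒰, (S.supportedIn U : Set S.groupT)) := by
  obtain ⟨F, rfl⟩ := descend_surjective hfree g
  have hmem : F ∈ S.fragGroup ((fun U => S.π ⁻¹' U) '' 𝒰) := by
    refine mem_fragGroup ?_ F ?_
    · rintro _ ⟨U, hU, rfl⟩
      refine ⟨(h𝒰 U hU).preimage continuous_π, fun δ hδ x t h => ?_⟩
      rwa [mem_preimage, π_Dih hδ] at h
    · have hcl : closure {p : X × ℝ | F.1 p.1 p.2 ≠ p.2} ⊆
          S.π ⁻¹' closure (supp (descend S F).1) := by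
        refine closure_minimal ?_ (isClosed_closure.preimage continuous_π)
        rintro ⟨x, t⟩ hxt
        have hc : Tendsto (fun y => S.π (y, t)) (𝓝 x) (𝓝 (S.π (x, t))) :=
          (continuous_π.comp (continuous_id.prodMk continuous_const)).tendsto x
        refine mem_closure_iff_nhds.2 fun U hU => ?_
        obtain ⟨y, hy, h1, h2⟩ := exists_nonperiodic hfree
          ((eventually_apply_eq F x t).and (hc.eventually hU))
        refine ⟨_, h2, fun he => hxt ?_⟩
        rw [descend_π] at he
        exact h1.symm.trans (eq_of_π_eq hy he)
      refine (hcl.trans (preimage_mono hg)).trans ?_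
      rintro p ⟨U, hU, hp⟩
      exact ⟨_, ⟨U, hU, rfl⟩, hp⟩
  have := Subgroup.mem_map_of_mem (descend S) hmem
  rw [fragGroup, MonoidHom.map_closure] at this
  refine Subgroup.closure_mono ?_ this
  rintro _ ⟨B, ⟨-, _, ⟨U, hU, rfl⟩, hB⟩, rfl⟩
  refine mem_biUnion hU fun z hz => ?_
  obtain ⟨x, t, rfl⟩ := exists_rep z
  refine hB x t fun h => hz ?_
  rw [descend_π, h]

theorem isPerfect_groupT (hfree : Dense {x : X | x ∉ Function.periodicPts S.φ}) :
    Group.IsPerfect S.groupT := by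
  refine ⟨eq_top_iff.2 fun g _ => ?_⟩
  obtain ⟨F, rfl⟩ := descend_surjective hfree g
  refine map_mem_commutator _ ?_
  -- For the trivial cover, only the membership of the factors in the commutator subgroup matters.
  have hmem : F ∈ S.fragGroup {univ} := mem_fragGroup (by
    rintro _ rfl
    exact ⟨isOpen_univ, fun _ _ _ _ _ => trivial⟩) F (by simp)
  refine (Subgroup.closure_le _).2 ?_ hmem
  exact fun B hB => hB.1

end Fragmentation

end ReversibleSystem

end SolenoidalThompson

theorem proposition4p7 {X : Type*} [TopologicalSpace X] [CompactSpace X]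
    [TopologicalSpace.MetrizableSpace X] [TotallyDisconnectedSpace X]
    (S : SolenoidalThompson.ReversibleSystem X)
    (hfree : Dense {x : X | x ∉ Function.periodicPts S.φ}) :
    (∀ (g : S.groupT) (𝒰 : Set (Set S.DihedralSuspension)),
      (∀ U ∈ 𝒰, IsOpen U) →
      closure (SolenoidalThompson.ReversibleSystem.supp
        (g : S.DihedralSuspension ≃ₜ S.DihedralSuspension)) ⊆ ⋃₀ 𝒰 →
      g ∈ Subgroup.closure (⋃ U ∈ 𝒰, (S.supportedIn U : Set S.groupT))) ∧
    Group.IsPerfect S.groupT := by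
  exact ⟨fun g _ h𝒰 hg =>
    SolenoidalThompson.ReversibleSystem.mem_closure_supportedIn hfree g h𝒰 hg,
    SolenoidalThompson.ReversibleSystem.isPerfect_groupT hfree⟩
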